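/- **Conventions.** Let $\Delta$ be the open unit disk. A holomorphic function $f=\sum_{n\ge0}f_nz^n$ on $\Delta$ *has smooth boundary values* if it extends continuously to $\overline\Delta$ with $C^\infty$ restriction to $S^1$; put $f^*(z)=\sum \bar f_n z^{-n}$, so that $f^*=\bar f$ on $S^1$ and $f^*(\infty)=\overline{f(0)}$. For a loop $g$ put $g^{-*}=(g^{-1})^*$ (pointwise conjugate transpose of the inverse). A sequence $\eta_n=(\eta_n^-,\eta_n^+)\in\mathbb C^2$ is rapidly decreasing if $\sup_n n^k|\eta_n|<\infty$ for all $k$. For such a sequence with $1-\eta_n^-\eta_n^+\neq0$ for all $n$, an *admissible choice of roots* is a sequence $\mathbf a(\eta_n)$ with $\mathbf a(\eta_n)^2=(1-\eta_n^-\eta_n^+)^{-1}$ and $\mathbf a(\eta_n)\to1$. An *upper factor* is a matrix $\begin{pmatrix}\alpha&\beta\\\gamma&\delta\end{pmatrix}$ of holomorphic functions on $\Delta$ with smooth boundary values, with determinant $1$ on $\Delta$ and $\alpha(0)=\delta(0)=1$, $\gamma(0)=0$. **Theorem.** Let $g_1,g_2\in C^\infty(S^1,SL(2,\mathbb C))$.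 Consider the conditions: (I.1) $g_1=\begin{pmatrix}a_1&b_1\\c_1^*&d_1^*\end{pmatrix}$ on $S^1$, where $a_1,b_1,c_1,d_1$ are holomorphic in $\Delta$ with smooth boundary values, $a_1(0)=d_1^*(\infty)\ne0$, and neither $a_1,b_1$ nor $c_1,d_1$ vanish simultaneously at a point of $\Delta$. (I.2) There are a rapidly decreasing sequence $(\eta_n)_{n\ge0}$ in $\mathbb C^2$ with $1-\eta_n^-\eta_n^+\ne0$ for all $n$, and an admissible choice of roots, such that in $C^\infty(S^1,SL(2,\mathbb C))$ $$g_1(z)=\lim_{n\to\infty}\mathbf a(\eta_n)\begin{pmatrix}1&\eta_n^+z^n\\\eta_n^-z^{-n}&1\end{pmatrix}\cdots\mathbf a(\eta_0)\begin{pmatrix}1&\eta_0^+\\\eta_0^-&1\end{pmatrix}.$$ (I.3) There is a constant $\mathbf a_1\in\mathbb C\setminus\{0\}$ such that on $S^1$ $$g_1=\begin{pmatrix}1&0\\y^*&1\end{pmatrix}\begin{pmatrix}\mathbf a_1&0\\0&\mathbf a_1^{-1}\end{pmatrix}u,\qquad g_1^{-*}=\begin{pmatrix}1&0\\\mathbf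 y^*&1\end{pmatrix}\begin{pmatrix}\overline{\mathbf a_1}&0\\0&\overline{\mathbf a_1}^{-1}\end{pmatrix}u',$$ where $y,\mathbf y$ are holomorphic in $\Delta$ with smooth boundary values and $u,u'$ are upper factors. (II.1) $g_2=\begin{pmatrix}a_2^*&b_2^*\\c_2&d_2\end{pmatrix}$ on $S^1$, where $a_2,b_2,c_2,d_2$ are holomorphic in $\Delta$ with smooth boundary values, $b_2(0)=c_2(0)=0$, $a_2^*(\infty)=d_2(0)\ne0$, and neither $a_2,b_2$ nor $c_2,d_2$ vanish simultaneously at a point of $\Delta$. (II.2) There are a rapidly decreasing sequence $(\zeta_k)_{k\ge1}$ in $\mathbb C^2$ with $1-\zeta_k^-\zeta_k^+\ne0$ for all $k$, and an admissible choice of roots, such that in $C^\infty(S^1,SL(2,\mathbb C))$ $$g_2(z)=\lim_{n\to\infty}\mathbf a(\zeta_n)\begin{pmatrix}1&\zeta_n^-z^{-n}\\\zeta_n^+z^n&1\end{pmatrix}\cdots\mathbf a(\zeta_1)\begin{pmatrix}1&\zeta_1^-z^{-1}\\\zeta_1^+z&1\end{pmatrix}.$$ (II.3) There is a constant $\mathbf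 a_2\in\mathbb C\setminus\{0\}$ such that on $S^1$ $$g_2=\begin{pmatrix}1&x^*\\0&1\end{pmatrix}\begin{pmatrix}\mathbf a_2&0\\0&\mathbf a_2^{-1}\end{pmatrix}u,\qquad g_2^{-*}=\begin{pmatrix}1&\mathbf x^*\\0&1\end{pmatrix}\begin{pmatrix}\overline{\mathbf a_2}&0\\0&\overline{\mathbf a_2}^{-1}\end{pmatrix}u',$$ where $x,\mathbf x$ are holomorphic in $\Delta$ with smooth boundary values and vanish at $0$, and $u,u'$ are upper factors. Then: 1. For every rapidly decreasing $(\eta_n)_{n\ge0}$ with $1-\eta_n^-\eta_n^+\ne0$ for all $n$ and every admissible choice of roots, the limit in (I.2) exists in $C^\infty(S^1,SL(2,\mathbb C))$; similarly for $(\zeta_k)_{k\ge1}$ and the limit in (II.2). 2. (I.1) and (I.3) are equivalent, and (I.2) implies both. (II.1) and (II.3) are equivalent, and (II.2) implies both. 3. The converse holds generically. There are polynomials $m_k,p_k,q_k$ $(k\ge0)$ with complex coefficients, $q_k\ne0$, independent of $g_1$, in finitely many of the Laurent coefficients of $b_1/a_1$ at $0$ and of $c_1^*/d_1^*$ at $\infty$,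 such that for every $g_1$ satisfying (I.1): if $g_1$ has a factorization (I.2), then for all $k$ the polynomial $q_k$ does not vanish at the coefficients of $g_1$ and $\eta_k^-=m_k/q_k$, $\eta_k^+=p_k/q_k$ there; and if no $q_k$ vanishes at the coefficients of $g_1$, then $g_1$ satisfies (I.2). The same holds for $g_2$ satisfying (II.1), with $\zeta_k$ $(k\ge1)$ in place of $\eta_k$, (II.2) in place of (I.2), and the Laurent coefficients of $c_2/d_2$ at $0$ and of $b_2^*/a_2^*$ at $\infty$. -/

import Mathlib

open scoped ContDiff ComplexConjugate Matrix Topology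

namespace SLLoop

noncomputable section

/-- A (not yet smooth) loop `S¹ → SL(2,ℂ)`. -/
abbrev Loop := Circle → Matrix.SpecialLinearGroup (Fin 2) ℂ

/-- `g ∈ C^∞(S¹, SL(2,ℂ))`: every matrix entry is a smooth function of the angle. -/
def IsSmoothLoop (g : Loop) : Prop :=
  ∀ i j : Fin 2, ContDiff ℝ ∞ (fun θ : ℝ => (g (Circle.exp θ)).1 i j)

/-- The value at `z` of the loop `g^{-*} = (g^{-1})^*`. -/
def invStar (g : Loop) (z : Circle) : Matrix (Fin 2) (Fin 2) ℂ :=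
  ((g z)⁻¹).1ᴴ

/-- Holomorphic functions in the open unit disk `Δ` with smooth boundary values: `f` is holomorphic
in `Δ`, continuous up to the boundary, and its restriction to `S¹` is a smooth function of the
angle. (Values of `f` outside the closed disk are irrelevant.) -/
structure HolSmooth (f : ℂ → ℂ) : Prop where
  holomorphic : DifferentiableOn ℂ f (Metric.ball 0 1)
  continuous : ContinuousOn f (Metric.closedBall 0 1)
  smooth_boundary : ContDiff ℝ ∞ (fun θ : ℝ => f (Circle.exp θ))

/-- The `n`-th Taylor coefficient of `f` at `0`. -/
def taylorCoeff (f : ℂ → ℂ) (n : ℕ) : ℂ :=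
  iteratedDeriv n f 0 / (n.factorial : ℂ)

/-- The coefficients in `f = ∑ fₙ zⁿ` (`Sum.inl n`) and in `h^* = ∑ conj hₙ z^{-n}` (`Sum.inr n`). -/
def laurentData (f h : ℂ → ℂ) : ℕ ⊕ ℕ → ℂ :=
  Sum.elim (fun n => taylorCoeff f n) (fun n => conj (taylorCoeff h n))

/-- Convergence in `C^∞(S¹)`: all derivatives with respect to the angle of all matrix entries
converge uniformly. -/
def SmoothTendsto (G : ℕ → Circle → Matrix (Fin 2) (Fin 2) ℂ)
    (g : Circle → Matrix (Fin 2) (Fin 2) ℂ) : Prop :=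
  ∀ (m : ℕ) (i j : Fin 2),
    TendstoUniformly
      (fun (N : ℕ) (θ : ℝ) => iteratedDeriv m (fun t : ℝ => G N (Circle.exp t) i j) θ)
      (fun θ : ℝ => iteratedDeriv m (fun t : ℝ => g (Circle.exp t) i j) θ)
      Filter.atTop

/-- Rapidly decreasing sequences of pairs of complex numbers. -/
def RapidlyDecreasing (η : ℕ → ℂ × ℂ) : Prop :=
  ∀ k : ℕ, ∃ C : ℝ, ∀ n : ℕ, (n : ℝ) ^ k * ‖η n‖ ≤ C

/-! ### The first kind of loops

A pair is written `η = (η⁻, η⁺)`, so `η.1 = η⁻` and `η.2 = η⁺`. -/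

/-- On `S¹`, `g = [[a, b], [c^*, d^*]]` with `a, b, c, d` holomorphic in the disk with smooth
boundary values, `a(0) = d^*(∞) ≠ 0`, and such that neither `a, b` nor `c, d` vanish simultaneously
at a point of the disk. On `S¹`, `f^*` is the complex conjugate of `f`, and
`d^*(∞) = conj (d 0)`. -/
structure IsForm₁ (g : Loop) (a b c d : ℂ → ℂ) : Prop where
  hol_a : HolSmooth a
  hol_b : HolSmooth b
  hol_c : HolSmooth c
  hol_d : HolSmooth d
  eq_on_circle : ∀ z : Circle, (g z).1 = !![a z, b z; conj (c z), conj (d z)]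
  center : a 0 = conj (d 0)
  center_ne : a 0 ≠ 0
  no_common_zero_ab : ∀ z ∈ Metric.ball (0 : ℂ) 1, ¬ (a z = 0 ∧ b z = 0)
  no_common_zero_cd : ∀ z ∈ Metric.ball (0 : ℂ) 1, ¬ (c z = 0 ∧ d z = 0)

/-- Condition (I.1). -/
def CondI1 (g : Loop) : Prop := ∃ a b c d : ℂ → ℂ, IsForm₁ g a b c d

/-- `s · [[1, η⁺ zⁿ], [η⁻ z⁻ⁿ, 1]]`. -/
def rootFactor₁ (s : ℂ) (η : ℂ × ℂ) (n : ℕ) (z : ℂ) : Matrix (Fin 2) (Fin 2) ℂ :=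
  s • !![1, η.2 * z ^ n; η.1 * z ^ (-(n : ℤ)), 1]

/-- The ordered product of the factors with indices `N, N-1, …, 0`, in this order. -/
def rootProd₁ (s : ℕ → ℂ) (η : ℕ → ℂ × ℂ) : ℕ → Circle → Matrix (Fin 2) (Fin 2) ℂ
  | 0, z => rootFactor₁ (s 0) (η 0) 0 z
  | N + 1, z => rootFactor₁ (s (N + 1)) (η (N + 1)) (N + 1) z * rootProd₁ s η N z

/-- Admissible parameters: `η` is rapidly decreasing, `1 - η⁻η⁺ ≠ 0` for every index, and
`s n` is a square root of `(1 - η⁻η⁺)⁻¹` which is near `1` for large `n`. -/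
structure IsParam₁ (s : ℕ → ℂ) (η : ℕ → ℂ × ℂ) : Prop where
  rapid : RapidlyDecreasing η
  nondeg : ∀ n, 1 - (η n).1 * (η n).2 ≠ 0
  root : ∀ n, s n ^ 2 = (1 - (η n).1 * (η n).2)⁻¹
  root_tendsto : Filter.Tendsto s Filter.atTop (𝓝 1)

/-- `g` is the limit in `C^∞` of the ordered products with parameters `η` and roots `s`. -/
def IsRootFactorization₁ (g : Loop) (s : ℕ → ℂ) (η : ℕ → ℂ × ℂ) : Prop :=
  IsParam₁ s η ∧ SmoothTendsto (rootProd₁ s η) (fun z => (g z).1)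

/-- Condition (I.2). -/
def CondI2 (g : Loop) : Prop :=
  ∃ (s : ℕ → ℂ) (η : ℕ → ℂ × ℂ), IsRootFactorization₁ g s η

/-- A holomorphic map `[[α, β], [γ, δ]] : Δ → SL(2,ℂ)` with smooth boundary values which is
unipotent upper triangular at `0`. -/
structure IsUpperFactor (α β γ δ : ℂ → ℂ) : Prop where
  hol_α : HolSmooth α
  hol_β : HolSmooth β
  hol_γ : HolSmooth γ
  hol_δ : HolSmooth δ
  det_eq_one : ∀ z ∈ Metric.ball (0 : ℂ) 1, α z * δ z - β z * γ z = 1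
  α_zero : α 0 = 1
  γ_zero : γ 0 = 0
  δ_zero : δ 0 = 1

/-- The function `h` on `S¹` has a triangular factorization
`[[1, 0], [y^*, 1]] · diag(τ, τ⁻¹) · [[α, β], [γ, δ]]`, where
`y^* = ∑_{j ≥ 0} conj(y_j) z^{-j}`. -/
def HasTriangular₁ (h : Circle → Matrix (Fin 2) (Fin 2) ℂ) (τ : ℂ) : Prop :=
  ∃ y α β γ δ : ℂ → ℂ, HolSmooth y ∧ IsUpperFactor α β γ δ ∧
    ∀ z : Circle, h z =
      !![1, 0; conj (y z), 1] * !![τ, 0; 0, τ⁻¹] * !![α z, β z; γ z, δ z]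

/-- Condition (I.3); the diagonal constant for `g^{-*}` is the conjugate of the one for `g`. -/
def CondI3 (g : Loop) : Prop :=
  ∃ τ : ℂ, τ ≠ 0 ∧ HasTriangular₁ (fun z => (g z).1) τ ∧ HasTriangular₁ (invStar g) (conj τ)

/-! ### The second kind of loops

The sequences `ζ` are indexed by `k ≥ 1`; the entry of index `0` plays no role. -/

/-- On `S¹`, `g = [[a^*, b^*], [c, d]]` with `a, b, c, d` holomorphic in the disk with smooth
boundary values, `b(0) = c(0) = 0`, `a^*(∞) = d(0) ≠ 0`, and such that neither `a, b` nor `c, d`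
vanish simultaneously at a point of the disk. -/
structure IsForm₂ (g : Loop) (a b c d : ℂ → ℂ) : Prop where
  hol_a : HolSmooth a
  hol_b : HolSmooth b
  hol_c : HolSmooth c
  hol_d : HolSmooth d
  eq_on_circle : ∀ z : Circle, (g z).1 = !![conj (a z), conj (b z); c z, d z]
  b_zero : b 0 = 0
  c_zero : c 0 = 0
  center : conj (a 0) = d 0
  center_ne : d 0 ≠ 0
  no_common_zero_ab : ∀ z ∈ Metric.ball (0 : ℂ) 1, ¬ (a z = 0 ∧ b z = 0)
  no_common_zero_cd : ∀ z ∈ Metric.ball (0 : ℂ) 1, ¬ (c z = 0 ∧ d z = 0)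

/-- Condition (II.1). -/
def CondII1 (g : Loop) : Prop := ∃ a b c d : ℂ → ℂ, IsForm₂ g a b c d

/-- `s · [[1, ζ⁻ z⁻ⁿ], [ζ⁺ zⁿ, 1]]`. -/
def rootFactor₂ (s : ℂ) (ζ : ℂ × ℂ) (n : ℕ) (z : ℂ) : Matrix (Fin 2) (Fin 2) ℂ :=
  s • !![1, ζ.1 * z ^ (-(n : ℤ)); ζ.2 * z ^ n, 1]

/-- The ordered product of the factors with indices `N, N-1, …, 1`, in this order. -/
def rootProd₂ (s : ℕ → ℂ) (ζ : ℕ → ℂ × ℂ) : ℕ → Circle → Matrix (Fin 2) (Fin 2) ℂ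
  | 0, _ => 1
  | N + 1, z => rootFactor₂ (s (N + 1)) (ζ (N + 1)) (N + 1) z * rootProd₂ s ζ N z

/-- Admissible parameters for the second kind of products. -/
structure IsParam₂ (s : ℕ → ℂ) (ζ : ℕ → ℂ × ℂ) : Prop where
  rapid : RapidlyDecreasing ζ
  nondeg : ∀ n, 1 ≤ n → 1 - (ζ n).1 * (ζ n).2 ≠ 0
  root : ∀ n, 1 ≤ n → s n ^ 2 = (1 - (ζ n).1 * (ζ n).2)⁻¹
  root_tendsto : Filter.Tendsto s Filter.atTop (𝓝 1)

/-- `g` is the limit in `C^∞` of the ordered products with parameters `ζ` and roots `s`. -/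
def IsRootFactorization₂ (g : Loop) (s : ℕ → ℂ) (ζ : ℕ → ℂ × ℂ) : Prop :=
  IsParam₂ s ζ ∧ SmoothTendsto (rootProd₂ s ζ) (fun z => (g z).1)

/-- Condition (II.2). -/
def CondII2 (g : Loop) : Prop :=
  ∃ (s : ℕ → ℂ) (ζ : ℕ → ℂ × ℂ), IsRootFactorization₂ g s ζ

/-- The function `h` on `S¹` has a triangular factorization
`[[1, x^*], [0, 1]] · diag(τ, τ⁻¹) · [[α, β], [γ, δ]]`, where
`x^* = ∑_{j ≥ 1} conj(x_j) z^{-j}`. -/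
def HasTriangular₂ (h : Circle → Matrix (Fin 2) (Fin 2) ℂ) (τ : ℂ) : Prop :=
  ∃ x α β γ δ : ℂ → ℂ, HolSmooth x ∧ x 0 = 0 ∧ IsUpperFactor α β γ δ ∧
    ∀ z : Circle, h z =
      !![1, conj (x z); 0, 1] * !![τ, 0; 0, τ⁻¹] * !![α z, β z; γ z, δ z]

/-- Condition (II.3); the diagonal constant for `g^{-*}` is the conjugate of the one for `g`. -/
def CondII3 (g : Loop) : Prop :=
  ∃ τ : ℂ, τ ≠ 0 ∧ HasTriangular₂ (fun z => (g z).1) τ ∧ HasTriangular₂ (invStar g) (conj τ)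

end

end SLLoop

/-! Everything is expressed through supports of Fourier coefficients on the circle. Smooth functions
have rapidly decreasing coefficients, a holomorphic function with smooth boundary values has no
negative ones, and every smooth function splits as `P + conj M` with `P`, `M` holomorphic.

Convergence of the products: in the `C^m` norm the `n`-th factor differs from the identity by an
amount of order `n ^ m * ‖η n‖`, which is summable, so the partial products stay bounded and their
differences are summable (`exists_smooth_limit`, `IsParam₁.exists_bddDeriv`).

Row conditions and triangular factorization: a first row `(a, b)` without zeros in the closed disk
is completed to a holomorphic matrix of determinant one by a Bezout equation in the disk algebra
(`exists_bezout`). The loop then differs from this matrix by a lower unipotent factor on the left,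
whose entry is split into `P + conj M` (`exists_row_reduction`). The same applies to `g^{-*}`, with
first row `(d, -c)`. Conversely, the two first rows of the triangular factorizations give back `a,
b, c, d`.

Root factorizations: multiplying a limit of root products on the right by the inverses of its first
`N` factors leaves a tail, whose off-diagonal Fourier coefficients begin at `±N` (`Tri`), with
leading terms determined by `η N` (`Lead`). These conditions are checked on finite products and pass
to the limit (`band_strip_rootProd₁`). At `N = 0` they give the holomorphy in the row conditions. A
common zero is impossible because the quotient of `g` by a late partial product is uniformly close
to the identity. `Lead` also expresses `η N` as a ratio of coefficients in which `a` and `d^*`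
cancel, so that the recursion can be run over a polynomial ring with denominators cleared (`Rows`,
`Matches.succ`).

For the converse, nonvanishing denominators produce a sequence `η` for which all stripped loops
satisfy `Tri` and `Lead`. The two triangular factorizations give a left multiplier `[[1, w], [-f,
1]]` taking `g` to the complementary support condition `CoTri` with constant diagonal coefficient
`κ`. It commutes with stripping on the right. Together the two conditions are a linear system for
each column in which only the coefficients of `f` and `w` of index at least `N` in absolute value
occur; for large `N` it is a contraction, so the stripped loops tend to `κ` times the identity and
`η` decreases rapidly (`tri_bounds`, `strip_decay`). Hence the product built from `η` converges to a
multiple of `g`; determinants make the multiple `±1`, and the sign goes into the first root. The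
second kind of loops is the first kind with trivial factor at index `0`, conjugated by the
antidiagonal permutation. -/

namespace SLLoop

noncomputable section

section

/-! ### Smooth functions on the circle and their Fourier coefficients -/

/-- Smoothness of a function on the circle, as a function of the angle. -/
def Sm (f : Circle → ℂ) : Prop := ContDiff ℝ ∞ (fun θ : ℝ => f (Circle.exp θ))

instance fact_two_pi_pos : Fact (0 < 2 * Real.pi) := ⟨Real.two_pi_pos⟩

lemma toCircle_mk (x : ℝ) : AddCircle.toCircle (x : AddCircle (2 * Real.pi)) = Circle.exp x := by
  rw [AddCircle.toCircle_apply_mk, div_self Real.two_pi_pos.ne', one_mul]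

namespace Sm

variable {f g : Circle → ℂ}

lemma const (c : ℂ) : Sm (fun _ => c) := contDiff_const

lemma add (hf : Sm f) (hg : Sm g) : Sm (fun z => f z + g z) := ContDiff.add hf hg

lemma sub (hf : Sm f) (hg : Sm g) : Sm (fun z => f z - g z) := ContDiff.sub hf hg

lemma neg (hf : Sm f) : Sm (fun z => -f z) := ContDiff.neg hf

lemma mul (hf : Sm f) (hg : Sm g) : Sm (fun z => f z * g z) := ContDiff.mul hf hg

lemma star (hf : Sm f) : Sm (fun z => conj (f z)) :=
  Complex.conjCLE.contDiff.comp hf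

lemma zpow (n : ℤ) : Sm (fun z => (z : ℂ) ^ n) := by
  have : (fun θ : ℝ => ((Circle.exp θ : Circle) : ℂ) ^ n) =
      fun θ : ℝ => Complex.exp (n * (θ * Complex.I)) := by
    ext θ
    rw [Circle.coe_exp, Complex.exp_int_mul]
  unfold Sm
  rw [this]
  refine Complex.contDiff_exp.comp (contDiff_const.mul (ContDiff.mul ?_ contDiff_const))
  exact Complex.ofRealCLM.contDiff

lemma continuous_lift (hf : Sm f) :
    Continuous (fun x : AddCircle (2 * Real.pi) => f x.toCircle) := by
  refine continuous_coinduced_dom.2 ?_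
  have : (fun x : AddCircle (2 * Real.pi) => f x.toCircle) ∘ (fun x : ℝ => (x : AddCircle _)) =
      fun θ : ℝ => f (Circle.exp θ) := by
    ext θ
    simp [toCircle_mk]
  exact this ▸ ContDiff.continuous hf

end Sm

/-- The Fourier coefficients of a function on the circle. -/
def coef (f : Circle → ℂ) (n : ℤ) : ℂ :=
  fourierCoeff (fun x : AddCircle (2 * Real.pi) => f x.toCircle) n

lemma exists_exp (z : Circle) : ∃ θ : ℝ, Circle.exp θ = z := ⟨_, Circle.exp_arg z⟩

lemma exists_toCircle (z : Circle) : ∃ x : AddCircle (2 * Real.pi), x.toCircle = z := by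
  obtain ⟨θ, rfl⟩ := exists_exp z
  exact ⟨θ, toCircle_mk θ⟩

lemma coef_eq_integral (f : Circle → ℂ) (n : ℤ) :
    coef f n = (2 * Real.pi : ℂ)⁻¹ * ∫ θ in (0 : ℝ)..2 * Real.pi,
      ((Circle.exp θ : Circle) : ℂ) ^ (-n) * f (Circle.exp θ) := by
  have h := fourierCoeff_eq_intervalIntegral (T := 2 * Real.pi)
    (fun x : AddCircle (2 * Real.pi) => f x.toCircle) n 0
  rw [zero_add] at h
  unfold coef
  rw [h]
  simp only [toCircle_mk, fourier_apply, AddCircle.toCircle_zsmul, Circle.coe_zpow, smul_eq_mul,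
    Complex.real_smul]
  push_cast
  simp

variable {f g : Circle → ℂ}

lemma integrable_aux (hf : Sm f) (n : ℤ) : MeasureTheory.Integrable
    (fun x : AddCircle (2 * Real.pi) => fourier n x • f x.toCircle)
    AddCircle.haarAddCircle :=
  (((fourier n).continuous.smul hf.continuous_lift)).integrable_of_hasCompactSupport
    (HasCompactSupport.of_compactSpace _)

lemma coef_add (hf : Sm f) (hg : Sm g) (n : ℤ) :
    coef (fun z => f z + g z) n = coef f n + coef g n := by
  unfold coef fourierCoeff
  rw [← MeasureTheory.integral_add (integrable_aux hf _) (integrable_aux hg _)]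
  simp [mul_add]

lemma coef_const_mul (c : ℂ) (f : Circle → ℂ) (n : ℤ) :
    coef (fun z => c * f z) n = c * coef f n :=
  fourierCoeff.const_mul _ _ _

lemma coef_sub (hf : Sm f) (hg : Sm g) (n : ℤ) :
    coef (fun z => f z - g z) n = coef f n - coef g n := by
  unfold coef fourierCoeff
  rw [← MeasureTheory.integral_sub (integrable_aux hf _) (integrable_aux hg _)]
  simp [mul_sub]

lemma coef_zpow_mul (k : ℤ) (f : Circle → ℂ) (n : ℤ) :
    coef (fun z => (z : ℂ) ^ k * f z) n = coef f (n - k) := by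
  unfold coef fourierCoeff
  refine congrArg _ (funext fun x => ?_)
  simp only [fourier_apply, AddCircle.toCircle_zsmul, Circle.coe_zpow, smul_eq_mul]
  rw [← mul_assoc, ← zpow_add₀ (Circle.coe_ne_zero _)]
  congr 2
  ring

lemma coef_conj (f : Circle → ℂ) (n : ℤ) :
    coef (fun z => conj (f z)) n = conj (coef f (-n)) := by
  unfold coef fourierCoeff
  rw [← integral_conj]
  refine congrArg _ (funext fun x => ?_)
  simp only [smul_eq_mul, map_mul]
  rw [← fourier_neg, neg_neg]

lemma norm_coef_le {C : ℝ} (h : ∀ z, ‖f z‖ ≤ C) (n : ℤ) : ‖coef f n‖ ≤ C := by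
  unfold coef fourierCoeff
  refine (MeasureTheory.norm_integral_le_of_norm_le_const (C := C)
    (Filter.Eventually.of_forall fun x => ?_)).trans (by simp)
  rw [norm_smul, fourier_apply, Circle.norm_coe, one_mul]
  exact h _

lemma coef_zpow (k n : ℤ) : coef (fun z => (z : ℂ) ^ k) n = if n = k then 1 else 0 := by
  have h := fourierCoeff_fourier (T := 2 * Real.pi) k
  have h2 := congrFun h n
  rw [Pi.single_apply] at h2
  rw [← h2]
  unfold coef
  congr 1
  ext x
  simp [fourier_apply, AddCircle.toCircle_zsmul]

lemma coef_const (c : ℂ) (n : ℤ) : coef (fun _ => c) n = if n = 0 then c else 0 := by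
  have h := coef_const_mul c (fun z => (z : ℂ) ^ (0 : ℤ)) n
  rw [coef_zpow] at h
  simpa using h

/-! ### Decay of Fourier coefficients -/

lemma hasDerivAt_zpow (n : ℤ) (θ : ℝ) :
    HasDerivAt (fun θ : ℝ => ((Circle.exp θ : Circle) : ℂ) ^ n)
      ((n * Complex.I) * ((Circle.exp θ : Circle) : ℂ) ^ n) θ := by
  have he : ∀ θ : ℝ, ((Circle.exp θ : Circle) : ℂ) ^ n =
      Complex.exp ((n * Complex.I) * θ) := by
    intro θ
    rw [Circle.coe_exp, ← Complex.exp_int_mul]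
    ring_nf
  simp only [he]
  have h1 : HasDerivAt (fun θ : ℝ => (n * Complex.I) * (θ : ℂ)) (n * Complex.I) θ := by
    simpa using (Complex.ofRealCLM.hasDerivAt (x := θ)).const_mul (n * Complex.I)
  simpa [mul_comm] using h1.cexp

lemma iteratedDeriv_zpow (n : ℤ) (k : ℕ) :
    iteratedDeriv k (fun θ : ℝ => ((Circle.exp θ : Circle) : ℂ) ^ n) =
      fun θ : ℝ => (n * Complex.I) ^ k * ((Circle.exp θ : Circle) : ℂ) ^ n := by
  induction k with
  | zero => simp
  | succ k ih =>
    ext θ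
    rw [iteratedDeriv_succ, ih, ((hasDerivAt_zpow n θ).const_mul _).deriv, pow_succ]
    ring

/-- Integration by parts over a full period: periodicity cancels the boundary terms. -/
lemma integral_deriv_mul {u : ℝ → ℂ} (hu : ContDiff ℝ 1 u)
    (hp : u (2 * Real.pi) = u 0) (n : ℤ) :
    ∫ θ in (0 : ℝ)..2 * Real.pi, ((Circle.exp θ : Circle) : ℂ) ^ (-n) * deriv u θ =
      (n * Complex.I) *
        ∫ θ in (0 : ℝ)..2 * Real.pi, ((Circle.exp θ : Circle) : ℂ) ^ (-n) * u θ := by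
  have hc : Continuous (fun θ : ℝ => ((Circle.exp θ : Circle) : ℂ) ^ (-n)) :=
    (Sm.zpow (-n)).continuous
  have h := intervalIntegral.integral_mul_deriv_eq_deriv_mul (a := 0) (b := 2 * Real.pi)
    (fun θ _ => hasDerivAt_zpow (-n) θ) (fun θ _ => (hu.differentiable one_ne_zero θ).hasDerivAt)
    ((continuous_const.mul hc).intervalIntegrable _ _)
    ((hu.continuous_deriv le_rfl).intervalIntegrable _ _)
  rw [h, hp]
  simp only [Circle.exp_two_pi, Circle.exp_zero, mul_assoc, intervalIntegral.integral_const_mul]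
  push_cast
  ring

lemma iteratedDeriv_periodic {u : ℝ → ℂ} {c : ℝ} (hp : Function.Periodic u c) (k : ℕ) :
    Function.Periodic (iteratedDeriv k u) c := by
  intro x
  have h := congrFun (iteratedDeriv_comp_add_const k u c) x
  rw [← h]
  exact congrArg (fun v => iteratedDeriv k v x) (funext hp)

lemma exp_periodic (f : Circle → ℂ) :
    Function.Periodic (fun θ : ℝ => f (Circle.exp θ)) (2 * Real.pi) := by
  intro θ
  simp [Circle.exp_add]

lemma coef_iteratedDeriv (hf : Sm f) (n : ℤ) (k : ℕ) :
    (2 * Real.pi : ℂ)⁻¹ * ∫ θ in (0 : ℝ)..2 * Real.pi, ((Circle.exp θ : Circle) : ℂ) ^ (-n) *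
      iteratedDeriv k (fun θ : ℝ => f (Circle.exp θ)) θ = (n * Complex.I) ^ k * coef f n := by
  induction k with
  | zero => simp [coef_eq_integral]
  | succ k ih =>
    rw [iteratedDeriv_succ, integral_deriv_mul, mul_left_comm, ih, pow_succ']
    · ring
    · rw [iteratedDeriv_eq_iterate]
      exact ContDiff.iterate_deriv' 1 k (hf.of_le (by exact_mod_cast le_top))
    · have := iteratedDeriv_periodic (exp_periodic f) k 0
      simpa using this

/-- The `k`-th derivative in the angle has Fourier coefficients `(i n) ^ k * coef f n`, and these
are bounded by its supremum over one period. -/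
lemma Sm.decay (hf : Sm f) (k : ℕ) : ∃ C : ℝ, ∀ n : ℤ, |(n : ℝ)| ^ k * ‖coef f n‖ ≤ C := by
  have hc : Continuous (iteratedDeriv k (fun θ : ℝ => f (Circle.exp θ))) :=
    ContDiff.continuous_iteratedDeriv k hf (by exact_mod_cast le_top)
  obtain ⟨C, hC⟩ := (isCompact_Icc (a := (0 : ℝ)) (b := 2 * Real.pi)).exists_bound_of_continuousOn
    hc.continuousOn
  refine ⟨‖(2 * Real.pi : ℂ)⁻¹‖ * (C * |2 * Real.pi - 0|), fun n => ?_⟩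
  have h := congrArg norm (coef_iteratedDeriv hf n k)
  rw [norm_mul, norm_mul, norm_pow, norm_mul, Complex.norm_I, mul_one, Complex.norm_intCast] at h
  rw [← h]
  gcongr
  refine intervalIntegral.norm_integral_le_of_norm_le_const fun x hx => ?_
  rw [norm_mul, norm_zpow, Circle.norm_coe, one_zpow, one_mul]
  rw [Set.uIoc_of_le Real.two_pi_pos.le] at hx
  exact hC x ⟨hx.1.le, hx.2⟩

lemma Sm.summable_pow (hf : Sm f) (k : ℕ) :
    Summable (fun n : ℤ => |(n : ℝ)| ^ k * ‖coef f n‖) := by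
  -- The two extra powers give comparison with the sum of `1 / n ^ 2`; the index `0` is discarded as
  -- a finite exception.
  obtain ⟨C, hC⟩ := hf.decay (k + 2)
  refine Summable.of_norm_bounded_eventually (g := fun n : ℤ => C * (1 / (n : ℝ) ^ 2))
    ((Real.summable_one_div_int_pow.2 one_lt_two).mul_left C) ?_
  rw [Filter.eventually_cofinite]
  refine (Set.finite_singleton (0 : ℤ)).subset fun n hn => ?_
  by_contra h0
  refine hn ?_
  have h1 : (0 : ℝ) < (n : ℝ) ^ 2 := by
    have : (n : ℝ) ≠ 0 := by exact_mod_cast h0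
    positivity
  rw [Real.norm_of_nonneg (by positivity), mul_one_div, le_div_iff₀ h1, ← sq_abs (n : ℝ)]
  refine le_trans (le_of_eq ?_) (hC n)
  ring

lemma Sm.summable (hf : Sm f) : Summable (fun n : ℤ => ‖coef f n‖) := by
  simpa using hf.summable_pow 0

lemma Sm.hasSum (hf : Sm f) (z : Circle) : HasSum (fun n : ℤ => coef f n * (z : ℂ) ^ n) (f z) := by
  obtain ⟨x, rfl⟩ := exists_toCircle z
  have h := has_pointwise_sum_fourier_series_of_summable
    (f := (⟨_, hf.continuous_lift⟩ : C(AddCircle (2 * Real.pi), ℂ)))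
    (Summable.of_norm hf.summable) x
  simpa [coef, fourier_apply, AddCircle.toCircle_zsmul] using h

lemma norm_mul_zpow (c : ℂ) (z : Circle) (n : ℤ) : ‖c * (z : ℂ) ^ n‖ = ‖c‖ := by
  rw [norm_mul, norm_zpow, Circle.norm_coe, one_zpow, mul_one]

/-- Fourier coefficients of a product with an absolutely convergent Fourier series. -/
lemma hasSum_coef_mul {a : ℤ → ℂ} (ha : Summable fun j => ‖a j‖)
    (hf : ∀ z : Circle, HasSum (fun j : ℤ => a j * (z : ℂ) ^ j) (f z)) (hg : Sm g) (n : ℤ) :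
    HasSum (fun j => a j * coef g (n - j)) (coef (fun z => f z * g z) n) := by
  have hs : ∀ j : ℤ, Sm (fun z => a j * ((z : ℂ) ^ j * g z)) := fun j =>
    (Sm.const _).mul ((Sm.zpow j).mul hg)
  obtain ⟨C, hC⟩ : ∃ C : ℝ, ∀ x : AddCircle (2 * Real.pi), ‖g x.toCircle‖ ≤ C := by
    obtain ⟨C, hC⟩ := isCompact_univ.exists_bound_of_continuousOn hg.continuous_lift.continuousOn
    exact ⟨C, fun x => hC x trivial⟩
  have h := MeasureTheory.hasSum_integral_of_summable_integral_norm
    (μ := (AddCircle.haarAddCircle : MeasureTheory.Measure (AddCircle (2 * Real.pi))))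
    (fun j => integrable_aux (hs j) (-n)) ?_
  · have h2 : (fun j => a j * coef g (n - j)) = fun j =>
        coef (fun z => a j * ((z : ℂ) ^ j * g z)) n := by
      ext j
      rw [coef_const_mul, coef_zpow_mul]
    rw [h2]
    refine Eq.subst (motive := fun t => HasSum _ t) ?_ h
    unfold coef fourierCoeff
    refine congrArg _ (funext fun x => ?_)
    refine (tsum_const_smul'' _).trans (congrArg _ ?_)
    simpa only [mul_assoc] using ((hf x.toCircle).mul_right (g x.toCircle)).tsum_eq
  · refine Summable.of_nonneg_of_le (fun j => by positivity) (fun j => ?_) (ha.mul_right C)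
    refine (le_abs_self _).trans ?_
    rw [← Real.norm_eq_abs]
    refine (MeasureTheory.norm_integral_le_of_norm_le_const (C := ‖a j‖ * C)
      (Filter.Eventually.of_forall fun x => ?_)).trans (by simp)
    rw [norm_norm, norm_smul, fourier_apply, Circle.norm_coe, one_mul, norm_mul, norm_mul,
      norm_zpow, Circle.norm_coe, one_zpow, one_mul]
    gcongr
    exact hC x

/-! ### Holomorphic functions with smooth boundary values -/

namespace HolSmooth

variable {F G : ℂ → ℂ}

lemma sm (hF : HolSmooth F) : Sm (fun z : Circle => F z) := hF.smooth_boundary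

lemma diffContOnCl (hF : HolSmooth F) : DiffContOnCl ℂ F (Metric.ball 0 1) :=
  ⟨hF.holomorphic, by rw [closure_ball _ one_ne_zero]; exact hF.continuous⟩

lemma mem_closedBall (z : Circle) : (z : ℂ) ∈ Metric.closedBall (0 : ℂ) 1 := by
  simp [Circle.norm_coe]

lemma const (c : ℂ) : HolSmooth (fun _ => c) :=
  ⟨differentiableOn_const _, continuousOn_const, contDiff_const⟩

lemma add (hF : HolSmooth F) (hG : HolSmooth G) : HolSmooth (fun z => F z + G z) :=
  ⟨hF.1.add hG.1, hF.2.add hG.2, hF.sm.add hG.sm⟩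

lemma sub (hF : HolSmooth F) (hG : HolSmooth G) : HolSmooth (fun z => F z - G z) :=
  ⟨hF.1.sub hG.1, hF.2.sub hG.2, hF.sm.sub hG.sm⟩

lemma mul (hF : HolSmooth F) (hG : HolSmooth G) : HolSmooth (fun z => F z * G z) :=
  ⟨hF.1.mul hG.1, hF.2.mul hG.2, hF.sm.mul hG.sm⟩

lemma neg (hF : HolSmooth F) : HolSmooth (fun z => -F z) :=
  ⟨hF.1.neg, hF.2.neg, hF.sm.neg⟩

lemma pow (n : ℕ) : HolSmooth (fun z => z ^ n) := by
  refine ⟨(differentiable_id.pow n).differentiableOn, (continuous_pow n).continuousOn, ?_⟩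
  exact_mod_cast Sm.zpow n

lemma div (hF : HolSmooth F) (hG : HolSmooth G)
    (h0 : ∀ z ∈ Metric.closedBall (0 : ℂ) 1, G z ≠ 0) : HolSmooth (fun z => F z / G z) :=
  ⟨hF.1.div hG.1 fun z hz => h0 z (Metric.ball_subset_closedBall hz), hF.2.div hG.2 h0,
    by
      simp only [div_eq_mul_inv]
      exact ContDiff.mul hF.sm (ContDiff.inv hG.sm fun θ => h0 _ (mem_closedBall _))⟩

lemma eqOn (hF : HolSmooth F) (hG : HolSmooth G) (h : ∀ z : Circle, F z = G z) :
    Set.EqOn F G (Metric.closedBall 0 1) := by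
  have := Complex.eqOn_closure_of_eqOn_frontier (Metric.isBounded_ball) hF.diffContOnCl
    hG.diffContOnCl fun z hz => ?_
  · rwa [closure_ball _ one_ne_zero] at this
  · rw [frontier_ball _ one_ne_zero] at hz
    exact h ⟨z, hz⟩

lemma norm_le (hF : HolSmooth F) {C : ℝ} (h : ∀ z : Circle, ‖F z‖ ≤ C) {z : ℂ}
    (hz : z ∈ Metric.closedBall (0 : ℂ) 1) : ‖F z‖ ≤ C := by
  refine Complex.norm_le_of_forall_mem_frontier_norm_le (Metric.isBounded_ball)
    hF.diffContOnCl (fun z hz => ?_) (by rwa [closure_ball _ one_ne_zero])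
  rw [frontier_ball _ one_ne_zero] at hz
  exact h ⟨z, hz⟩

/-- Cauchy's theorem for `z ^ m * F z`, where `n = -(m + 1)`: the remaining power of `z` comes from
`dz = i z dθ`. Continuity up to the boundary allows integration over the unit circle itself. -/
lemma coef_of_neg (hF : HolSmooth F) {n : ℤ} (hn : n < 0) : coef (fun z => F z) n = 0 := by
  obtain ⟨m, rfl⟩ : ∃ m : ℕ, n = -(m + 1 : ℤ) := ⟨(-n - 1).toNat, by omega⟩
  have h := ((HolSmooth.pow m).mul hF).diffContOnCl.circleIntegral_eq_zero zero_le_one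
  rw [circleIntegral] at h
  rw [coef_eq_integral]
  have h2 : ∀ θ : ℝ, deriv (circleMap 0 1) θ • (circleMap 0 1 θ ^ m * F (circleMap 0 1 θ)) =
      Complex.I * (((Circle.exp θ : Circle) : ℂ) ^ (-(-(m + 1 : ℤ))) * F (Circle.exp θ)) := by
    intro θ
    have : circleMap 0 1 θ = (Circle.exp θ : ℂ) := by simp [circleMap, Circle.coe_exp]
    rw [deriv_circleMap, this, neg_neg]
    rw [show (m + 1 : ℤ) = ((m + 1 : ℕ) : ℤ) by norm_cast, zpow_natCast, smul_eq_mul, pow_succ]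
    ring
  simp only [h2, intervalIntegral.integral_const_mul, mul_eq_zero, Complex.I_ne_zero,
    false_or] at h
  rw [h, mul_zero]

/-- Cauchy's formula for the Taylor coefficients, taken on the unit circle itself rather than on
smaller circles. -/
lemma coef_natCast (hF : HolSmooth F) (n : ℕ) : coef (fun z => F z) n = taylorCoeff F n := by
  have h := DiffContOnCl.hasFPowerSeriesOnBall (R := 1) (by simpa using hF.diffContOnCl) one_pos
  have h1 := h.factorial_smul 1 n
  rw [cauchyPowerSeries_apply] at h1
  rw [taylorCoeff, iteratedDeriv_eq_iteratedFDeriv, ← h1, nsmul_eq_mul, mul_comm, mul_div_assoc,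
    div_self (by exact_mod_cast n.factorial_ne_zero), mul_one, coef_eq_integral, circleIntegral]
  have h2 : ∀ θ : ℝ, deriv (circleMap 0 ((1 : NNReal) : ℝ)) θ • (1 / (circleMap 0 ((1 : NNReal) : ℝ) θ - 0)) ^ n •
      (circleMap 0 ((1 : NNReal) : ℝ) θ - 0)⁻¹ • F (circleMap 0 ((1 : NNReal) : ℝ) θ) =
      Complex.I * (((Circle.exp θ : Circle) : ℂ) ^ (-(n : ℤ)) * F (Circle.exp θ)) := by
    intro θ
    have : circleMap 0 ((1 : NNReal) : ℝ) θ = (Circle.exp θ : ℂ) := by simp [circleMap, Circle.coe_exp]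
    rw [deriv_circleMap, this, zpow_neg, zpow_natCast, smul_eq_mul, smul_eq_mul, smul_eq_mul,
      sub_zero, one_div, inv_pow]
    have := Circle.coe_ne_zero (Circle.exp θ)
    field_simp
  rw [intervalIntegral.integral_congr fun θ _ => h2 θ, intervalIntegral.integral_const_mul,
    smul_eq_mul]
  have hI : (2 * Real.pi * Complex.I : ℂ)⁻¹ * Complex.I = (2 * Real.pi : ℂ)⁻¹ := by
    rw [mul_inv, mul_assoc, inv_mul_cancel₀ Complex.I_ne_zero, mul_one]
  rw [← mul_assoc, hI]

lemma coef_zero (hF : HolSmooth F) : coef (fun z => F z) 0 = F 0 := by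
  have := hF.coef_natCast 0
  simpa [taylorCoeff] using this

end HolSmooth

/-- A power series with rapidly decreasing coefficients is holomorphic in the disk with smooth
boundary values. -/
lemma holSmooth_tsum {c : ℕ → ℂ} (hc : ∀ k : ℕ, ∃ C : ℝ, ∀ n : ℕ, (n : ℝ) ^ k * ‖c n‖ ≤ C) :
    HolSmooth (fun z => ∑' n : ℕ, c n * z ^ n) ∧ Summable (fun n => ‖c n‖) ∧
      ∀ z : Circle, HasSum (fun n : ℕ => c n * (z : ℂ) ^ n) (∑' n : ℕ, c n * (z : ℂ) ^ n) := by
  have hs : ∀ k : ℕ, Summable (fun n : ℕ => (n : ℝ) ^ k * ‖c n‖) := by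
    intro k
    obtain ⟨C, hC⟩ := hc (k + 2)
    refine Summable.of_norm_bounded_eventually_nat (g := fun n : ℕ => C * (1 / (n : ℝ) ^ 2))
      ((Real.summable_one_div_nat_pow.2 one_lt_two).mul_left C) ?_
    filter_upwards [Filter.eventually_gt_atTop 0] with n hn
    have h1 : (0 : ℝ) < (n : ℝ) ^ 2 := by positivity
    rw [mul_one_div, le_div_iff₀ h1, Real.norm_of_nonneg (by positivity)]
    refine le_trans (le_of_eq ?_) (hC n)
    ring
  have hs0 : Summable (fun n => ‖c n‖) := by simpa using hs 0
  have hb : ∀ n : ℕ, ∀ z ∈ Metric.closedBall (0 : ℂ) 1, ‖c n * z ^ n‖ ≤ ‖c n‖ := by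
    intro n z hz
    rw [norm_mul, norm_pow]
    exact mul_le_of_le_one_right (norm_nonneg _) (pow_le_one₀ (norm_nonneg _) (by simpa using hz))
  refine ⟨⟨?_, ?_, ?_⟩, hs0, fun z => ?_⟩
  · exact Complex.differentiableOn_tsum_of_summable_norm hs0
      (fun n => ((differentiable_id.pow n).const_mul _).differentiableOn) Metric.isOpen_ball
      fun n z hz => hb n z (Metric.ball_subset_closedBall hz)
  · exact continuousOn_tsum (fun n => (continuous_const.mul (continuous_pow n)).continuousOn)
      hs0 hb
  -- Each derivative in the angle multiplies the `n`-th term by `i n`, which gives the majorants.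
  · refine contDiff_tsum (N := ⊤) (v := fun k (n : ℕ) => (n : ℝ) ^ k * ‖c n‖) (fun n => ?_)
      (fun k _ => hs k) (fun k n θ _ => ?_)
    · exact (Sm.const (c n)).mul (HolSmooth.pow n).sm
    · rw [norm_iteratedFDeriv_eq_norm_iteratedDeriv, iteratedDeriv_const_mul_field]
      have := congrFun (iteratedDeriv_zpow n k) θ
      simp only [zpow_natCast] at this
      rw [this, norm_mul, norm_mul, norm_pow, norm_pow, Circle.norm_coe, one_pow, norm_mul,
        Complex.norm_I, mul_one, mul_one, mul_comm]
      simp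
  · exact (Summable.of_norm_bounded hs0 fun n => hb n z (HolSmooth.mem_closedBall z)).hasSum

/-! ### Splitting into nonnegative and negative frequencies -/

lemma Sm.exists_posPart (hf : Sm f) : ∃ P : ℂ → ℂ, HolSmooth P ∧
    ∀ z : Circle, HasSum (fun n : ℕ => coef f n * (z : ℂ) ^ n) (P z) := by
  obtain ⟨h1, -, h2⟩ := holSmooth_tsum (c := fun n => coef f n) fun k => by
    obtain ⟨C, hC⟩ := hf.decay k
    exact ⟨C, fun n => by simpa using hC n⟩
  exact ⟨_, h1, h2⟩

lemma conj_coe (z : Circle) : conj (z : ℂ) = (z : ℂ)⁻¹ := by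
  rw [← Circle.coe_inv, Circle.coe_inv_eq_conj]

/-- Splitting of a smooth function into a holomorphic and an antiholomorphic part. -/
lemma Sm.exists_split (hf : Sm f) : ∃ P M : ℂ → ℂ, HolSmooth P ∧ HolSmooth M ∧ M 0 = 0 ∧
    (∀ z : Circle, f z = P z + conj (M z)) ∧
    ((∀ n < 0, coef f n = 0) → ∀ z : Circle, f z = P z) := by
  obtain ⟨P, hP, hPs⟩ := hf.exists_posPart
  -- Multiplying by `z` before conjugating moves the index `-(n + 1)` of `f` to `n`, so `Q` collects
  -- exactly the negative frequencies and `M = z * Q` vanishes at `0`.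
  obtain ⟨Q, hQ, hQs⟩ := ((Sm.zpow 1).mul hf).star.exists_posPart
  have hc : ∀ n : ℕ, coef (fun z : Circle => conj ((z : ℂ) ^ (1 : ℤ) * f z)) n =
      conj (coef f (-(n + 1 : ℤ))) := by
    intro n
    rw [coef_conj (fun z : Circle => (z : ℂ) ^ (1 : ℤ) * f z), coef_zpow_mul]
    ring_nf
  have hsum : ∀ z : Circle, HasSum (fun n : ℕ => coef f (-(n + 1 : ℤ)) * (z : ℂ) ^ (-(n + 1 : ℤ)))
      (conj ((z : ℂ) * Q z)) := by
    intro z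
    have h := (Complex.hasSum_conj'.2 ((hQs z).mul_left (z : ℂ)))
    refine Eq.subst (motive := fun t => HasSum t _) (funext fun n => ?_) h
    rw [hc, map_mul, map_mul, Complex.conj_conj, map_pow, conj_coe, neg_add, zpow_add₀
      (Circle.coe_ne_zero z), zpow_neg, zpow_neg, zpow_natCast, zpow_one, inv_pow]
    ring
  have hz : ∀ z : Circle, f z = P z + conj ((z : ℂ) * Q z) := fun z =>
    (hf.hasSum z).unique (HasSum.of_nat_of_neg_add_one (by simpa using hPs z) (hsum z))
  refine ⟨P, fun z => z * Q z, hP, ?_, by simp, hz, fun h z => ?_⟩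
  · simpa using (HolSmooth.pow 1).mul hQ
  · rw [hz z]
    have h0 : conj ((z : ℂ) * Q z) = 0 := by
      refine (hsum z).unique (Eq.subst (motive := fun t => HasSum t 0) (funext fun n => ?_) hasSum_zero)
      rw [h _ (by omega), zero_mul]
    rw [h0, add_zero]

lemma Sm.exists_holSmooth (hf : Sm f) (h : ∀ n < 0, coef f n = 0) :
    ∃ F : ℂ → ℂ, HolSmooth F ∧ ∀ z : Circle, f z = F z := by
  obtain ⟨P, -, hP, -, -, -, h2⟩ := hf.exists_split
  exact ⟨P, hP, h2 h⟩

lemma Sm.exists_holSmooth_conj (hf : Sm f) (h : ∀ n > 0, coef f n = 0) :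
    ∃ F : ℂ → ℂ, HolSmooth F ∧ ∀ z : Circle, f z = conj (F z) := by
  obtain ⟨F, hF, h2⟩ := hf.star.exists_holSmooth fun n hn => by
    rw [coef_conj, h _ (by omega), map_zero]
  exact ⟨F, hF, fun z => by rw [← h2, Complex.conj_conj]⟩

lemma HolSmooth.coef_conj_of_pos {F : ℂ → ℂ} (hF : HolSmooth F) {n : ℤ} (hn : 0 < n) :
    coef (fun z => conj (F z)) n = 0 := by
  rw [coef_conj (fun z : Circle => F z), hF.coef_of_neg (by omega), map_zero]

lemma HolSmooth.coef_conj_zero {F : ℂ → ℂ} (hF : HolSmooth F) :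
    coef (fun z => conj (F z)) 0 = conj (F 0) := by
  rw [coef_conj (fun z : Circle => F z), neg_zero, hF.coef_zero]

lemma HolSmooth.coef_conj_neg {F : ℂ → ℂ} (hF : HolSmooth F) (n : ℕ) :
    coef (fun z => conj (F z)) (-(n : ℤ)) = conj (taylorCoeff F n) := by
  rw [coef_conj (fun z : Circle => F z), neg_neg, hF.coef_natCast]

end

section

/-! ### The Bezout equation for holomorphic functions with smooth boundary values -/

lemma HolSmooth.polynomial (p : Polynomial ℂ) : HolSmooth (fun z => p.eval z) := by
  induction p using Polynomial.induction_on' with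
  | add p q hp hq => simpa only [Polynomial.eval_add] using hp.add hq
  | monomial n a => simpa only [Polynomial.eval_monomial] using (HolSmooth.const a).mul (.pow n)

/-- The Taylor coefficients are absolutely summable, so the partial sums converge uniformly on the
closed disk. -/
lemma HolSmooth.exists_polynomial {F : ℂ → ℂ} (hF : HolSmooth F) {ε : ℝ} (hε : 0 < ε) :
    ∃ p : Polynomial ℂ, ∀ z ∈ Metric.closedBall (0 : ℂ) 1, ‖F z - p.eval z‖ < ε := by
  obtain ⟨h1, h2, h3⟩ := holSmooth_tsum (c := fun n => coef (fun z => F z) n) fun k => by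
    obtain ⟨C, hC⟩ := hF.sm.decay k
    exact ⟨C, fun n => by simpa using hC n⟩
  have heq : Set.EqOn F (fun z => ∑' n : ℕ, coef (fun z => F z) n * z ^ n)
      (Metric.closedBall 0 1) := by
    refine hF.eqOn h1 fun z => ?_
    obtain ⟨P, -, hPs⟩ := hF.sm.exists_posPart
    obtain ⟨P', M, -, -, -, hs, hs2⟩ := hF.sm.exists_split
    refine (hF.sm.hasSum z).unique ?_
    have h4 := h3 z
    rw [← (Nat.cast_injective (R := ℤ)).hasSum_iff]
    · refine Eq.subst (motive := fun t => HasSum t _) (funext fun n => ?_) h4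
      simp only [Function.comp_apply, zpow_natCast]
    · rintro n hn
      rw [hF.coef_of_neg, zero_mul]
      by_contra h
      exact hn ⟨n.toNat, by simpa using h⟩
  have hu := tendstoUniformlyOn_tsum_nat (f := fun n z => coef (fun z => F z) n * z ^ n)
    (s := Metric.closedBall (0 : ℂ) 1) h2 fun n z hz => by
      rw [norm_mul, norm_pow]
      exact mul_le_of_le_one_right (norm_nonneg _) (pow_le_one₀ (norm_nonneg _) (by simpa using hz))
  obtain ⟨N, hN⟩ := (Metric.tendstoUniformlyOn_iff.1 hu ε hε).exists
  refine ⟨∑ n ∈ Finset.range N, Polynomial.monomial n (coef (fun z => F z) n), fun z hz => ?_⟩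
  have := hN z hz
  rw [dist_eq_norm] at this
  have hz2 : F z = _ := heq hz
  rw [hz2]
  simpa [Polynomial.eval_finsetSum] using this

/-- The closed unit disk. -/
abbrev Disk : Set ℂ := Metric.closedBall (0 : ℂ) 1

instance compactSpace_disk : CompactSpace Disk := isCompact_iff_compactSpace.1
  (isCompact_closedBall _ _)

instance nonempty_disk : Nonempty Disk := ⟨⟨0, by simp⟩⟩

/-- The disk algebra, as the closure of the polynomials. -/
abbrev diskAlgebra : Subalgebra ℂ C(Disk, ℂ) := (polynomialFunctions Disk).topologicalClosure

instance completeSpace_diskAlgebra : CompleteSpace diskAlgebra :=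
  (Subalgebra.isClosed_topologicalClosure _).completeSpace_coe

instance normOneClass_diskAlgebra : NormOneClass diskAlgebra :=
  ⟨(norm_one : ‖(1 : C(Disk, ℂ))‖ = 1)⟩

lemma mem_diskAlgebra {F : ℂ → ℂ} (hF : HolSmooth F) :
    (⟨fun z : Disk => F z, hF.continuous.domRestrict⟩ : C(Disk, ℂ)) ∈ diskAlgebra := by
  change _ ∈ closure ((polynomialFunctions Disk : Subalgebra ℂ C(Disk, ℂ)) : Set C(Disk, ℂ))
  rw [Metric.mem_closure_iff]
  intro ε hε
  obtain ⟨p, hp⟩ := hF.exists_polynomial (half_pos hε)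
  refine ⟨p.toContinuousMapOn Disk, ⟨p, by simp, rfl⟩, ?_⟩
  refine lt_of_le_of_lt ((ContinuousMap.dist_le (half_pos hε).le).2 fun z => ?_) (half_lt_self hε)
  rw [dist_eq_norm]
  exact (hp z z.2).le

lemma exists_polynomial_of_mem {F : C(Disk, ℂ)} (hF : F ∈ diskAlgebra) {ε : ℝ} (hε : 0 < ε) :
    ∃ p : Polynomial ℂ, ‖F - p.toContinuousMapOn Disk‖ < ε := by
  change _ ∈ closure ((polynomialFunctions Disk : Subalgebra ℂ C(Disk, ℂ)) : Set C(Disk, ℂ)) at hF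
  rw [Metric.mem_closure_iff] at hF
  obtain ⟨_, ⟨p, -, rfl⟩, hp⟩ := hF ε hε
  exact ⟨p, by simpa [dist_eq_norm] using hp⟩

lemma toContinuousMapOn_mem (p : Polynomial ℂ) : p.toContinuousMapOn Disk ∈ diskAlgebra :=
  Subalgebra.le_topologicalClosure _ ⟨p, by simp, rfl⟩

/-- Every character of the disk algebra is the evaluation at a point of the closed disk. -/
lemma character_eq_eval (φ : WeakDual.characterSpace ℂ diskAlgebra) :
    ∃ w : Disk, ∀ F : diskAlgebra, φ F = F.1 w := by
  set ψ : diskAlgebra →ₐ[ℂ] ℂ := WeakDual.CharacterSpace.toAlgHom φ with hψ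
  have hψ' : ∀ F, φ F = ψ F := fun F => rfl
  have hn : ∀ F, ‖ψ F‖ ≤ ‖F‖ := fun F => AlgHom.norm_apply_le_self ψ F
  let X : diskAlgebra := ⟨Polynomial.X.toContinuousMapOn Disk, toContinuousMapOn_mem _⟩
  have hX : ‖X‖ ≤ 1 := by
    change ‖Polynomial.X.toContinuousMapOn Disk‖ ≤ 1
    refine (ContinuousMap.norm_le _ zero_le_one).2 fun z => ?_
    change ‖Polynomial.eval z.1 Polynomial.X‖ ≤ 1
    rw [Polynomial.eval_X]
    exact mem_closedBall_zero_iff.1 z.2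
  -- The point is the image of the coordinate function; it lies in the closed disk because
  -- characters do not increase norms. Polynomials then determine the character by density.
  let w : Disk := ⟨ψ X, by simpa using (hn X).trans hX⟩
  have hp : ∀ p : Polynomial ℂ, ψ ⟨p.toContinuousMapOn Disk, toContinuousMapOn_mem _⟩ =
      p.eval w.1 := by
    intro p
    have h1 : (⟨p.toContinuousMapOn Disk, toContinuousMapOn_mem _⟩ : diskAlgebra) =
        Polynomial.aeval X p := by
      apply Subtype.ext
      rw [← Subalgebra.coe_val, ← Polynomial.aeval_algHom_apply]
      exact (Polynomial.aeval_algHom_apply (Polynomial.toContinuousMapOnAlgHom Disk)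
        Polynomial.X p ▸ by simp)
    rw [h1, ← Polynomial.aeval_algHom_apply, Polynomial.coe_aeval_eq_eval]
  refine ⟨w, fun F => ?_⟩
  rw [hψ']
  refine eq_of_forall_dist_le fun ε hε => ?_
  obtain ⟨p, hpF⟩ := exists_polynomial_of_mem F.2 (half_pos hε)
  set P : diskAlgebra := ⟨p.toContinuousMapOn Disk, toContinuousMapOn_mem _⟩ with hP
  have h1 : ‖ψ F - ψ P‖ ≤ ε / 2 := by
    rw [← map_sub]
    exact (hn _).trans hpF.le
  have h2 : ‖F.1 w - ψ P‖ ≤ ε / 2 := by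
    rw [hp]
    exact ((F.1 - p.toContinuousMapOn Disk).norm_coe_le_norm w).trans hpF.le
  rw [dist_eq_norm]
  calc ‖ψ F - F.1 w‖ = ‖(ψ F - ψ P) - (F.1 w - ψ P)‖ := by congr 1; ring
    _ ≤ _ := norm_sub_le _ _
    _ ≤ ε := by linarith

/-- A maximal ideal of the disk algebra containing `a` and `b` would be the kernel of an evaluation,
that is, a common zero. The resulting coefficients `x`, `y` need not be smooth on the boundary;
replacing them by polynomial approximations keeps the combination invertible, and dividing by it
gives smooth coefficients. -/
lemma exists_bezout {a b : ℂ → ℂ} (ha : HolSmooth a) (hb : HolSmooth b)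
    (h0 : ∀ z ∈ Metric.closedBall (0 : ℂ) 1, ¬ (a z = 0 ∧ b z = 0)) :
    ∃ e f : ℂ → ℂ, HolSmooth e ∧ HolSmooth f ∧
      ∀ z ∈ Metric.closedBall (0 : ℂ) 1, a z * e z - b z * f z = 1 := by
  let a' : diskAlgebra := ⟨_, mem_diskAlgebra ha⟩
  let b' : diskAlgebra := ⟨_, mem_diskAlgebra hb⟩
  have htop : Ideal.span {a', b'} = ⊤ := by
    by_contra hne
    obtain ⟨M, hM, haM⟩ := Ideal.exists_le_maximal _ hne
    obtain ⟨w, hw⟩ := character_eq_eval M.toCharacterSpace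
    have ha0 : a'.1 w = 0 := by
      rw [← hw]
      exact M.toCharacterSpace_apply_eq_zero_of_mem (haM (Ideal.subset_span (by simp)))
    have hb0 : b'.1 w = 0 := by
      rw [← hw]
      exact M.toCharacterSpace_apply_eq_zero_of_mem (haM (Ideal.subset_span (by simp)))
    exact h0 w w.2 ⟨ha0, hb0⟩
  obtain ⟨x, y, hxy⟩ := Ideal.mem_span_pair.1 ((Ideal.eq_top_iff_one _).1 htop)
  set C : ℝ := ‖a'‖ + ‖b'‖ + 1 with hC
  have hCpos : 0 < C := by positivity
  -- With this tolerance `a * p + b * q` differs from `1` by at most `(C - 1) / (2 * C)`, which is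
  -- less than `1 / 2`.
  obtain ⟨p, hp⟩ := exists_polynomial_of_mem x.2 (show 0 < 1 / (2 * C) by positivity)
  obtain ⟨q, hq⟩ := exists_polynomial_of_mem y.2 (show 0 < 1 / (2 * C) by positivity)
  have hh : HolSmooth (fun z => a z * p.eval z + b z * q.eval z) :=
    (ha.mul (.polynomial p)).add (hb.mul (.polynomial q))
  have hne : ∀ z ∈ Metric.closedBall (0 : ℂ) 1, a z * p.eval z + b z * q.eval z ≠ 0 := by
    intro z hz heq
    have h1 : x.1 ⟨z, hz⟩ * a z + y.1 ⟨z, hz⟩ * b z = 1 := by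
      have := congrArg (fun F : diskAlgebra => F.1 ⟨z, hz⟩) hxy
      exact this
    have hpz : ‖x.1 ⟨z, hz⟩ - p.eval z‖ ≤ 1 / (2 * C) :=
      ((x.1 - p.toContinuousMapOn Disk).norm_coe_le_norm ⟨z, hz⟩).trans hp.le
    have hqz : ‖y.1 ⟨z, hz⟩ - q.eval z‖ ≤ 1 / (2 * C) :=
      ((y.1 - q.toContinuousMapOn Disk).norm_coe_le_norm ⟨z, hz⟩).trans hq.le
    have haz : ‖a z‖ ≤ ‖a'‖ := a'.1.norm_coe_le_norm ⟨z, hz⟩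
    have hbz : ‖b z‖ ≤ ‖b'‖ := b'.1.norm_coe_le_norm ⟨z, hz⟩
    have h2 : (1 : ℂ) = (x.1 ⟨z, hz⟩ - p.eval z) * a z + (y.1 ⟨z, hz⟩ - q.eval z) * b z := by
      rw [← h1]
      linear_combination heq
    have h3 : (1 : ℝ) ≤ 1 / (2 * C) * ‖a'‖ + 1 / (2 * C) * ‖b'‖ := by
      calc (1 : ℝ) = ‖(1 : ℂ)‖ := by simp
        _ ≤ _ := by
          rw [h2]
          refine (norm_add_le _ _).trans ?_
          rw [norm_mul, norm_mul]
          gcongr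
    have h4 : 1 / (2 * C) * ‖a'‖ + 1 / (2 * C) * ‖b'‖ = (C - 1) / (2 * C) := by
      rw [hC]; ring
    rw [h4, le_div_iff₀ (by positivity)] at h3
    linarith
  refine ⟨_, _, (HolSmooth.polynomial p).div hh hne, ((HolSmooth.polynomial q).div hh hne).neg,
    fun z hz => ?_⟩
  have := hne z hz
  field_simp
  ring

/-! ### Triangular factorization -/

lemma exists_circle_of_norm {z : ℂ} (hz : z ∈ Metric.closedBall (0 : ℂ) 1)
    (h : z ∉ Metric.ball (0 : ℂ) 1) : ∃ w : Circle, (w : ℂ) = z := by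
  have h1 : ‖z‖ = 1 := le_antisymm (by simpa using hz) (by simpa using h)
  exact ⟨⟨z, mem_sphere_zero_iff_norm.2 h1⟩, rfl⟩

/-- Reduction of the second row of a loop in `SL(2)` to a holomorphic one, given that the first
row is holomorphic without zeros. -/
lemma exists_row_reduction {a b : ℂ → ℂ} {c d : Circle → ℂ} (ha : HolSmooth a) (hb : HolSmooth b)
    (hc : Sm c) (hd : Sm d) (h0 : ∀ z ∈ Metric.ball (0 : ℂ) 1, ¬ (a z = 0 ∧ b z = 0))
    (hdet : ∀ z : Circle, a z * d z - b z * c z = 1) :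
    ∃ y γ δ : ℂ → ℂ, HolSmooth y ∧ HolSmooth γ ∧ HolSmooth δ ∧ y 0 = 0 ∧
      (∀ z ∈ Metric.closedBall (0 : ℂ) 1, a z * δ z - b z * γ z = 1) ∧
      ∀ z : Circle, c z = conj (y z) * a z + γ z ∧ d z = conj (y z) * b z + δ z := by
  obtain ⟨e, f, he, hf, hef⟩ := exists_bezout ha hb fun z hz => by
    by_cases hz' : z ∈ Metric.ball (0 : ℂ) 1
    · exact h0 z hz'
    · obtain ⟨w, rfl⟩ := exists_circle_of_norm hz hz'
      rintro ⟨h1, h2⟩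
      have := hdet w
      rw [h1, h2] at this
      simp at this
  -- Both `(c, d)` and `(f, e)` complete `(a, b)` to determinant one, so they differ by a multiple
  -- of `(a, b)`; the multiplier is `c * e - d * f`. Its holomorphic part goes into the new row.
  obtain ⟨P, M, hP, hM, hM0, hPM, -⟩ := ((hc.mul he.sm).sub (hd.mul hf.sm)).exists_split
  refine ⟨M, fun z => f z + P z * a z, fun z => e z + P z * b z, hM, hf.add (hP.mul ha),
    he.add (hP.mul hb), hM0, fun z hz => ?_, fun z => ⟨?_, ?_⟩⟩
  · linear_combination hef z hz
  · linear_combination (-c z) * hef z (HolSmooth.mem_closedBall z) + f z * hdet z + a z * hPM z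
  · linear_combination (-d z) * hef z (HolSmooth.mem_closedBall z) + e z * hdet z + b z * hPM z

end

section

/-! ### Row conditions and triangular factorizations -/

lemma invStar_eq (g : Loop) (z : Circle) : invStar g z =
    !![conj ((g z).1 1 1), -conj ((g z).1 1 0); -conj ((g z).1 0 1), conj ((g z).1 0 0)] := by
  rw [invStar, Matrix.SpecialLinearGroup.coe_inv, Matrix.adjugate_fin_two]
  ext i j
  fin_cases i <;> fin_cases j <;> simp [Matrix.conjTranspose_apply]

lemma loop_det (g : Loop) (z : Circle) :
    (g z).1 0 0 * (g z).1 1 1 - (g z).1 0 1 * (g z).1 1 0 = 1 := by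
  rw [← Matrix.det_fin_two]
  exact (g z).2

lemma lower_mul_diag_mul (y τ α β γ δ : ℂ) :
    !![1, 0; y, 1] * !![τ, 0; 0, τ⁻¹] * !![α, β; γ, δ] =
      !![τ * α, τ * β; y * (τ * α) + τ⁻¹ * γ, y * (τ * β) + τ⁻¹ * δ] := by
  simp [mul_assoc]

lemma upper_mul_diag_mul (x τ α β γ δ : ℂ) :
    !![1, x; 0, 1] * !![τ, 0; 0, τ⁻¹] * !![α, β; γ, δ] =
      !![τ * α + x * (τ⁻¹ * γ), τ * β + x * (τ⁻¹ * δ); τ⁻¹ * γ, τ⁻¹ * δ] := by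
  simp [mul_assoc]

/-- After row reduction only the normalization at `0` is missing. The constant `k = γ 0 / a 0` is
moved into the unipotent factor, whose entry may have a constant term for this kind of loop. -/
lemma hasTriangular₁_of {h : Circle → Matrix (Fin 2) (Fin 2) ℂ} {a b : ℂ → ℂ} {c d : Circle → ℂ}
    (ha : HolSmooth a) (hb : HolSmooth b)
    (hc : Sm c) (hd : Sm d) (h0 : ∀ z ∈ Metric.ball (0 : ℂ) 1, ¬ (a z = 0 ∧ b z = 0))
    (hdet : ∀ z : Circle, a z * d z - b z * c z = 1) (ha0 : a 0 ≠ 0)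
    (hh : ∀ z : Circle, h z = !![a z, b z; c z, d z]) : HasTriangular₁ h (a 0) := by
  obtain ⟨y, γ, δ, hy, hγ, hδ, -, hu, hcd⟩ := exists_row_reduction ha hb hc hd h0 hdet
  have hball : (0 : ℂ) ∈ Metric.closedBall (0 : ℂ) 1 := by simp
  set k : ℂ := γ 0 / a 0 with hk
  have hdiv : ∀ {F : ℂ → ℂ}, HolSmooth F → HolSmooth (fun z => F z / a 0) := fun hF =>
    hF.div (.const _) fun _ _ => ha0
  refine ⟨fun z => y z + conj k, fun z => a z / a 0, fun z => b z / a 0,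
    fun z => a 0 * (γ z - k * a z), fun z => a 0 * (δ z - k * b z), hy.add (.const _),
    ⟨hdiv ha, hdiv hb, (HolSmooth.const _).mul (hγ.sub ((HolSmooth.const _).mul ha)),
      (HolSmooth.const _).mul (hδ.sub ((HolSmooth.const _).mul hb)), fun z hz => ?_,
      div_self ha0, ?_, ?_⟩, fun z => ?_⟩
  · have := hu z (Metric.ball_subset_closedBall hz)
    field_simp
    linear_combination this
  · rw [hk]
    field_simp
    ring
  · have := hu 0 hball
    rw [hk]
    field_simp
    linear_combination this
  · obtain ⟨h1, h2⟩ := hcd z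
    rw [lower_mul_diag_mul, hh, h1, h2, mul_div_cancel₀ _ ha0, mul_div_cancel₀ _ ha0,
      inv_mul_cancel_left₀ ha0, inv_mul_cancel_left₀ ha0, map_add, Complex.conj_conj]
    (congr 3; ring_nf)

/-- The same reduction with rows and columns exchanged, starting from the holomorphic row `(d, c)`.
No constant is moved: `c 0 = 0` already gives the normalization, and the entry of the unipotent
factor has to vanish at `0`. -/
lemma hasTriangular₂_of {h : Circle → Matrix (Fin 2) (Fin 2) ℂ} {a b : ℂ → ℂ} {c d : ℂ → ℂ}
    (ha : HolSmooth a) (hb : HolSmooth b)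
    (hc : HolSmooth c) (hd : HolSmooth d) (hc0 : c 0 = 0)
    (h0 : ∀ z ∈ Metric.ball (0 : ℂ) 1, ¬ (c z = 0 ∧ d z = 0))
    (hdet : ∀ z : Circle, conj (a z) * d z - conj (b z) * c z = 1)
    (hd0 : d 0 ≠ 0)
    (hh : ∀ z : Circle, h z = !![conj (a z), conj (b z); c z, d z]) :
    HasTriangular₂ h (d 0)⁻¹ := by
  obtain ⟨x, β, α, hx, hβ, hα, hx0, hu, hba⟩ := exists_row_reduction hd hc hb.sm.star ha.sm.star
    (fun z hz h => h0 z hz h.symm) (fun z => by rw [← hdet z]; ring)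
  have hdiv : ∀ {F : ℂ → ℂ}, HolSmooth F → HolSmooth (fun z => F z / d 0) := fun hF =>
    hF.div (.const _) fun _ _ => hd0
  refine ⟨x, fun z => d 0 * α z, fun z => d 0 * β z, fun z => c z / d 0, fun z => d z / d 0, hx,
    hx0, ⟨(HolSmooth.const _).mul hα, (HolSmooth.const _).mul hβ, hdiv hc, hdiv hd,
      fun z hz => ?_, ?_, by simp [hc0], div_self hd0⟩, fun z => ?_⟩
  · have := hu z (Metric.ball_subset_closedBall hz)
    field_simp
    linear_combination this
  · have := hu 0 (by simp)
    rw [hc0, zero_mul, sub_zero] at this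
    exact this
  · obtain ⟨h1, h2⟩ := hba z
    rw [upper_mul_diag_mul, hh, h1, h2, inv_inv, mul_div_cancel₀ _ hd0, mul_div_cancel₀ _ hd0,
      inv_mul_cancel_left₀ hd0, inv_mul_cancel_left₀ hd0]
    congr 3 <;> ring_nf

/-- The first rows of `g` and of `g^{-*}` are `(a, b)` and `(d, -c)`; the center condition makes the
two diagonal constants conjugate. -/
theorem IsForm₁.condI3 {g : Loop} {a b c d : ℂ → ℂ} (h : IsForm₁ g a b c d) : CondI3 g := by
  have hdet : ∀ z : Circle, a z * conj (d z) - b z * conj (c z) = 1 := fun z => by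
    have := loop_det g z
    simpa [h.eq_on_circle] using this
  have hd0 : d 0 ≠ 0 := fun h0 => h.center_ne (by rw [h.center, h0, map_zero])
  refine ⟨a 0, h.center_ne, ?_, ?_⟩
  · exact hasTriangular₁_of h.hol_a h.hol_b h.hol_c.sm.star h.hol_d.sm.star h.no_common_zero_ab
      hdet h.center_ne h.eq_on_circle
  · rw [h.center, Complex.conj_conj]
    refine hasTriangular₁_of (b := fun z => -c z) (c := fun z => -conj (b z))
      (d := fun z => conj (a z)) h.hol_d h.hol_c.neg
      h.hol_b.sm.star.neg h.hol_a.sm.star (fun z hz h0 => h.no_common_zero_cd z hz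
        ⟨neg_eq_zero.1 h0.2, h0.1⟩) (fun z => ?_) hd0 fun z => ?_
    · have := congrArg conj (hdet z)
      simp only [map_sub, map_mul, Complex.conj_conj, map_one] at this
      linear_combination this
    · rw [invStar_eq, h.eq_on_circle]
      simp

/-- A lower unipotent factor on the left does not change the first row, so both rows can be read
off. A common zero would contradict the determinant of the holomorphic factor. -/
theorem CondI3.condI1 {g : Loop} (h : CondI3 g) : CondI1 g := by
  obtain ⟨τ, hτ, ⟨y, α, β, γ, δ, hy, hu, hg⟩, ⟨y', α', β', γ', δ', hy', hu', hg'⟩⟩ := h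
  have hτ' : conj τ ≠ 0 := (map_ne_zero _).2 hτ
  refine ⟨fun z => τ * α z, fun z => τ * β z, fun z => -(conj τ * β' z), fun z => conj τ * α' z,
    (HolSmooth.const _).mul hu.hol_α, (HolSmooth.const _).mul hu.hol_β,
    ((HolSmooth.const _).mul hu'.hol_β).neg, (HolSmooth.const _).mul hu'.hol_α, fun z => ?_,
    by simp [hu.α_zero, hu'.α_zero], by simp [hu.α_zero, hτ], fun z hz h0 => ?_,
    fun z hz h0 => ?_⟩
  · have h1 := hg z
    have h2 := hg' z
    rw [lower_mul_diag_mul] at h1 h2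
    rw [invStar_eq] at h2
    have e00 := congrFun (congrFun h1 0) 0
    have e01 := congrFun (congrFun h1 0) 1
    have e11 := congrArg conj (congrFun (congrFun h2 0) 0)
    have e10 := congrArg conj (congrFun (congrFun h2 0) 1)
    simp at e00 e01 e10 e11
    ext i j
    fin_cases i <;> fin_cases j <;> simp [e00, e01, e11]
    rw [← e10, neg_neg]
  · have := hu.det_eq_one z hz
    simp only [mul_eq_zero, hτ, false_or] at h0
    rw [h0.1, h0.2] at this
    simp at this
  · have := hu'.det_eq_one z hz
    simp only [neg_eq_zero, mul_eq_zero, hτ', false_or] at h0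
    rw [h0.1, h0.2] at this
    simp at this

/-- Here the second rows are the holomorphic ones: `(c, d)` for `g` and `(-b, a)` for `g^{-*}`. -/
theorem IsForm₂.condII3 {g : Loop} {a b c d : ℂ → ℂ} (h : IsForm₂ g a b c d) : CondII3 g := by
  have hdet : ∀ z : Circle, conj (a z) * d z - conj (b z) * c z = 1 := fun z => by
    have := loop_det g z
    simpa [h.eq_on_circle] using this
  have ha0 : a 0 ≠ 0 := fun h0 => h.center_ne (by rw [← h.center, h0, map_zero])
  refine ⟨(d 0)⁻¹, inv_ne_zero h.center_ne, ?_, ?_⟩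
  · exact hasTriangular₂_of h.hol_a h.hol_b h.hol_c h.hol_d h.c_zero h.no_common_zero_cd
      hdet h.center_ne h.eq_on_circle
  · rw [← h.center, map_inv₀, Complex.conj_conj]
    refine hasTriangular₂_of (a := d) (b := fun z => -c z) (c := fun z => -b z) h.hol_d h.hol_c.neg
      h.hol_b.neg h.hol_a (by simp [h.b_zero])
      (fun z hz h0 => h.no_common_zero_ab z hz ⟨h0.2, neg_eq_zero.1 h0.1⟩)
      (fun z => ?_) ha0 fun z => ?_
    · have := congrArg conj (hdet z)
      simp only [map_sub, map_mul, Complex.conj_conj, map_one] at this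
      rw [map_neg]
      linear_combination this
    · rw [invStar_eq, h.eq_on_circle]
      simp

theorem CondII3.condII1 {g : Loop} (h : CondII3 g) : CondII1 g := by
  obtain ⟨τ, hτ, ⟨y, α, β, γ, δ, hy, -, hu, hg⟩, ⟨y', α', β', γ', δ', hy', -, hu', hg'⟩⟩ := h
  have hτ' : (conj τ)⁻¹ ≠ 0 := inv_ne_zero ((map_ne_zero _).2 hτ)
  have hτi : τ⁻¹ ≠ 0 := inv_ne_zero hτ
  refine ⟨fun z => (conj τ)⁻¹ * δ' z, fun z => -((conj τ)⁻¹ * γ' z), fun z => τ⁻¹ * γ z,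
    fun z => τ⁻¹ * δ z, (HolSmooth.const _).mul hu'.hol_δ,
    ((HolSmooth.const _).mul hu'.hol_γ).neg, (HolSmooth.const _).mul hu.hol_γ,
    (HolSmooth.const _).mul hu.hol_δ, fun z => ?_, by simp [hu'.γ_zero], by simp [hu.γ_zero],
    by simp [hu.δ_zero, hu'.δ_zero], by simp [hu.δ_zero, hτ], fun z hz h0 => ?_,
    fun z hz h0 => ?_⟩
  · have h1 := hg z
    have h2 := hg' z
    rw [upper_mul_diag_mul] at h1 h2
    rw [invStar_eq] at h2
    have e10 := congrFun (congrFun h1 1) 0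
    have e11 := congrFun (congrFun h1 1) 1
    have e01 := congrArg conj (congrFun (congrFun h2 1) 0)
    have e00 := congrArg conj (congrFun (congrFun h2 1) 1)
    simp at e00 e01 e10 e11
    ext i j
    fin_cases i <;> fin_cases j <;> simp [e00, e10, e11]
    rw [← e01, neg_neg]
  · have := hu'.det_eq_one z hz
    simp only [neg_eq_zero, mul_eq_zero, hτ', false_or] at h0
    rw [h0.1, h0.2] at this
    simp at this
  · have := hu.det_eq_one z hz
    simp only [mul_eq_zero, hτi, false_or] at h0
    rw [h0.1, h0.2] at this
    simp at this

end

section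

/-! ### Convergence of the root products -/

/-- `f` is smooth and its derivatives of order at most `m` are bounded by `K`. -/
structure BddDeriv (m : ℕ) (K : ℝ) (f : Circle → ℂ) : Prop where
  sm : Sm f
  bound : ∀ j ≤ m, ∀ θ : ℝ, ‖iteratedDeriv j (fun t : ℝ => f (Circle.exp t)) θ‖ ≤ K

lemma Sm.contDiffAt {f : Circle → ℂ} (hf : Sm f) (j : ℕ) (θ : ℝ) :
    ContDiffAt ℝ j (fun t : ℝ => f (Circle.exp t)) θ :=
  (ContDiff.of_le hf (by exact_mod_cast le_top)).contDiffAt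

namespace BddDeriv

variable {m : ℕ} {K K' : ℝ} {f g : Circle → ℂ}

lemma nonneg (hf : BddDeriv m K f) : 0 ≤ K :=
  (norm_nonneg _).trans (hf.bound 0 (Nat.zero_le _) 0)

lemma mono (hf : BddDeriv m K f) (h : K ≤ K') : BddDeriv m K' f :=
  ⟨hf.sm, fun j hj θ => (hf.bound j hj θ).trans h⟩

lemma add (hf : BddDeriv m K f) (hg : BddDeriv m K' g) :
    BddDeriv m (K + K') (fun z => f z + g z) := by
  refine ⟨hf.sm.add hg.sm, fun j hj θ => ?_⟩
  have := iteratedDeriv_add (hf.sm.contDiffAt j θ) (hg.sm.contDiffAt j θ)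
  refine (congrArg norm this).trans_le ?_
  exact (norm_add_le _ _).trans (add_le_add (hf.bound j hj θ) (hg.bound j hj θ))

lemma const_mul (c : ℂ) (hf : BddDeriv m K f) : BddDeriv m (‖c‖ * K) (fun z => c * f z) := by
  refine ⟨(Sm.const c).mul hf.sm, fun j hj θ => ?_⟩
  rw [iteratedDeriv_const_mul_field, norm_mul]
  gcongr
  exact hf.bound j hj θ

/-- By Leibniz' rule the binomial sum of the powers of `|n|` is `(|n| + 1) ^ j`. -/
lemma zpow_mul (n : ℤ) (hf : BddDeriv m K f) :
    BddDeriv m ((|(n : ℝ)| + 1) ^ m * K) (fun z => (z : ℂ) ^ n * f z) := by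
  refine ⟨(Sm.zpow n).mul hf.sm, fun j hj θ => ?_⟩
  have h := iteratedDeriv_mul ((Sm.zpow n).contDiffAt j θ) (hf.sm.contDiffAt j θ)
  refine (congrArg norm h).trans_le ?_
  have hK := hf.nonneg
  calc _ ≤ ∑ i ∈ Finset.range (j + 1), |(n : ℝ)| ^ i * 1 ^ (j - i) * (j.choose i) * K := by
        refine norm_sum_le_of_le _ fun i hi => ?_
        rw [iteratedDeriv_zpow, norm_mul, norm_mul, norm_mul, norm_pow, norm_mul, norm_zpow,
          Circle.norm_coe, Complex.norm_I, one_zpow, mul_one, mul_one, Complex.norm_natCast,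
          Complex.norm_intCast, one_pow, mul_one, mul_comm (j.choose i : ℝ)]
        gcongr
        exact hf.bound _ (by omega) θ
    _ = (|(n : ℝ)| + 1) ^ j * K := by rw [← Finset.sum_mul, ← add_pow]
    _ ≤ (|(n : ℝ)| + 1) ^ m * K := by
        gcongr
        simp

end BddDeriv

lemma Sm.exists_bddDeriv {f : Circle → ℂ} (hf : Sm f) (m : ℕ) : ∃ K, BddDeriv m K f := by
  have hb : ∀ j : ℕ, ∃ C : ℝ, ∀ θ : ℝ, ‖iteratedDeriv j (fun t : ℝ => f (Circle.exp t)) θ‖ ≤ C := by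
    intro j
    have hc : Continuous (iteratedDeriv j (fun θ : ℝ => f (Circle.exp θ))) :=
      ContDiff.continuous_iteratedDeriv j hf (by exact_mod_cast le_top)
    obtain ⟨C, hC⟩ := (isCompact_Icc (a := (0 : ℝ)) (b := 2 * Real.pi)).exists_bound_of_continuousOn
      hc.continuousOn
    refine ⟨C, fun θ => ?_⟩
    obtain ⟨y, hy, hy2⟩ := (iteratedDeriv_periodic (exp_periodic f) j).exists_mem_Ico₀
      Real.two_pi_pos θ
    rw [hy2]
    exact hC y ⟨hy.1, hy.2.le⟩
  choose C hC using hb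
  refine ⟨∑ i ∈ Finset.range (m + 1), |C i|, hf, fun j hj θ => (hC j θ).trans ?_⟩
  exact (le_abs_self _).trans (Finset.single_le_sum (f := fun i => |C i|)
    (fun i _ => abs_nonneg _) (Finset.mem_range.2 (by omega)))

/-- The limit is `G 0` plus the telescoping series, which may be differentiated termwise because the
increments of every order have summable bounds. -/
lemma exists_smooth_limit {G : ℕ → Circle → ℂ} (hG : Sm (G 0)) {ε : ℕ → ℕ → ℝ}
    (hε : ∀ m, Summable (ε m))
    (h : ∀ m N, BddDeriv m (ε m N) (fun z => G (N + 1) z - G N z)) :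
    ∃ g : Circle → ℂ, Sm g ∧ ∀ m : ℕ, TendstoUniformly
      (fun (N : ℕ) (θ : ℝ) => iteratedDeriv m (fun t : ℝ => G N (Circle.exp t)) θ)
      (fun θ : ℝ => iteratedDeriv m (fun t : ℝ => g (Circle.exp t)) θ) Filter.atTop := by
  set D : ℕ → ℝ → ℂ := fun N t => G (N + 1) (Circle.exp t) - G N (Circle.exp t) with hD
  have hDs : ∀ N, ContDiff ℝ ∞ (D N) := fun N => (h 0 N).sm
  have hb : ∀ m N θ, ‖iteratedFDeriv ℝ m (D N) θ‖ ≤ ε m N := fun m N θ => by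
    rw [norm_iteratedFDeriv_eq_norm_iteratedDeriv]
    exact (h m N).bound m le_rfl θ
  have hts : ContDiff ℝ ∞ (fun t => ∑' N, D N t) :=
    contDiff_tsum (N := ⊤) hDs (fun k _ => hε k) (fun k N θ _ => hb k N θ)
  have hsum : Sm (fun z => G 0 z + ∑' N, (G (N + 1) z - G N z)) := ContDiff.add hG hts
  have hGsm : ∀ N, Sm (G N) := by
    intro N
    induction N with
    | zero => exact hG
    | succ N ih => simpa using ih.add (h 0 N).sm
  refine ⟨_, hsum, fun m => ?_⟩
  have hlim : ∀ θ : ℝ, iteratedDeriv m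
      (fun t : ℝ => G 0 (Circle.exp t) + ∑' N, (G (N + 1) (Circle.exp t) - G N (Circle.exp t))) θ =
      iteratedDeriv m (fun t : ℝ => G 0 (Circle.exp t)) θ + ∑' N, iteratedDeriv m (D N) θ := by
    intro θ
    have h1 := iteratedDeriv_add (hG.contDiffAt m θ)
      ((hts.of_le (by exact_mod_cast le_top)).contDiffAt (x := θ) : ContDiffAt ℝ m _ θ)
    refine h1.trans (congrArg _ ?_)
    rw [iteratedDeriv_eq_iteratedFDeriv, iteratedFDeriv_tsum_apply (N := ⊤) hDs (fun k _ => hε k)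
      (fun k N θ _ => hb k N θ) le_top]
    have hsm : Summable fun N => iteratedFDeriv ℝ m (D N) θ :=
      Summable.of_norm_bounded (hε m) fun N => hb m N θ
    simp only [iteratedDeriv_eq_iteratedFDeriv]
    exact ContinuousMultilinearMap.tsum_eval hsm _
  have hpart : ∀ N θ, iteratedDeriv m (fun t : ℝ => G N (Circle.exp t)) θ =
      iteratedDeriv m (fun t : ℝ => G 0 (Circle.exp t)) θ +
        ∑ i ∈ Finset.range N, iteratedDeriv m (D i) θ := by
    intro N θ
    induction N with
    | zero => simp
    | succ N ih =>
      rw [Finset.sum_range_succ, ← add_assoc, ← ih]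
      have := iteratedDeriv_sub ((hGsm (N + 1)).contDiffAt m θ) ((hGsm N).contDiffAt m θ)
      have h2 : iteratedDeriv m (D N) θ = _ := this
      rw [h2]
      ring
  have hu := tendstoUniformly_tsum_nat (f := fun N θ => iteratedDeriv m (D N) θ) (hε m)
    fun N θ => (h m N).bound m le_rfl θ
  rw [Metric.tendstoUniformly_iff] at hu ⊢
  intro e he
  filter_upwards [hu e he] with N hN θ
  rw [hlim, hpart N, dist_add_left]
  exact hN θ

lemma prod_one_add_le {ε : ℕ → ℝ} (h0 : ∀ n, 0 ≤ ε n) (hs : Summable ε) (N : ℕ) :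
    ∏ i ∈ Finset.range N, (1 + ε i) ≤ Real.exp (∑' i, ε i) := by
  calc ∏ i ∈ Finset.range N, (1 + ε i) ≤ ∏ i ∈ Finset.range N, Real.exp (ε i) :=
        Finset.prod_le_prod (fun i _ => by linarith [h0 i])
          fun i _ => by linarith [Real.add_one_le_exp (ε i)]
    _ = Real.exp (∑ i ∈ Finset.range N, ε i) := (Real.exp_sum _ _).symm
    _ ≤ _ := Real.exp_le_exp.2 (hs.sum_le_tsum _ fun i _ => h0 i)

/-! ### Uniform bounds and convergence for finite root products -/

section RootProducts

variable {s : ℕ → ℂ} {η : ℕ → ℂ × ℂ}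

lemma rootProd₁_succ_zero (N : ℕ) (z : Circle) (j : Fin 2) :
    rootProd₁ s η (N + 1) z 0 j = s (N + 1) * (rootProd₁ s η N z 0 j +
      (η (N + 1)).2 * ((z : ℂ) ^ ((N + 1 : ℕ) : ℤ) * rootProd₁ s η N z 1 j)) := by
  rw [zpow_natCast]
  simp [rootProd₁, rootFactor₁, Matrix.mul_apply, Fin.sum_univ_two, -Nat.cast_add]
  ring

lemma rootProd₁_succ_one (N : ℕ) (z : Circle) (j : Fin 2) :
    rootProd₁ s η (N + 1) z 1 j = s (N + 1) * (rootProd₁ s η N z 1 j +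
      (η (N + 1)).1 * ((z : ℂ) ^ (-((N + 1 : ℕ) : ℤ)) * rootProd₁ s η N z 0 j)) := by
  simp [rootProd₁, rootFactor₁, Matrix.mul_apply, Fin.sum_univ_two, -Nat.cast_add]
  ring

lemma sm_rootProd₁ (N : ℕ) (i j : Fin 2) : Sm (fun z => rootProd₁ s η N z i j) := by
  induction N generalizing i j with
  | zero => fin_cases i <;> fin_cases j <;> simp [rootProd₁, rootFactor₁] <;> exact Sm.const _
  | succ N ih =>
    fin_cases i
    · simp only [Fin.zero_eta, rootProd₁_succ_zero]
      exact (Sm.const _).mul ((ih 0 j).add ((Sm.const _).mul ((Sm.zpow _).mul (ih 1 j))))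
    · simp only [Fin.mk_one, rootProd₁_succ_one]
      exact (Sm.const _).mul ((ih 1 j).add ((Sm.const _).mul ((Sm.zpow _).mul (ih 0 j))))

lemma det_rootProd₁ (h : IsParam₁ s η) (N : ℕ) (z : Circle) : (rootProd₁ s η N z).det = 1 := by
  have hf : ∀ n, (rootFactor₁ (s n) (η n) n z).det = 1 := by
    intro n
    have h1 := h.root n
    have h2 := h.nondeg n
    have h3 := zpow_ne_zero n (Circle.coe_ne_zero z)
    rw [rootFactor₁, Matrix.det_smul, Fintype.card_fin, h1, Matrix.det_fin_two_of, zpow_neg,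
      zpow_natCast]
    rw [zpow_natCast] at h3
    field_simp
  induction N with
  | zero => exact hf 0
  | succ N ih => rw [rootProd₁, Matrix.det_mul, hf, ih, one_mul]

/-- The size of the `N`-th increment of the root product, relative to a bound for the product. -/
def incr (s : ℕ → ℂ) (η : ℕ → ℂ × ℂ) (m N : ℕ) : ℝ :=
  ‖s (N + 1) - 1‖ + ‖s (N + 1)‖ * (‖η (N + 1)‖ * ((N : ℝ) + 2) ^ m)

lemma incr_nonneg (m N : ℕ) : 0 ≤ incr s η m N := by unfold incr; positivity

lemma RapidlyDecreasing.summable (h : RapidlyDecreasing η) (m : ℕ) :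
    Summable (fun N : ℕ => ‖η (N + 1)‖ * ((N : ℝ) + 2) ^ m) := by
  obtain ⟨C, hC⟩ := h (m + 2)
  refine Summable.of_nonneg_of_le (fun N => by positivity) (fun N => ?_)
    (((summable_nat_add_iff 1).2 (Real.summable_one_div_nat_pow.2 one_lt_two)).mul_left
      (2 ^ m * C))
  have h1 := hC (N + 1)
  have h2 : (0 : ℝ) < ((N + 1 : ℕ) : ℝ) ^ 2 := by positivity
  rw [mul_one_div, le_div_iff₀ h2]
  calc ‖η (N + 1)‖ * ((N : ℝ) + 2) ^ m * ((N + 1 : ℕ) : ℝ) ^ 2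
      ≤ ‖η (N + 1)‖ * (2 * ((N + 1 : ℕ) : ℝ)) ^ m * ((N + 1 : ℕ) : ℝ) ^ 2 := by
        gcongr
        push_cast
        linarith [N.cast_nonneg (α := ℝ)]
    _ = 2 ^ m * (((N + 1 : ℕ) : ℝ) ^ (m + 2) * ‖η (N + 1)‖) := by
        rw [mul_pow]; ring
    _ ≤ _ := by gcongr

lemma RapidlyDecreasing.tendsto_zero (h : RapidlyDecreasing η) :
    Filter.Tendsto (fun n => ‖η n‖) Filter.atTop (𝓝 0) := by
  have := (h.summable 0).tendsto_atTop_zero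
  rw [← Filter.tendsto_add_atTop_iff_nat 1]
  simpa using this

/-- A root `x` satisfies `(x - 1) * (x + 1) * (1 - η⁻η⁺) = η⁻η⁺`. Convergence of the roots to `1`
keeps `x + 1` away from `0`, so `x - 1` is controlled by `η`; the other branch of the root would
fail here. -/
lemma IsParam₁.summable_incr (h : IsParam₁ s η) (m : ℕ) : Summable (incr s η m) := by
  have hη := h.rapid.summable m
  have hη0 := h.rapid.tendsto_zero.comp (Filter.tendsto_add_atTop_nat 1)
  have hs := h.root_tendsto.comp (Filter.tendsto_add_atTop_nat 1)
  refine Summable.of_norm_bounded_eventually_nat (hη.mul_left 4) ?_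
  have e1 : ∀ᶠ N in Filter.atTop, ‖η (N + 1)‖ < 1 / 2 :=
    hη0.eventually (gt_mem_nhds (by norm_num))
  have e2 : ∀ᶠ N in Filter.atTop, ‖s (N + 1) - 1‖ < 1 := by
    have := (tendsto_iff_norm_sub_tendsto_zero.1 hs).eventually (gt_mem_nhds zero_lt_one)
    simpa using this
  filter_upwards [e1, e2] with N h1 h2
  rw [Real.norm_of_nonneg (incr_nonneg _ _), incr]
  set e := η (N + 1) with he
  set x := s (N + 1) with hx
  have hroot := h.root (N + 1)
  rw [← he, ← hx] at hroot
  have hnd := h.nondeg (N + 1)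
  rw [← he] at hnd
  have h3 : ‖e.1 * e.2‖ ≤ ‖e‖ * ‖e‖ := by
    rw [norm_mul]
    exact mul_le_mul (norm_fst_le e) (norm_snd_le e) (norm_nonneg _) (norm_nonneg _)
  have h0 := norm_nonneg e
  have h4 : ‖e.1 * e.2‖ ≤ 1 / 2 * ‖e‖ := h3.trans (by gcongr)
  have h5 : 1 / 2 ≤ ‖1 - e.1 * e.2‖ := by
    have := norm_sub_norm_le (1 : ℂ) (e.1 * e.2)
    rw [norm_one] at this
    linarith
  have h6 : 1 ≤ ‖x + 1‖ := by
    have := norm_sub_norm_le (2 : ℂ) (1 - x)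
    rw [show (2 : ℂ) - (1 - x) = x + 1 by ring, Complex.norm_ofNat, norm_sub_rev] at this
    linarith
  have h7 : ‖x‖ ≤ 2 := by
    have := norm_add_le (x - 1) 1
    rw [sub_add_cancel, norm_one] at this
    linarith
  have h8 : (x - 1) * (x + 1) * (1 - e.1 * e.2) = e.1 * e.2 := by
    have : x ^ 2 * (1 - e.1 * e.2) = 1 := by rw [hroot, inv_mul_cancel₀ hnd]
    linear_combination this
  have h9 : ‖x - 1‖ ≤ ‖e‖ := by
    have h10 := congrArg norm h8
    rw [norm_mul, norm_mul] at h10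
    have : ‖x - 1‖ * 1 * (1 / 2) ≤ ‖x - 1‖ * ‖x + 1‖ * ‖1 - e.1 * e.2‖ := by gcongr
    linarith
  have h11 : (1 : ℝ) ≤ ((N : ℝ) + 2) ^ m := one_le_pow₀ (by linarith [N.cast_nonneg (α := ℝ)])
  have h12 : ‖e‖ ≤ ‖e‖ * ((N : ℝ) + 2) ^ m := le_mul_of_one_le_right h0 h11
  have h13 : ‖x‖ * (‖e‖ * ((N : ℝ) + 2) ^ m) ≤ 2 * (‖e‖ * ((N : ℝ) + 2) ^ m) := by gcongr
  linarith

/-- A new factor adds `s - 1` times the same row and `s * η^±` times the other row shifted by `±(N +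
1)`; `m` derivatives of the shift cost `(N + 2) ^ m`. -/
lemma bddDeriv_incr {m N : ℕ} {K : ℝ}
    (h : ∀ i j, BddDeriv m K (fun z => rootProd₁ s η N z i j)) (i j : Fin 2) :
    BddDeriv m (incr s η m N * K)
      (fun z => rootProd₁ s η (N + 1) z i j - rootProd₁ s η N z i j) := by
  have hK := (h 0 0).nonneg
  have key : ∀ (f g : Circle → ℂ) (c : ℂ) (n : ℤ), BddDeriv m K f → BddDeriv m K g →
      ‖c‖ ≤ ‖η (N + 1)‖ → |(n : ℝ)| = N + 1 →
      BddDeriv m (incr s η m N * K)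
        (fun z => (s (N + 1) - 1) * f z + s (N + 1) * (c * ((z : ℂ) ^ n * g z))) := by
    intro f g c n hf hg hc hn
    refine ((hf.const_mul (s (N + 1) - 1)).add
      (((hg.zpow_mul n).const_mul c).const_mul (s (N + 1)))).mono ?_
    have h1 : ‖c‖ * (((N : ℝ) + 1 + 1) ^ m * K) ≤ ‖η (N + 1)‖ * ((N : ℝ) + 2) ^ m * K := by
      rw [show (N : ℝ) + 1 + 1 = N + 2 by ring, ← mul_assoc]
      gcongr
    rw [hn, incr, add_mul, mul_assoc ‖s (N + 1)‖]
    gcongr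
  fin_cases i
  · convert key _ _ (η (N + 1)).2 ((N + 1 : ℕ) : ℤ) (h 0 j) (h 1 j) (norm_snd_le _) ?_ using 2
    · simp only [Fin.zero_eta, rootProd₁_succ_zero]
      ring
    · push_cast
      exact abs_of_nonneg (by positivity)
  · convert key _ _ (η (N + 1)).1 (-((N + 1 : ℕ) : ℤ)) (h 1 j) (h 0 j) (norm_fst_le _) ?_ using 2
    · simp only [Fin.mk_one, rootProd₁_succ_one]
      ring
    · push_cast
      rw [abs_neg]
      exact abs_of_nonneg (by positivity)

/-- A discrete Gronwall argument: each step multiplies the bound by `1 + incr`, and the product of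
these is at most the exponential of a convergent sum. -/
lemma IsParam₁.exists_bddDeriv (h : IsParam₁ s η) (m : ℕ) :
    ∃ K, ∀ N i j, BddDeriv m K (fun z => rootProd₁ s η N z i j) := by
  choose K₀ hK₀ using fun i j => (sm_rootProd₁ (s := s) (η := η) 0 i j).exists_bddDeriv m
  set K := ∑ i, ∑ j, K₀ i j with hKdef
  have hK : ∀ i j, BddDeriv m K (fun z => rootProd₁ s η 0 z i j) := by
    intro i j
    refine (hK₀ i j).mono ?_
    exact (Finset.single_le_sum (f := fun j => K₀ i j) (fun j _ => (hK₀ i j).nonneg)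
      (Finset.mem_univ j)).trans (Finset.single_le_sum (f := fun i => ∑ j, K₀ i j)
      (fun i _ => Finset.sum_nonneg fun j _ => (hK₀ i j).nonneg) (Finset.mem_univ i))
  have hK0 := (hK 0 0).nonneg
  have hind : ∀ N i j, BddDeriv m (K * ∏ n ∈ Finset.range N, (1 + incr s η m n))
      (fun z => rootProd₁ s η N z i j) := by
    intro N
    induction N with
    | zero => simpa using hK
    | succ N ih =>
      intro i j
      have := (ih i j).add (bddDeriv_incr ih i j)
      simp only [add_sub_cancel] at this
      rw [Finset.prod_range_succ]
      refine this.mono (le_of_eq (by ring))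
  refine ⟨K * Real.exp (∑' n, incr s η m n), fun N i j => (hind N i j).mono ?_⟩
  gcongr
  exact prod_one_add_le (incr_nonneg m) (h.summable_incr m) N

/-- The root products converge in `C^∞`. -/
theorem IsParam₁.exists_loop (h : IsParam₁ s η) :
    ∃ g : Loop, IsSmoothLoop g ∧ IsRootFactorization₁ g s η := by
  choose K hK using h.exists_bddDeriv
  choose G hGs hG using fun i j : Fin 2 => exists_smooth_limit
    (G := fun N z => rootProd₁ s η N z i j) (sm_rootProd₁ 0 i j)
    (fun m => (h.summable_incr m).mul_right (K m)) fun m N => bddDeriv_incr (hK m N) i j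
  have hpt : ∀ i j z, Filter.Tendsto (fun N => rootProd₁ s η N z i j) Filter.atTop
      (𝓝 (G i j z)) := by
    intro i j z
    obtain ⟨θ, rfl⟩ := exists_exp z
    simpa using (hG i j 0).tendsto_at θ
  have hdet : ∀ z, (Matrix.of fun i j => G i j z).det = 1 := by
    intro z
    have h1 : Filter.Tendsto (fun N => (rootProd₁ s η N z).det) Filter.atTop
        (𝓝 (Matrix.of fun i j => G i j z).det) := by
      simp only [Matrix.det_fin_two]
      exact ((hpt 0 0 z).mul (hpt 1 1 z)).sub ((hpt 0 1 z).mul (hpt 1 0 z))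
    refine tendsto_nhds_unique h1 ?_
    simp [det_rootProd₁ h]
  exact ⟨fun z => ⟨_, hdet z⟩, fun i j => hGs i j, h, fun m i j => hG i j m⟩

end RootProducts

end

section

/-! ### Stripping off root factors from the right -/

/-- The Fourier coefficients of a matrix valued function. -/
def mcoef (M : Circle → Matrix (Fin 2) (Fin 2) ℂ) (i j : Fin 2) (k : ℤ) : ℂ :=
  coef (fun z => M z i j) k

/-- Smoothness of all the matrix entries. -/
def MSm (M : Circle → Matrix (Fin 2) (Fin 2) ℂ) : Prop := ∀ i j, Sm (fun z => M z i j)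

/-- Up to a scalar, the inverse of a root factor. -/
def stripFactor (e : ℂ × ℂ) (n : ℕ) (z : ℂ) : Matrix (Fin 2) (Fin 2) ℂ :=
  !![1, -(e.2 * z ^ (n : ℤ)); -(e.1 * z ^ (-(n : ℤ))), 1]

/-- The loop `M` after multiplication by the (unnormalized) inverses of the first root factors. -/
def strip (η : ℕ → ℂ × ℂ) (M : Circle → Matrix (Fin 2) (Fin 2) ℂ) :
    ℕ → Circle → Matrix (Fin 2) (Fin 2) ℂ
  | 0, z => M z
  | N + 1, z => strip η M N z * stripFactor (η N) N z

variable {η : ℕ → ℂ × ℂ} {s : ℕ → ℂ} {M : Circle → Matrix (Fin 2) (Fin 2) ℂ}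

lemma strip_succ_zero (N : ℕ) (z : Circle) (i : Fin 2) : strip η M (N + 1) z i 0 =
    strip η M N z i 0 - (η N).1 * ((z : ℂ) ^ (-(N : ℤ)) * strip η M N z i 1) := by
  simp only [strip, stripFactor, Matrix.mul_apply, Fin.sum_univ_two, Matrix.of_apply,
    Matrix.cons_val_zero, Matrix.cons_val_one]
  ring

lemma strip_succ_one (N : ℕ) (z : Circle) (i : Fin 2) : strip η M (N + 1) z i 1 =
    strip η M N z i 1 - (η N).2 * ((z : ℂ) ^ (N : ℤ) * strip η M N z i 0) := by
  simp only [strip, stripFactor, Matrix.mul_apply, Fin.sum_univ_two, Matrix.of_apply,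
    Matrix.cons_val_zero, Matrix.cons_val_one]
  ring

lemma msm_strip (h : MSm M) (N : ℕ) : MSm (strip η M N) := by
  induction N with
  | zero => exact h
  | succ N ih =>
    intro i j
    fin_cases j
    · simp only [Fin.zero_eta, strip_succ_zero]
      exact (ih i 0).sub ((Sm.const _).mul ((Sm.zpow _).mul (ih i 1)))
    · simp only [Fin.mk_one, strip_succ_one]
      exact (ih i 1).sub ((Sm.const _).mul ((Sm.zpow _).mul (ih i 0)))

lemma coef_sub_mul_zpow {f g : Circle → ℂ} (hf : Sm f) (hg : Sm g) (c : ℂ) (n k : ℤ) :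
    coef (fun z => f z - c * ((z : ℂ) ^ n * g z)) k = coef f k - c * coef g (k - n) := by
  rw [coef_sub hf ((Sm.const c).mul ((Sm.zpow n).mul hg)),
    coef_const_mul c (fun z => (z : ℂ) ^ n * g z), coef_zpow_mul]

lemma mcoef_strip_zero (h : MSm M) (N : ℕ) (i : Fin 2) (k : ℤ) :
    mcoef (strip η M (N + 1)) i 0 k =
      mcoef (strip η M N) i 0 k - (η N).1 * mcoef (strip η M N) i 1 (k + N) := by
  have h1 := msm_strip (η := η) h N
  unfold mcoef
  simp only [strip_succ_zero]
  rw [coef_sub_mul_zpow (h1 i 0) (h1 i 1), sub_neg_eq_add]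

lemma mcoef_strip_one (h : MSm M) (N : ℕ) (i : Fin 2) (k : ℤ) :
    mcoef (strip η M (N + 1)) i 1 k =
      mcoef (strip η M N) i 1 k - (η N).2 * mcoef (strip η M N) i 0 (k - N) := by
  have h1 := msm_strip (η := η) h N
  unfold mcoef
  simp only [strip_succ_one]
  rw [coef_sub_mul_zpow (h1 i 1) (h1 i 0)]

/-- Support conditions on the Fourier coefficients which characterize tails of root products. -/
structure Tri (M : Circle → Matrix (Fin 2) (Fin 2) ℂ) (N : ℕ) : Prop where
  c00 : ∀ k < 0, mcoef M 0 0 k = 0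
  c01 : ∀ k < (N : ℤ), mcoef M 0 1 k = 0
  c10 : ∀ k > -(N : ℤ), mcoef M 1 0 k = 0
  c11 : ∀ k > 0, mcoef M 1 1 k = 0

/-- The leading coefficients of the off-diagonal entries are given by `e`. -/
structure Lead (M : Circle → Matrix (Fin 2) (Fin 2) ℂ) (N : ℕ) (e : ℂ × ℂ) : Prop where
  c01 : mcoef M 0 1 N = e.2 * mcoef M 0 0 0
  c10 : mcoef M 1 0 (-(N : ℤ)) = e.1 * mcoef M 1 1 0

/-- Stripping subtracts from each off-diagonal entry a shifted diagonal entry, and `Lead` says that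
this removes exactly the extremal coefficient. -/
lemma Tri.strip_succ (h : MSm M) {N : ℕ} (ht : Tri (strip η M N) N)
    (hl : Lead (strip η M N) N (η N)) : Tri (strip η M (N + 1)) (N + 1) := by
  refine ⟨fun k hk => ?_, fun k hk => ?_, fun k hk => ?_, fun k hk => ?_⟩
  · rw [mcoef_strip_zero h, ht.c00 k hk, ht.c01 _ (by omega)]
    simp
  · rw [mcoef_strip_one h]
    rcases (show k < N ∨ k = N by push_cast at hk; omega) with h1 | h1
    · rw [ht.c01 k h1, ht.c00 _ (by omega)]
      simp
    · rw [h1, hl.c01, sub_self (N : ℤ), sub_self]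
  · rw [mcoef_strip_zero h]
    rcases (show k > -(N : ℤ) ∨ k = -N by push_cast at hk; omega) with h1 | h1
    · rw [ht.c10 k h1, ht.c11 _ (by omega)]
      simp
    · rw [h1, hl.c10, neg_add_cancel, sub_self]
  · rw [mcoef_strip_one h, ht.c11 k hk, ht.c10 _ (by omega)]
    simp

/-! ### Stripping of root products -/

/-- Stripping acts on the right, so it commutes with adding later root factors and with the
unipotent multiplier. -/
lemma strip_mul_left (R : Circle → Matrix (Fin 2) (Fin 2) ℂ) (N : ℕ) (z : Circle) :
    strip η (fun z => R z * M z) N z = R z * strip η M N z := by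
  induction N with
  | zero => rfl
  | succ N ih => rw [strip, ih, strip, Matrix.mul_assoc]

lemma IsParam₁.s_ne_zero (h : IsParam₁ s η) (n : ℕ) : s n ≠ 0 := by
  intro h0
  have := h.root n
  rw [h0, zero_pow two_ne_zero] at this
  exact inv_ne_zero (h.nondeg n) this.symm

lemma IsParam₁.one_sub (h : IsParam₁ s η) (n : ℕ) :
    1 - (η n).1 * (η n).2 = (s n)⁻¹ ^ 2 := by
  rw [inv_pow, h.root n, inv_inv]

lemma rootFactor₁_mul_stripFactor (h : IsParam₁ s η) (n : ℕ) (z : Circle) :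
    rootFactor₁ (s n) (η n) n z * stripFactor (η n) n z = (s n)⁻¹ • 1 := by
  have h1 := h.one_sub n
  have h0 := h.s_ne_zero n
  have h3 := pow_ne_zero n (Circle.coe_ne_zero z)
  have h4 : s n * (1 - (η n).1 * (η n).2) = (s n)⁻¹ := by
    rw [h1]; field_simp
  rw [← h4, rootFactor₁, stripFactor]
  ext i j
  fin_cases i <;> fin_cases j <;> simp [Matrix.mul_apply, Fin.sum_univ_two] <;> field_simp <;> ring

lemma strip_rootProd₁ (h : IsParam₁ s η) (N : ℕ) (z : Circle) :
    strip η (rootProd₁ s η N) (N + 1) z = (∏ n ∈ Finset.range (N + 1), (s n)⁻¹) • 1 := by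
  induction N with
  | zero =>
    rw [strip, strip, rootProd₁, rootFactor₁_mul_stripFactor h]
    simp
  | succ N ih =>
    have h1 : rootProd₁ s η (N + 1) =
        fun z : Circle => rootFactor₁ (s (N + 1)) (η (N + 1)) (N + 1) z * rootProd₁ s η N z := rfl
    rw [strip, h1, strip_mul_left, ih, Matrix.mul_smul, Matrix.mul_one, Matrix.smul_mul,
      rootFactor₁_mul_stripFactor h, Finset.prod_range_succ _ (N + 1), smul_smul]

lemma strip_rootProd₁_self (h : IsParam₁ s η) (N : ℕ) (z : Circle) :
    strip η (rootProd₁ s η N) N z =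
      (∏ n ∈ Finset.range N, (s n)⁻¹) • rootFactor₁ (s N) (η N) N z := by
  cases N with
  | zero => simp [strip, rootProd₁]
  | succ N =>
    have h1 : rootProd₁ s η (N + 1) =
        fun z : Circle => rootFactor₁ (s (N + 1)) (η (N + 1)) (N + 1) z * rootProd₁ s η N z := rfl
    rw [h1, strip_mul_left, strip_rootProd₁ h, Matrix.mul_smul, Matrix.mul_one]

/-- Stripping `M` is right multiplication by a matrix independent of `M`; applying it to the root
product identifies that matrix as a scalar multiple of the inverse of the product. -/
lemma strip_mul_rootProd₁ (h : IsParam₁ s η) (N : ℕ) (z : Circle) :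
    strip η M (N + 1) z * rootProd₁ s η N z = (∏ n ∈ Finset.range (N + 1), (s n)⁻¹) • M z := by
  have h1 : ∀ L : Circle → Matrix (Fin 2) (Fin 2) ℂ,
      strip η L (N + 1) z = L z * strip η (fun _ => 1) (N + 1) z := fun L => by
    rw [← strip_mul_left]
    simp
  have hc : (∏ n ∈ Finset.range (N + 1), (s n)⁻¹) ≠ 0 :=
    Finset.prod_ne_zero_iff.2 fun n _ => inv_ne_zero (h.s_ne_zero n)
  set c := ∏ n ∈ Finset.range (N + 1), (s n)⁻¹ with hcdef
  have h2 := strip_rootProd₁ h N z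
  rw [h1, ← hcdef] at h2
  have h3 : rootProd₁ s η N z * (c⁻¹ • strip η (fun _ => 1) (N + 1) z) = 1 := by
    rw [Matrix.mul_smul, h2, smul_smul, inv_mul_cancel₀ hc, one_smul]
  have h4 := mul_eq_one_comm.1 h3
  rw [Matrix.smul_mul, inv_smul_eq_iff₀ hc] at h4
  rw [h1, Matrix.mul_assoc, h4, Matrix.mul_smul, Matrix.mul_one]

/-- The supports of the Fourier coefficients of a finite root product with indices in `[N, L]`. -/
structure Band (M : Circle → Matrix (Fin 2) (Fin 2) ℂ) (N L : ℤ) : Prop where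
  c00 : ∀ k, ¬ (0 ≤ k ∧ k ≤ L - N) → mcoef M 0 0 k = 0
  c01 : ∀ k, ¬ (N ≤ k ∧ k ≤ L) → mcoef M 0 1 k = 0
  c10 : ∀ k, ¬ (-L ≤ k ∧ k ≤ -N) → mcoef M 1 0 k = 0
  c11 : ∀ k, ¬ (N - L ≤ k ∧ k ≤ 0) → mcoef M 1 1 k = 0

/-- Induction on the number of remaining factors. A factor of index `N + j + 1` shifts the other row
beyond the present leading positions, so it widens the band outwards by one and only multiplies the
leading and central coefficients by its root. -/
lemma band_strip_rootProd₁ (h : IsParam₁ s η) (N j : ℕ) :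
    Band (strip η (rootProd₁ s η (N + j)) N) N (N + j : ℕ) ∧
      Lead (strip η (rootProd₁ s η (N + j)) N) N (η N) ∧
      mcoef (strip η (rootProd₁ s η (N + j)) N) 0 0 0 =
        (∏ n ∈ Finset.range N, (s n)⁻¹) * ∏ i ∈ Finset.range (j + 1), s (N + i) ∧
      mcoef (strip η (rootProd₁ s η (N + j)) N) 1 1 0 =
        mcoef (strip η (rootProd₁ s η (N + j)) N) 0 0 0 := by
  induction j with
  | zero =>
    set c := ∏ n ∈ Finset.range N, (s n)⁻¹ with hc
    have e : strip η (rootProd₁ s η (N + 0)) N =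
        fun z : Circle => c • rootFactor₁ (s N) (η N) N z := funext fun z => strip_rootProd₁_self h N z
    have e00 : ∀ k, mcoef (strip η (rootProd₁ s η (N + 0)) N) 0 0 k =
        if k = 0 then c * s N else 0 := by
      intro k
      rw [e, ← coef_const]
      simp [mcoef, rootFactor₁]
    have e11 : ∀ k, mcoef (strip η (rootProd₁ s η (N + 0)) N) 1 1 k =
        if k = 0 then c * s N else 0 := by
      intro k
      rw [e, ← coef_const]
      simp [mcoef, rootFactor₁]
    have e01 : ∀ k, mcoef (strip η (rootProd₁ s η (N + 0)) N) 0 1 k =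
        (c * s N * (η N).2) * if k = N then 1 else 0 := by
      intro k
      rw [e, ← coef_zpow, ← coef_const_mul]
      simp [mcoef, rootFactor₁, mul_assoc]
    have e10 : ∀ k, mcoef (strip η (rootProd₁ s η (N + 0)) N) 1 0 k =
        (c * s N * (η N).1) * if k = -(N : ℤ) then 1 else 0 := by
      intro k
      rw [e, ← coef_zpow, ← coef_const_mul]
      simp [mcoef, rootFactor₁, mul_assoc]
    refine ⟨⟨fun k hk => ?_, fun k hk => ?_, fun k hk => ?_, fun k hk => ?_⟩, ⟨?_, ?_⟩, ?_, ?_⟩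
    · rw [e00, if_neg]; rintro rfl; simp at hk
    · rw [e01, if_neg, mul_zero]; rintro rfl; simp at hk
    · rw [e10, if_neg, mul_zero]; rintro rfl; simp at hk
    · rw [e11, if_neg]; rintro rfl; simp at hk
    · rw [e01, e00, if_pos rfl, if_pos rfl]; ring
    · rw [e10, e11, if_pos rfl, if_pos rfl]; ring
    · rw [e00, if_pos rfl]; simp
    · rw [e00, e11]
  | succ j ih =>
    obtain ⟨hb, hl, hκ, h11⟩ := ih
    set T := strip η (rootProd₁ s η (N + j)) N with hT
    have hTs : MSm T := msm_strip (fun i j => sm_rootProd₁ _ i j) N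
    have e : strip η (rootProd₁ s η (N + (j + 1))) N = fun z : Circle =>
        rootFactor₁ (s (N + j + 1)) (η (N + j + 1)) (N + j + 1) z * T z := by
      ext1 z
      exact strip_mul_left _ N z
    have e0 : ∀ i k, mcoef (strip η (rootProd₁ s η (N + (j + 1))) N) 0 i k =
        s (N + j + 1) * (mcoef T 0 i k +
          (η (N + j + 1)).2 * mcoef T 1 i (k - (N + j + 1 : ℕ))) := by
      intro i k
      rw [e]
      have : (fun z : Circle => (rootFactor₁ (s (N + j + 1)) (η (N + j + 1)) (N + j + 1) z * T z)
          0 i) = fun z : Circle => s (N + j + 1) * (T z 0 i - (-(η (N + j + 1)).2) *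
            ((z : ℂ) ^ ((N + j + 1 : ℕ) : ℤ) * T z 1 i)) := by
        ext z
        rw [zpow_natCast]
        simp [rootFactor₁, Matrix.mul_apply, Fin.sum_univ_two]
        ring
      rw [mcoef, this, coef_const_mul (s (N + j + 1)) (fun z : Circle => T z 0 i - _),
        coef_sub_mul_zpow (hTs 0 i) (hTs 1 i), mcoef, mcoef]
      ring
    have e1 : ∀ i k, mcoef (strip η (rootProd₁ s η (N + (j + 1))) N) 1 i k =
        s (N + j + 1) * (mcoef T 1 i k +
          (η (N + j + 1)).1 * mcoef T 0 i (k + (N + j + 1 : ℕ))) := by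
      intro i k
      rw [e]
      have : (fun z : Circle => (rootFactor₁ (s (N + j + 1)) (η (N + j + 1)) (N + j + 1) z * T z)
          1 i) = fun z : Circle => s (N + j + 1) * (T z 1 i - (-(η (N + j + 1)).1) *
            ((z : ℂ) ^ (-((N + j + 1 : ℕ) : ℤ)) * T z 0 i)) := by
        ext z
        simp [rootFactor₁, Matrix.mul_apply, Fin.sum_univ_two, -Nat.cast_add]
        ring
      rw [mcoef, this, coef_const_mul (s (N + j + 1)) (fun z : Circle => T z 1 i - _),
        coef_sub_mul_zpow (hTs 1 i) (hTs 0 i), mcoef, mcoef, sub_neg_eq_add]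
      ring
    push_cast at hb
    refine ⟨⟨fun k hk => ?_, fun k hk => ?_, fun k hk => ?_, fun k hk => ?_⟩, ⟨?_, ?_⟩, ?_, ?_⟩
    · push_cast at hk
      rw [e0, hb.c00 _ (by omega), hb.c10 _ (by push_cast; omega)]; simp
    · push_cast at hk
      rw [e0, hb.c01 _ (by omega), hb.c11 _ (by push_cast; omega)]; simp
    · push_cast at hk
      rw [e1, hb.c10 _ (by omega), hb.c00 _ (by push_cast; omega)]; simp
    · push_cast at hk
      rw [e1, hb.c11 _ (by omega), hb.c01 _ (by push_cast; omega)]; simp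
    · rw [e0, e0, hl.c01, hb.c11 _ (by push_cast; omega), hb.c10 _ (by push_cast; omega)]; ring
    · rw [e1, e1, hl.c10, hb.c00 _ (by push_cast; omega), hb.c01 _ (by push_cast; omega)]; ring
    · rw [e0, hκ, hb.c10 _ (by push_cast; omega), Finset.prod_range_succ _ (j + 1)]
      simp only [← add_assoc]
      ring
    · rw [e0, e1, h11, hb.c10 _ (by push_cast; omega), hb.c01 _ (by push_cast; omega)]; ring

end

section

/-! ### Limits of root products -/

/-- The matrix valued function underlying a loop. -/
abbrev Loop.mat (g : Loop) : Circle → Matrix (Fin 2) (Fin 2) ℂ := fun z => (g z).1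

lemma IsSmoothLoop.msm {g : Loop} (hg : IsSmoothLoop g) : MSm g.mat := fun i j => hg i j

lemma SmoothTendsto.eventually_dist_lt {G : ℕ → Circle → Matrix (Fin 2) (Fin 2) ℂ}
    {M : Circle → Matrix (Fin 2) (Fin 2) ℂ} (h : SmoothTendsto G M) {ε : ℝ} (hε : 0 < ε) :
    ∀ᶠ N in Filter.atTop, ∀ z i j, ‖G N z i j - M z i j‖ < ε := by
  have h1 : ∀ i j, ∀ᶠ N in Filter.atTop, ∀ z, ‖G N z i j - M z i j‖ < ε := by
    intro i j
    filter_upwards [Metric.tendstoUniformly_iff.1 (h 0 i j) ε hε] with N hN z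
    obtain ⟨θ, rfl⟩ := exists_exp z
    have := hN θ
    rwa [iteratedDeriv_zero, iteratedDeriv_zero, dist_comm, dist_eq_norm] at this
  simp only [← Filter.eventually_all] at h1
  filter_upwards [h1] with N hN z i j
  exact hN i j z

lemma SmoothTendsto.tendsto_mcoef {G : ℕ → Circle → Matrix (Fin 2) (Fin 2) ℂ}
    {M : Circle → Matrix (Fin 2) (Fin 2) ℂ} (h : SmoothTendsto G M) (hG : ∀ N, MSm (G N))
    (hM : MSm M) (i j : Fin 2) (k : ℤ) :
    Filter.Tendsto (fun N => mcoef (G N) i j k) Filter.atTop (𝓝 (mcoef M i j k)) := by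
  rw [Metric.tendsto_nhds]
  intro ε hε
  filter_upwards [h.eventually_dist_lt (half_pos hε)] with N hN
  rw [dist_eq_norm, mcoef, mcoef, ← coef_sub (hG N i j) (hM i j)]
  exact (norm_coef_le (fun z => (hN z i j).le) k).trans_lt (half_lt_self hε)

lemma tendsto_mcoef_strip {η : ℕ → ℂ × ℂ} {G : ℕ → Circle → Matrix (Fin 2) (Fin 2) ℂ}
    {M : Circle → Matrix (Fin 2) (Fin 2) ℂ} (hG : ∀ N, MSm (G N)) (hM : MSm M)
    (h : ∀ i j k, Filter.Tendsto (fun N => mcoef (G N) i j k) Filter.atTop (𝓝 (mcoef M i j k)))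
    (n : ℕ) (i j : Fin 2) (k : ℤ) :
    Filter.Tendsto (fun N => mcoef (strip η (G N) n) i j k) Filter.atTop
      (𝓝 (mcoef (strip η M n) i j k)) := by
  induction n generalizing i j k with
  | zero => exact h i j k
  | succ n ih =>
    fin_cases j
    · simp only [Fin.zero_eta, mcoef_strip_zero (hG _), mcoef_strip_zero hM]
      exact (ih i 0 k).sub ((ih i 1 _).const_mul _)
    · simp only [Fin.mk_one, mcoef_strip_one (hG _), mcoef_strip_one hM]
      exact (ih i 1 k).sub ((ih i 0 _).const_mul _)

/-! ### Supports, center and quotients of a limit of root products -/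

namespace IsRootFactorization₁

variable {g : Loop} {s : ℕ → ℂ} {η : ℕ → ℂ × ℂ}

lemma tendsto_strip (h : IsRootFactorization₁ g s η) (hg : IsSmoothLoop g) (N : ℕ)
    (i j : Fin 2) (k : ℤ) :
    Filter.Tendsto (fun l => mcoef (strip η (rootProd₁ s η (N + l)) N) i j k) Filter.atTop
      (𝓝 (mcoef (strip η g.mat N) i j k)) := by
  have := tendsto_mcoef_strip (η := η) (fun N i j => sm_rootProd₁ N i j) hg.msm
    (h.2.tendsto_mcoef (fun N i j => sm_rootProd₁ N i j) hg.msm) N i j k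
  simp only [add_comm N]
  exact this.comp (Filter.tendsto_add_atTop_nat N)

/-- For fixed `N` every Fourier coefficient of the stripped loop involves finitely many coefficients
of the loop, so linear relations valid for all longer finite products pass to the limit. `lead` and
`center` are obtained the same way. -/
lemma tri (h : IsRootFactorization₁ g s η) (hg : IsSmoothLoop g) (N : ℕ) :
    Tri (strip η g.mat N) N := by
  refine ⟨fun k hk => ?_, fun k hk => ?_, fun k hk => ?_, fun k hk => ?_⟩ <;>
    refine tendsto_nhds_unique (h.tendsto_strip hg N _ _ k)
      (tendsto_const_nhds.congr fun l => Eq.symm ?_)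
  · exact (band_strip_rootProd₁ h.1 N l).1.c00 k (by omega)
  · exact (band_strip_rootProd₁ h.1 N l).1.c01 k (by omega)
  · exact (band_strip_rootProd₁ h.1 N l).1.c10 k (by omega)
  · exact (band_strip_rootProd₁ h.1 N l).1.c11 k (by omega)

lemma lead (h : IsRootFactorization₁ g s η) (hg : IsSmoothLoop g) (N : ℕ) :
    Lead (strip η g.mat N) N (η N) := by
  refine ⟨?_, ?_⟩ <;> refine tendsto_nhds_unique (h.tendsto_strip hg N _ _ _)
      (Filter.Tendsto.congr (fun l => Eq.symm ?_)
        ((h.tendsto_strip hg N _ _ _).const_mul _))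
  · exact (band_strip_rootProd₁ h.1 N l).2.1.c01
  · exact (band_strip_rootProd₁ h.1 N l).2.1.c10

lemma center (h : IsRootFactorization₁ g s η) (hg : IsSmoothLoop g) (N : ℕ) :
    mcoef (strip η g.mat N) 1 1 0 = mcoef (strip η g.mat N) 0 0 0 :=
  tendsto_nhds_unique (h.tendsto_strip hg N _ _ _) (Filter.Tendsto.congr
    (fun l => ((band_strip_rootProd₁ h.1 N l).2.2.2).symm) (h.tendsto_strip hg N _ _ _))

lemma mcoef_succ (h : IsRootFactorization₁ g s η) (hg : IsSmoothLoop g) (N : ℕ) :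
    mcoef (strip η g.mat (N + 1)) 0 0 0 = mcoef (strip η g.mat N) 0 0 0 * ((s N)⁻¹ ^ 2) := by
  rw [mcoef_strip_zero hg.msm, zero_add, (h.lead hg N).c01, ← h.1.one_sub]
  ring

lemma mcoef_eq (h : IsRootFactorization₁ g s η) (hg : IsSmoothLoop g) (N : ℕ) :
    mcoef (strip η g.mat N) 0 0 0 =
      mcoef g.mat 0 0 0 * (∏ n ∈ Finset.range N, (s n)⁻¹) ^ 2 := by
  induction N with
  | zero => simp [strip]
  | succ N ih => rw [h.mcoef_succ hg, ih, Finset.prod_range_succ, mul_pow, mul_assoc]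

/-- The quotient of a root product by its partial products tends to `1`. -/
lemma eventually_quotient (h : IsRootFactorization₁ g s η) (hg : IsSmoothLoop g) {ε : ℝ}
    (hε : 0 < ε) : ∀ᶠ N in Filter.atTop, ∀ z : Circle,
      ‖(g z).1 0 0 * rootProd₁ s η N z 1 1 - (g z).1 0 1 * rootProd₁ s η N z 1 0 - 1‖ < ε ∧
      ‖(g z).1 1 1 * rootProd₁ s η N z 0 0 - (g z).1 1 0 * rootProd₁ s η N z 0 1 - 1‖ < ε := by
  choose K hK using fun i j : Fin 2 => (hg.msm i j).exists_bddDeriv 0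
  set C := 1 + ∑ i, ∑ j, K i j with hC
  have hKn : ∀ i j, 0 ≤ K i j := fun i j => (hK i j).nonneg
  have hCpos : 0 < C := add_pos_of_pos_of_nonneg one_pos
    (Finset.sum_nonneg fun i _ => Finset.sum_nonneg fun j _ => hKn i j)
  have hgC : ∀ i j z, ‖(g z).1 i j‖ ≤ C := by
    intro i j z
    obtain ⟨θ, rfl⟩ := exists_exp z
    have h1 := (hK i j).bound 0 le_rfl θ
    rw [iteratedDeriv_zero] at h1
    refine h1.trans ?_
    have h2 := (Finset.single_le_sum (f := fun j => K i j) (fun j _ => hKn i j)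
      (Finset.mem_univ j)).trans (Finset.single_le_sum (f := fun i => ∑ j, K i j)
      (fun i _ => Finset.sum_nonneg fun j _ => hKn i j) (Finset.mem_univ i))
    rw [hC]
    linarith
  have key : ∀ (x y p q p' q' : ℂ) (δ : ℝ), ‖x‖ ≤ C → ‖y‖ ≤ C → ‖p - p'‖ < δ → ‖q - q'‖ < δ →
      x * p' - y * q' = 1 → δ = ε / (2 * C) → ‖x * p - y * q - 1‖ < ε := by
    intro x y p q p' q' δ hx hy hp hq h1 hδ
    have : x * p - y * q - 1 = x * (p - p') - y * (q - q') := by rw [← h1]; ring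
    rw [this]
    have hpos : 0 < δ := by rw [hδ]; positivity
    calc _ ≤ ‖x‖ * ‖p - p'‖ + ‖y‖ * ‖q - q'‖ := by
          simpa only [norm_mul] using norm_sub_le (x * (p - p')) (y * (q - q'))
      _ ≤ C * ‖p - p'‖ + C * ‖q - q'‖ := by gcongr
      _ < C * δ + C * δ := by gcongr
      _ = ε := by rw [hδ]; field_simp; ring
  filter_upwards [h.2.eventually_dist_lt (show 0 < ε / (2 * C) by positivity)] with N hN z
  have hdet := loop_det g z
  exact ⟨key _ _ _ _ _ _ _ (hgC 0 0 z) (hgC 0 1 z) (hN z 1 1) (hN z 1 0) hdet rfl,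
    key _ _ _ _ _ _ _ (hgC 1 1 z) (hgC 1 0 z) (hN z 0 0) (hN z 0 1)
      (by linear_combination hdet) rfl⟩

lemma strip_eq (h : IsRootFactorization₁ g s η) (N : ℕ) (z : Circle) :
    strip η g.mat (N + 1) z = (∏ n ∈ Finset.range (N + 1), (s n)⁻¹) •
      ((g z).1 * (rootProd₁ s η N z).adjugate) := by
  have h1 := strip_mul_rootProd₁ (M := g.mat) h.1 N z
  have h2 := congrArg (· * (rootProd₁ s η N z).adjugate) h1
  simp only [Matrix.mul_assoc, Matrix.mul_adjugate, det_rootProd₁ h.1, one_smul, Matrix.mul_one,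
    Matrix.smul_mul] at h2
  exact h2

lemma strip_zero_zero (h : IsRootFactorization₁ g s η) (N : ℕ) (z : Circle) :
    strip η g.mat (N + 1) z 0 0 = (∏ n ∈ Finset.range (N + 1), (s n)⁻¹) *
      ((g z).1 0 0 * rootProd₁ s η N z 1 1 - (g z).1 0 1 * rootProd₁ s η N z 1 0) := by
  rw [h.strip_eq, Matrix.adjugate_fin_two, Matrix.smul_apply, smul_eq_mul]
  congr 1
  simp [Matrix.mul_apply, Fin.sum_univ_two]
  ring

lemma strip_one_one (h : IsRootFactorization₁ g s η) (N : ℕ) (z : Circle) :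
    strip η g.mat (N + 1) z 1 1 = (∏ n ∈ Finset.range (N + 1), (s n)⁻¹) *
      ((g z).1 1 1 * rootProd₁ s η N z 0 0 - (g z).1 1 0 * rootProd₁ s η N z 0 1) := by
  rw [h.strip_eq, Matrix.adjugate_fin_two, Matrix.smul_apply, smul_eq_mul]
  congr 1
  simp [Matrix.mul_apply, Fin.sum_univ_two]
  ring

/-- Each stripping multiplies the central coefficient by a nonzero number. If it vanished, the upper
left entry of the quotient by a partial product would have zero mean, although for a late one it is
uniformly close to `1`. -/
lemma center_ne_zero (h : IsRootFactorization₁ g s η) (hg : IsSmoothLoop g) :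
    mcoef g.mat 0 0 0 ≠ 0 := by
  intro h0
  obtain ⟨N, hN⟩ := (h.eventually_quotient hg (half_pos one_pos)).exists
  have h1 := h.mcoef_eq hg (N + 1)
  rw [h0, zero_mul, mcoef] at h1
  simp only [h.strip_zero_zero] at h1
  set c := ∏ n ∈ Finset.range (N + 1), (s n)⁻¹
  have hc : c ≠ 0 := Finset.prod_ne_zero_iff.2 fun n _ => inv_ne_zero (h.1.s_ne_zero n)
  set F : Circle → ℂ := fun z =>
    (g z).1 0 0 * rootProd₁ s η N z 1 1 - (g z).1 0 1 * rootProd₁ s η N z 1 0 with hF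
  have hFs : Sm F := ((hg.msm 0 0).mul (sm_rootProd₁ N 1 1)).sub
    ((hg.msm 0 1).mul (sm_rootProd₁ N 1 0))
  rw [coef_const_mul c F] at h1
  have h2 : coef F 0 = 0 := (mul_eq_zero.1 h1).resolve_left hc
  have h3 := coef_sub hFs (Sm.const 1) 0
  rw [h2, coef_const, if_pos rfl] at h3
  have h4 := norm_coef_le (fun z => (hN z).1.le) 0
  change ‖coef (fun z => F z - 1) 0‖ ≤ _ at h4
  rw [h3] at h4
  norm_num at h4

end IsRootFactorization₁

/-- A criterion for the absence of common zeros. -/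
lemma no_common_zero_of {a b r t A : ℂ → ℂ} {N : ℕ} (ha : HolSmooth a) (hb : HolSmooth b)
    (hr : HolSmooth r) (ht : HolSmooth t) (hA : HolSmooth A) (ha0 : a 0 ≠ 0)
    (h : ∀ z : Circle, (z : ℂ) ^ N * A z = a z * r z - b z * t z)
    (hA1 : ∀ z : Circle, ‖A z - 1‖ ≤ 1 / 2) :
    ∀ z ∈ Metric.ball (0 : ℂ) 1, ¬ (a z = 0 ∧ b z = 0) := by
  rintro z hz ⟨h1, h2⟩
  have hz' := Metric.ball_subset_closedBall hz
  -- By the maximum principle the identity and the bound extend to the disk. At a common zero either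
  -- `z = 0`, excluded by `a 0 ≠ 0`, or `A z = 0`, excluded by the bound.
  have h3 := ((HolSmooth.pow N).mul hA).eqOn ((ha.mul hr).sub (hb.mul ht)) h hz'
  have h4 := (hA.sub (.const 1)).norm_le hA1 hz'
  simp only [h1, h2, zero_mul, sub_self, mul_eq_zero] at h3
  rcases h3 with h3 | h3
  · rw [eq_zero_of_pow_eq_zero h3] at h1
    exact ha0 h1
  · rw [h3] at h4
    norm_num at h4

/-- The supports at `N = 0` give the four functions. The entries of a partial product are Laurent
polynomials of degree at most `N`; `z ^ N` clears their poles (after conjugation for the second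
row), and the diagonal entries of the quotient are holomorphic or antiholomorphic by `Tri` at `N +
1`. -/
theorem IsRootFactorization₁.exists_form {g : Loop} {s : ℕ → ℂ} {η : ℕ → ℂ × ℂ}
    (h : IsRootFactorization₁ g s η) (hg : IsSmoothLoop g) : CondI1 g := by
  have ht := h.tri hg 0
  obtain ⟨a, ha, hga⟩ := (hg.msm 0 0).exists_holSmooth ht.c00
  obtain ⟨b, hb, hgb⟩ := (hg.msm 0 1).exists_holSmooth ht.c01
  obtain ⟨c, hc, hgc⟩ := (hg.msm 1 0).exists_holSmooth_conj (fun k hk => ht.c10 k (by simpa using hk))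
  obtain ⟨d, hd, hgd⟩ := (hg.msm 1 1).exists_holSmooth_conj ht.c11
  have hκ := h.center_ne_zero hg
  have ha0 : mcoef g.mat 0 0 0 = a 0 := by
    rw [← ha.coef_zero, mcoef]
    simp only [hga]
  have hd0 : mcoef g.mat 0 0 0 = conj (d 0) := by
    have h1 : mcoef g.mat 1 1 0 = mcoef g.mat 0 0 0 := h.center hg 0
    rw [← hd.coef_conj_zero, ← h1, mcoef]
    simp only [hgd]
  rw [ha0] at hκ
  obtain ⟨N, hN⟩ := (h.eventually_quotient hg (half_pos one_pos)).exists
  have hp := (band_strip_rootProd₁ h.1 0 N).1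
  rw [zero_add] at hp
  have hps := fun i j => sm_rootProd₁ (s := s) (η := η) N i j
  have htN := h.tri hg (N + 1)
  set k := ∏ n ∈ Finset.range (N + 1), (s n)⁻¹ with hk
  have hk0 : k ≠ 0 := Finset.prod_ne_zero_iff.2 fun n _ => inv_ne_zero (h.1.s_ne_zero n)
  refine ⟨a, b, c, d, ha, hb, hc, hd, fun z => ?_, ha0.symm.trans hd0, hκ, ?_, ?_⟩
  · rw [← hga, ← hgb, ← hgc, ← hgd]
    exact Matrix.eta_fin_two _
  · set F : Circle → ℂ := fun z =>
      (g z).1 0 0 * rootProd₁ s η N z 1 1 - (g z).1 0 1 * rootProd₁ s η N z 1 0 with hF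
    have hFs : Sm F := ((hg.msm 0 0).mul (hps 1 1)).sub ((hg.msm 0 1).mul (hps 1 0))
    obtain ⟨A, hA, hFA⟩ := hFs.exists_holSmooth fun n hn => by
      have h1 := htN.c00 n hn
      rw [mcoef] at h1
      simp only [h.strip_zero_zero] at h1
      rw [coef_const_mul k F] at h1
      exact (mul_eq_zero.1 h1).resolve_left hk0
    obtain ⟨r, hr, hr2⟩ := ((Sm.zpow N).mul (hps 1 1)).exists_holSmooth fun n hn => by
      rw [coef_zpow_mul]
      exact hp.c11 _ (by omega)
    obtain ⟨t, ht, ht2⟩ := ((Sm.zpow N).mul (hps 1 0)).exists_holSmooth fun n hn => by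
      rw [coef_zpow_mul]
      exact hp.c10 _ (by omega)
    refine no_common_zero_of (N := N) ha hb hr ht hA hκ (fun z => ?_) fun z => ?_
    · rw [← hFA, ← hr2, ← ht2, hF, ← hga, ← hgb, zpow_natCast]
      ring
    · rw [← hFA]
      exact (hN z).1.le
  · set F : Circle → ℂ := fun z =>
      (g z).1 1 1 * rootProd₁ s η N z 0 0 - (g z).1 1 0 * rootProd₁ s η N z 0 1 with hF
    have hFs : Sm F := ((hg.msm 1 1).mul (hps 0 0)).sub ((hg.msm 1 0).mul (hps 0 1))
    obtain ⟨A, hA, hFA⟩ := hFs.exists_holSmooth_conj fun n hn => by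
      have h1 := htN.c11 n hn
      rw [mcoef] at h1
      simp only [h.strip_one_one] at h1
      rw [coef_const_mul k F] at h1
      exact (mul_eq_zero.1 h1).resolve_left hk0
    obtain ⟨r, hr, hr2⟩ := ((Sm.zpow N).mul (hps 0 0).star).exists_holSmooth fun n hn => by
      rw [coef_zpow_mul, coef_conj]
      exact (map_eq_zero _).2 (hp.c00 _ (by omega))
    obtain ⟨t, ht, ht2⟩ := ((Sm.zpow N).mul (hps 0 1).star).exists_holSmooth fun n hn => by
      rw [coef_zpow_mul, coef_conj]
      exact (map_eq_zero _).2 (hp.c01 _ (by omega))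
    have hd1 : d 0 ≠ 0 := fun h0 => hκ (by rw [← ha0, hd0, h0, map_zero])
    have hA2 : ∀ z : Circle, A z = conj (F z) := fun z => by rw [hFA, Complex.conj_conj]
    have hc2 : ∀ z : Circle, c z = conj ((g z).1 1 0) := fun z => by
      rw [← Complex.conj_conj (c z), ← hgc]
    have hd2 : ∀ z : Circle, d z = conj ((g z).1 1 1) := fun z => by
      rw [← Complex.conj_conj (d z), ← hgd]
    have := no_common_zero_of (N := N) hd hc hr ht hA hd1 (fun z => ?_) fun z => ?_
    · exact fun z hz h0 => this z hz h0.symm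
    · rw [hA2, ← hr2, ← ht2, hF, hc2, hd2, zpow_natCast]
      simp only [map_sub, map_mul]
      ring
    · have h1 := (hN z).2.le
      rw [← Complex.norm_conj, map_sub, map_one] at h1
      rw [hA2]
      exact h1

end

section

/-! ### The formal recursion for the parameters -/

/-- Division of a power series by the variable, discarding the constant term. -/
def shift {R : Type*} [CommRing R] (f : PowerSeries R) : PowerSeries R :=
  PowerSeries.mk fun k => PowerSeries.coeff (k + 1) f

/-- The power series, up to a common factor, of the entries of a stripped loop. -/
structure Rows (R : Type*) [CommRing R] where
  /-- the upper left entry -/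
  α : PowerSeries R
  /-- the upper right entry, divided by the leading power -/
  β : PowerSeries R
  /-- the lower left entry, divided by the leading power -/
  γ : PowerSeries R
  /-- the lower right entry -/
  δ : PowerSeries R

namespace Rows

variable {R S : Type*} [CommRing R] [CommRing S]

/-- The common denominator of the next parameters. -/
def q (x : Rows R) : R := PowerSeries.coeff 0 x.α

/-- The numerator of `η⁺`. -/
def p (x : Rows R) : R := PowerSeries.coeff 0 x.β

/-- The numerator of `η⁻`. -/
def m (x : Rows R) : R := PowerSeries.coeff 0 x.γ

/-- One step of the recursion. -/
def next (x : Rows R) : Rows R where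
  α := .C x.q * x.α - .C x.m * x.β
  β := shift (.C x.q * x.β - .C x.p * x.α)
  γ := shift (.C x.q * x.γ - .C x.m * x.δ)
  δ := .C x.q * x.δ - .C x.p * x.γ

/-- The recursion, with initial values given by the expansions of `b/a` and `c^*/d^*`. -/
def iter (v : ℕ ⊕ ℕ → R) : ℕ → Rows R
  | 0 => ⟨1, .mk fun k => v (Sum.inl k), .mk fun k => v (Sum.inr k), 1⟩
  | N + 1 => (iter v N).next

/-- Because `α` and `δ` keep a common constant term, the single denominator `q` serves for both `η⁺`
and `η⁻`. -/
lemma coeff_zero_δ (v : ℕ ⊕ ℕ → R) (N : ℕ) :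
    PowerSeries.coeff 0 (iter v N).δ = (iter v N).q := by
  induction N with
  | zero => rfl
  | succ N ih =>
    have h1 : PowerSeries.coeff 0 (iter v (N + 1)).δ =
      (iter v N).q * PowerSeries.coeff 0 (iter v N).δ - (iter v N).p * (iter v N).m := by
      simp [iter, next, m]
    have h2 : (iter v (N + 1)).q =
      (iter v N).q * (iter v N).q - (iter v N).m * (iter v N).p := by
      simp [iter, next, m, p, q]
    rw [h1, h2, ih]
    ring

/-- With `η^± = p / q, m / q` the right-hand side is `q ^ 2 * (1 - η⁻η⁺)`: nonvanishing of the next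
denominator is nondegeneracy of the present parameter. -/
lemma q_succ (v : ℕ ⊕ ℕ → R) (N : ℕ) :
    (iter v (N + 1)).q = (iter v N).q ^ 2 - (iter v N).m * (iter v N).p := by
  simp [iter, next, m, p, q, sq]

/-- Functoriality in the coefficient ring. -/
def map (φ : R →+* S) (x : Rows R) : Rows S :=
  ⟨PowerSeries.map φ x.α, PowerSeries.map φ x.β, PowerSeries.map φ x.γ, PowerSeries.map φ x.δ⟩

lemma map_shift (φ : R →+* S) (f : PowerSeries R) :
    PowerSeries.map φ (shift f) = shift (PowerSeries.map φ f) := by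
  ext k
  simp [shift]

lemma map_next (φ : R →+* S) (x : Rows R) : (x.map φ).next = x.next.map φ := by
  have hq : (x.map φ).q = φ x.q := by simp [q, map]
  have hp : (x.map φ).p = φ x.p := by simp [p, map]
  have hm : (x.map φ).m = φ x.m := by simp [m, map]
  simp only [next, hq, hp, hm]
  simp only [map, map_shift, map_sub, map_mul, PowerSeries.map_C]

lemma map_iter (φ : R →+* S) (v : ℕ ⊕ ℕ → R) (N : ℕ) :
    (iter v N).map φ = iter (fun i => φ (v i)) N := by
  induction N with
  | zero =>
    simp only [iter, map, map_one, mk.injEq, true_and, and_true]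
    constructor <;> ext <;> simp
  | succ N ih => rw [iter, iter, ← map_next, ih]

lemma iter_zero (N : ℕ) : iter (fun _ => (0 : R)) N = ⟨1, 0, 0, 1⟩ := by
  induction N with
  | zero =>
    simp only [iter, mk.injEq, true_and, and_true]
    constructor <;> ext <;> simp
  | succ N ih =>
    rw [iter, ih]
    simp only [next, q, p, m, mk.injEq]
    refine ⟨by simp, ?_, ?_, by simp⟩ <;> ext <;> simp [shift, PowerSeries.coeff_one]

/-- The universal rows, with coefficients in a polynomial ring. -/
abbrev univ (N : ℕ) : Rows (MvPolynomial (ℕ ⊕ ℕ) ℂ) := iter MvPolynomial.X N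

lemma univ_map (v : ℕ ⊕ ℕ → ℂ) (N : ℕ) : (univ N).map (MvPolynomial.eval v) = iter v N := by
  rw [map_iter]
  simp

lemma eval_q (v : ℕ ⊕ ℕ → ℂ) (N : ℕ) : MvPolynomial.eval v (univ N).q = (iter v N).q := by
  rw [← univ_map]
  simp [q, map]

lemma eval_p (v : ℕ ⊕ ℕ → ℂ) (N : ℕ) : MvPolynomial.eval v (univ N).p = (iter v N).p := by
  rw [← univ_map]
  simp [p, map]

lemma eval_m (v : ℕ ⊕ ℕ → ℂ) (N : ℕ) : MvPolynomial.eval v (univ N).m = (iter v N).m := by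
  rw [← univ_map]
  simp [m, map]

/-- At zero data the recursion is stationary with `q = 1`. -/
lemma univ_q_ne_zero (N : ℕ) : (univ N).q ≠ 0 := by
  intro h
  have h1 := eval_q (fun _ => 0) N
  rw [h, iter_zero, map_zero] at h1
  simp [q] at h1

lemma X_mul_shift {f : PowerSeries R} (h : PowerSeries.coeff 0 f = 0) :
    PowerSeries.X * shift f = f := by
  ext k
  cases k with
  | zero => rw [h]; simp
  | succ k => rw [PowerSeries.coeff_succ_X_mul, shift, PowerSeries.coeff_mk]

end Rows

/-! ### Power series of the entries of a stripped loop -/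

/-- The rows of Fourier coefficients of `M`, whose off-diagonal entries start at `±N`. -/
def fourierRows (M : Circle → Matrix (Fin 2) (Fin 2) ℂ) (N : ℕ) : Rows ℂ where
  α := .mk fun k => mcoef M 0 0 k
  β := .mk fun k => mcoef M 0 1 (N + k)
  γ := .mk fun k => mcoef M 1 0 (-N - k)
  δ := .mk fun k => mcoef M 1 1 (-k)

/-- The formal rows are proportional to the rows of a stripped loop, up to fixed factors. -/
structure Matches (A D : PowerSeries ℂ) (x y : Rows ℂ) (l : ℂ) : Prop where
  α : x.α * A = .C l * y.α
  β : x.β * A = .C l * y.β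
  γ : x.γ * D = .C l * y.γ
  δ : x.δ * D = .C l * y.δ

variable {η : ℕ → ℂ × ℂ} {M : Circle → Matrix (Fin 2) (Fin 2) ℂ}

lemma fourierRows_succ_α (h : MSm M) (N : ℕ) : (fourierRows (strip η M (N + 1)) (N + 1)).α =
    (fourierRows (strip η M N) N).α - .C (η N).1 * (fourierRows (strip η M N) N).β := by
  ext k
  simp [fourierRows, mcoef_strip_zero h, add_comm]

lemma fourierRows_succ_δ (h : MSm M) (N : ℕ) : (fourierRows (strip η M (N + 1)) (N + 1)).δ =
    (fourierRows (strip η M N) N).δ - .C (η N).2 * (fourierRows (strip η M N) N).γ := by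
  ext k
  simp [fourierRows, mcoef_strip_one h, sub_eq_add_neg, add_comm]

/-- The reference position moves from `N` to `N + 1`, which appears as division by `X`; it is exact
because `Lead` kills the constant term. -/
lemma fourierRows_succ_β (h : MSm M) {N : ℕ} (hl : Lead (strip η M N) N (η N)) :
    .X * (fourierRows (strip η M (N + 1)) (N + 1)).β =
    (fourierRows (strip η M N) N).β - .C (η N).2 * (fourierRows (strip η M N) N).α := by
  ext k
  cases k with
  | zero => simp [fourierRows, hl.c01]
  | succ k =>
    rw [PowerSeries.coeff_succ_X_mul]
    simp only [fourierRows, mcoef_strip_one h, PowerSeries.coeff_mk, map_sub, PowerSeries.coeff_C_mul]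
    push_cast
    congr 2 <;> ring_nf

lemma fourierRows_succ_γ (h : MSm M) {N : ℕ} (hl : Lead (strip η M N) N (η N)) :
    .X * (fourierRows (strip η M (N + 1)) (N + 1)).γ =
    (fourierRows (strip η M N) N).γ - .C (η N).1 * (fourierRows (strip η M N) N).δ := by
  ext k
  cases k with
  | zero => simp [fourierRows, hl.c10]
  | succ k =>
    rw [PowerSeries.coeff_succ_X_mul]
    simp only [fourierRows, mcoef_strip_zero h, PowerSeries.coeff_mk, map_sub, PowerSeries.coeff_C_mul]
    push_cast
    congr 2 <;> ring_nf

/-- A formal step is a stripping step multiplied by `q`. It is linear in each row, so the common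
factors `A` and `D` persist and only the scalar changes, by `q`. -/
lemma Matches.succ (h : MSm M) {N : ℕ} (hl : Lead (strip η M N) N (η N)) {A D : PowerSeries ℂ}
    {x : Rows ℂ} {l : ℂ} (hx : Matches A D x (fourierRows (strip η M N) N) l)
    (hδ : PowerSeries.coeff 0 x.δ = x.q)
    (hp : x.p = (η N).2 * x.q) (hm : x.m = (η N).1 * x.q) :
    Matches A D x.next (fourierRows (strip η M (N + 1)) (N + 1)) (x.q * l) := by
  refine ⟨?_, ?_, ?_, ?_⟩
  · rw [fourierRows_succ_α h, Rows.next, hm, map_mul, map_mul]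
    linear_combination .C x.q * hx.α - .C (η N).1 * .C x.q * hx.β
  · refine PowerSeries.X_mul_cancel ?_
    rw [mul_left_comm _ (PowerSeries.C _), fourierRows_succ_β h hl, ← mul_assoc PowerSeries.X, Rows.next, Rows.X_mul_shift,
      hp, map_mul, map_mul]
    · linear_combination .C x.q * hx.β - .C (η N).2 * .C x.q * hx.α
    · simp [Rows.p, Rows.q]; ring
  · refine PowerSeries.X_mul_cancel ?_
    rw [mul_left_comm _ (PowerSeries.C _), fourierRows_succ_γ h hl, ← mul_assoc PowerSeries.X, Rows.next, Rows.X_mul_shift,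
      hm, map_mul, map_mul]
    · linear_combination .C x.q * hx.γ - .C (η N).1 * .C x.q * hx.δ
    · rw [map_sub, PowerSeries.coeff_C_mul, PowerSeries.coeff_C_mul, hδ, Rows.m]; ring
  · rw [fourierRows_succ_δ h, Rows.next, hp, map_mul, map_mul]
    linear_combination .C x.q * hx.δ - .C (η N).2 * .C x.q * hx.γ

lemma Matches.coeff_zero {N : ℕ} {A D : PowerSeries ℂ} {x : Rows ℂ} {l : ℂ}
    (hx : Matches A D x (fourierRows M N) l) (hδ : PowerSeries.coeff 0 x.δ = x.q) :
    x.q * PowerSeries.coeff 0 A = l * mcoef M 0 0 0 ∧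
    x.p * PowerSeries.coeff 0 A = l * mcoef M 0 1 N ∧
    x.m * PowerSeries.coeff 0 D = l * mcoef M 1 0 (-(N : ℤ)) ∧
    x.q * PowerSeries.coeff 0 D = l * mcoef M 1 1 0 := by
  have hmul : ∀ f g : PowerSeries ℂ, PowerSeries.coeff 0 (f * g) =
      PowerSeries.coeff 0 f * PowerSeries.coeff 0 g := by
    intro f g
    simp
  have e1 := congrArg (PowerSeries.coeff 0) hx.α
  have e2 := congrArg (PowerSeries.coeff 0) hx.β
  have e3 := congrArg (PowerSeries.coeff 0) hx.γ
  have e4 := congrArg (PowerSeries.coeff 0) hx.δ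
  rw [hmul, PowerSeries.coeff_C_mul] at e1 e2 e3 e4
  rw [hδ] at e4
  simp only [PowerSeries.coeff_mk, fourierRows, Nat.cast_zero, add_zero, sub_zero,
    neg_zero] at e1 e2 e3 e4
  exact ⟨e1, e2, e3, e4⟩

/-- The power series expansion of a quotient. -/
lemma taylor_div_mul {a b : ℂ → ℂ} (ha : HolSmooth a) (hb : HolSmooth b) (ha0 : a 0 ≠ 0) :
    (PowerSeries.mk fun k => taylorCoeff (fun z => b z / a z) k) *
      (PowerSeries.mk fun k => taylorCoeff a k) = PowerSeries.mk fun k => taylorCoeff b k := by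
  have hball : Metric.ball (0 : ℂ) 1 ∈ 𝓝 (0 : ℂ) := Metric.ball_mem_nhds 0 one_pos
  have haA : AnalyticAt ℂ a 0 := ha.holomorphic.analyticAt hball
  have hbA : AnalyticAt ℂ b 0 := hb.holomorphic.analyticAt hball
  have hdA : AnalyticAt ℂ (fun z => b z / a z) 0 := hbA.div haA ha0
  ext n
  rw [PowerSeries.coeff_mul, PowerSeries.coeff_mk, Finset.Nat.sum_antidiagonal_eq_sum_range_succ_mk]
  -- Only a neighbourhood of `0` matters; `a` may vanish elsewhere in the disk.
  have hev : b =ᶠ[𝓝 0] (fun z => b z / a z) * a := by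
    filter_upwards [haA.continuousAt.eventually_ne ha0] with z hz
    simp [hz]
  rw [taylorCoeff, Filter.EventuallyEq.iteratedDeriv_eq n hev,
    iteratedDeriv_mul hdA.contDiffAt haA.contDiffAt, Finset.sum_div]
  refine Finset.sum_congr rfl fun i hi => ?_
  have hi' : i ≤ n := by simpa [Nat.lt_succ_iff] using hi
  rw [PowerSeries.coeff_mk, PowerSeries.coeff_mk, taylorCoeff, taylorCoeff]
  have h1 : (n.choose i : ℂ) * (i.factorial * (n - i).factorial) = n.factorial := by
    rw [← mul_assoc]
    exact_mod_cast Nat.choose_mul_factorial_mul_factorial hi'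
  have h2 : (n.factorial : ℂ) ≠ 0 := by exact_mod_cast n.factorial_ne_zero
  have h3 : (i.factorial : ℂ) ≠ 0 := by exact_mod_cast i.factorial_ne_zero
  have h4 : ((n - i).factorial : ℂ) ≠ 0 := by exact_mod_cast (n - i).factorial_ne_zero
  simp only
  rw [div_mul_div_comm, div_eq_div_iff (mul_ne_zero h3 h4) h2, ← h1]
  ring

/-! ### Comparison of the formal recursion with stripping -/

namespace IsForm₁

variable {g : Loop} {a b c d : ℂ → ℂ}

lemma d_zero_ne (h : IsForm₁ g a b c d) : d 0 ≠ 0 := fun h0 =>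
  h.center_ne (by rw [h.center, h0, map_zero])

lemma apply00 (h : IsForm₁ g a b c d) (z : Circle) : g.mat z 0 0 = a z := by
  simp [Loop.mat, h.eq_on_circle]

lemma apply01 (h : IsForm₁ g a b c d) (z : Circle) : g.mat z 0 1 = b z := by
  simp [Loop.mat, h.eq_on_circle]

lemma apply10 (h : IsForm₁ g a b c d) (z : Circle) : g.mat z 1 0 = conj (c z) := by
  simp [Loop.mat, h.eq_on_circle]

lemma apply11 (h : IsForm₁ g a b c d) (z : Circle) : g.mat z 1 1 = conj (d z) := by
  simp [Loop.mat, h.eq_on_circle]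

lemma tri (h : IsForm₁ g a b c d) : Tri g.mat 0 := by
  refine ⟨fun k hk => ?_, fun k hk => ?_, fun k hk => ?_, fun k hk => ?_⟩ <;> unfold mcoef
  · simp only [h.apply00]; exact h.hol_a.coef_of_neg hk
  · simp only [h.apply01]; exact h.hol_b.coef_of_neg (by simpa using hk)
  · simp only [h.apply10]; exact h.hol_c.coef_conj_of_pos (by simpa using hk)
  · simp only [h.apply11]; exact h.hol_d.coef_conj_of_pos hk

/-- The initial condition of the recursion. -/
lemma matches_zero (h : IsForm₁ g a b c d) :
    Matches (.mk fun k => taylorCoeff a k) (.mk fun k => conj (taylorCoeff d k))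
      (Rows.iter (laurentData (fun z => b z / a z) (fun z => c z / d z)) 0)
      (fourierRows g.mat 0) 1 := by
  have h1 := taylor_div_mul h.hol_a h.hol_b h.center_ne
  have h2 := congrArg (PowerSeries.map (starRingEnd ℂ))
    (taylor_div_mul h.hol_d h.hol_c h.d_zero_ne)
  have hmap : ∀ u : ℕ → ℂ, PowerSeries.map (starRingEnd ℂ) (.mk u) = .mk fun k => conj (u k) := by
    intro u; ext; simp
  rw [map_mul, hmap, hmap, hmap] at h2
  have hC : (PowerSeries.C (1 : ℂ)) = 1 := map_one _
  simp only [Rows.iter, fourierRows, laurentData, Sum.elim_inl, Sum.elim_inr]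
  refine ⟨?_, ?_, ?_, ?_⟩
  · rw [one_mul, hC, one_mul]
    ext k
    simp only [PowerSeries.coeff_mk, mcoef, h.apply00, h.hol_a.coef_natCast]
  · rw [h1, hC, one_mul]
    ext k
    simp only [PowerSeries.coeff_mk, mcoef, h.apply01, Nat.cast_zero, zero_add,
      h.hol_b.coef_natCast]
  · rw [h2, hC, one_mul]
    ext k
    simp only [PowerSeries.coeff_mk, mcoef, h.apply10, Nat.cast_zero, neg_zero, zero_sub,
      h.hol_c.coef_conj_neg]
  · rw [one_mul, hC, one_mul]
    ext k
    simp only [PowerSeries.coeff_mk, mcoef, h.apply11, h.hol_d.coef_conj_neg]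

/-- The parameters of a root factorization are rational functions of the coefficients. -/
theorem rational (h : IsForm₁ g a b c d) (hg : IsSmoothLoop g) {s : ℕ → ℂ} {η : ℕ → ℂ × ℂ}
    (hf : IsRootFactorization₁ g s η) (N : ℕ) :
    (Rows.iter (laurentData (fun z => b z / a z) (fun z => c z / d z)) N).q ≠ 0 ∧
    (Rows.iter (laurentData (fun z => b z / a z) (fun z => c z / d z)) N).m =
      (η N).1 * (Rows.iter (laurentData (fun z => b z / a z) (fun z => c z / d z)) N).q ∧
    (Rows.iter (laurentData (fun z => b z / a z) (fun z => c z / d z)) N).p =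
      (η N).2 * (Rows.iter (laurentData (fun z => b z / a z) (fun z => c z / d z)) N).q := by
  set v := laurentData (fun z => b z / a z) (fun z => c z / d z) with hv
  have ha0 : taylorCoeff a 0 = a 0 := by simp [taylorCoeff]
  have hd0 : conj (taylorCoeff d 0) = conj (d 0) := by simp [taylorCoeff]
  have hd1 : conj (d 0) ≠ 0 := (map_ne_zero _).2 h.d_zero_ne
  have key : ∀ {N : ℕ} {l : ℂ}, l ≠ 0 →
      Matches (.mk fun k => taylorCoeff a k) (.mk fun k => conj (taylorCoeff d k))
        (Rows.iter v N) (fourierRows (strip η g.mat N) N) l →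
      (Rows.iter v N).q ≠ 0 ∧ (Rows.iter v N).m = (η N).1 * (Rows.iter v N).q ∧
        (Rows.iter v N).p = (η N).2 * (Rows.iter v N).q := by
    intro N l hl hM
    obtain ⟨e1, e2, e3, e4⟩ := hM.coeff_zero (Rows.coeff_zero_δ v N)
    simp only [PowerSeries.coeff_mk, ha0, hd0] at e1 e2 e3 e4
    have hlead := hf.lead hg N
    rw [hlead.c01] at e2
    rw [hlead.c10] at e3
    have hκ : mcoef (strip η g.mat N) 0 0 0 ≠ 0 := by
      rw [hf.mcoef_eq hg]
      exact mul_ne_zero (hf.center_ne_zero hg) (pow_ne_zero _ (Finset.prod_ne_zero_iff.2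
        fun n _ => inv_ne_zero (hf.1.s_ne_zero n)))
    refine ⟨fun h0 => ?_, ?_, ?_⟩
    · rw [h0, zero_mul] at e1
      exact mul_ne_zero hl hκ e1.symm
    · refine mul_right_cancel₀ hd1 ?_
      linear_combination e3 - (η N).1 * e4
    · refine mul_right_cancel₀ h.center_ne ?_
      linear_combination e2 - (η N).2 * e1
  -- The induction needs `key` at every stage: nonvanishing of `q` there keeps the scalar `l`
  -- nonzero for the next one.
  have hind : ∀ N : ℕ, ∃ l : ℂ, l ≠ 0 ∧
      Matches (.mk fun k => taylorCoeff a k) (.mk fun k => conj (taylorCoeff d k))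
        (Rows.iter v N) (fourierRows (strip η g.mat N) N) l := by
    intro N
    induction N with
    | zero => exact ⟨1, one_ne_zero, h.matches_zero⟩
    | succ N ih =>
      obtain ⟨l, hl, hM⟩ := ih
      obtain ⟨h1, h2, h3⟩ := key hl hM
      exact ⟨_, mul_ne_zero h1 hl, hM.succ hg.msm (hf.lead hg N) (Rows.coeff_zero_δ v N) h3 h2⟩
  obtain ⟨l, hl, hM⟩ := hind N
  exact key hl hM

/-- If the denominators do not vanish, the stripped loops have the supports of tails of root
products. -/
theorem strip_of_q_ne_zero (h : IsForm₁ g a b c d) (hg : IsSmoothLoop g) {η : ℕ → ℂ × ℂ}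
    {v : ℕ ⊕ ℕ → ℂ} (hv : v = laurentData (fun z => b z / a z) (fun z => c z / d z))
    (hq : ∀ N, (Rows.iter v N).q ≠ 0)
    (hη : ∀ N, η N = ((Rows.iter v N).m / (Rows.iter v N).q, (Rows.iter v N).p / (Rows.iter v N).q))
    (N : ℕ) : Tri (strip η g.mat N) N ∧ Lead (strip η g.mat N) N (η N) ∧
      mcoef (strip η g.mat N) 0 0 0 ≠ 0 ∧ mcoef (strip η g.mat N) 1 1 0 ≠ 0 := by
  have ha0 : taylorCoeff a 0 = a 0 := by simp [taylorCoeff]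
  have hd0 : conj (taylorCoeff d 0) = conj (d 0) := by simp [taylorCoeff]
  have hd1 : conj (d 0) ≠ 0 := (map_ne_zero _).2 h.d_zero_ne
  have hp : ∀ N, (Rows.iter v N).p = (η N).2 * (Rows.iter v N).q := fun N => by
    rw [hη, div_mul_cancel₀ _ (hq N)]
  have hm : ∀ N, (Rows.iter v N).m = (η N).1 * (Rows.iter v N).q := fun N => by
    rw [hη, div_mul_cancel₀ _ (hq N)]
  have key : ∀ {N : ℕ} {l : ℂ}, l ≠ 0 →
      Matches (.mk fun k => taylorCoeff a k) (.mk fun k => conj (taylorCoeff d k))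
        (Rows.iter v N) (fourierRows (strip η g.mat N) N) l →
      Lead (strip η g.mat N) N (η N) ∧ mcoef (strip η g.mat N) 0 0 0 ≠ 0 ∧
        mcoef (strip η g.mat N) 1 1 0 ≠ 0 := by
    intro N l hl hM
    obtain ⟨e1, e2, e3, e4⟩ := hM.coeff_zero (Rows.coeff_zero_δ v N)
    simp only [PowerSeries.coeff_mk, ha0, hd0] at e1 e2 e3 e4
    rw [hp] at e2
    rw [hm] at e3
    refine ⟨⟨?_, ?_⟩, fun h0 => ?_, fun h0 => ?_⟩
    · refine mul_left_cancel₀ hl ?_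
      linear_combination (η N).2 * e1 - e2
    · refine mul_left_cancel₀ hl ?_
      linear_combination (η N).1 * e4 - e3
    · rw [h0, mul_zero] at e1
      exact mul_ne_zero (hq N) h.center_ne e1
    · rw [h0, mul_zero] at e4
      exact mul_ne_zero (hq N) hd1 e4
  have hind : ∀ N : ℕ, Tri (strip η g.mat N) N ∧ ∃ l : ℂ, l ≠ 0 ∧
      Matches (.mk fun k => taylorCoeff a k) (.mk fun k => conj (taylorCoeff d k))
        (Rows.iter v N) (fourierRows (strip η g.mat N) N) l := by
    intro N
    induction N with
    | zero => exact ⟨h.tri, 1, one_ne_zero, hv ▸ h.matches_zero⟩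
    | succ N ih =>
      obtain ⟨ht, l, hl, hM⟩ := ih
      have h1 := (key hl hM).1
      exact ⟨ht.strip_succ hg.msm h1, _, mul_ne_zero (hq N) hl,
        hM.succ hg.msm h1 (Rows.coeff_zero_δ v N) (hp N) (hm N)⟩
  obtain ⟨ht, l, hl, hM⟩ := hind N
  exact ⟨ht, key hl hM⟩

end IsForm₁

end

section

/-! ### Decay of the parameters -/

/-- The absolute value of the `l`-th Fourier coefficient, cut off to `|l| ≥ N`. -/
def tail (f : Circle → ℂ) (N : ℕ) (l : ℤ) : ℝ := if (N : ℤ) ≤ |l| then ‖coef f l‖ else 0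

/-- The sum of the absolute values of the Fourier coefficients with `|l| ≥ N`. -/
def tailSum (f : Circle → ℂ) (N : ℕ) : ℝ := ∑' l, tail f N l

variable {f w A B : Circle → ℂ}

lemma tail_nonneg (f : Circle → ℂ) (N : ℕ) (l : ℤ) : 0 ≤ tail f N l := by
  unfold tail; split_ifs <;> simp

lemma tail_le (f : Circle → ℂ) (N : ℕ) (l : ℤ) : tail f N l ≤ ‖coef f l‖ := by
  unfold tail; split_ifs <;> simp

lemma summable_tail (hf : Sm f) (N : ℕ) : Summable (tail f N) :=
  Summable.of_nonneg_of_le (tail_nonneg f N) (tail_le f N) hf.summable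

lemma tailSum_nonneg (f : Circle → ℂ) (N : ℕ) : 0 ≤ tailSum f N := tsum_nonneg (tail_nonneg f N)

lemma exists_tailSum_le (hf : Sm f) (k : ℕ) : ∃ C : ℝ, ∀ N : ℕ, (N : ℝ) ^ k * tailSum f N ≤ C := by
  refine ⟨∑' l : ℤ, |(l : ℝ)| ^ k * ‖coef f l‖, fun N => ?_⟩
  rw [tailSum, ← tsum_mul_left]
  refine Summable.tsum_le_tsum (fun l => ?_) ((summable_tail hf N).mul_left _) (hf.summable_pow k)
  unfold tail
  split_ifs with h
  · have : (N : ℝ) ≤ |(l : ℝ)| := by exact_mod_cast h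
    gcongr
  · rw [mul_zero]; positivity

lemma tendsto_tailSum (hf : Sm f) : Filter.Tendsto (tailSum f) Filter.atTop (𝓝 0) := by
  obtain ⟨C, hC⟩ := exists_tailSum_le hf 1
  refine squeeze_zero' (Filter.Eventually.of_forall (tailSum_nonneg f)) ?_
    (tendsto_const_div_atTop_nhds_zero_nat C)
  filter_upwards [Filter.eventually_gt_atTop 0] with N hN
  rw [le_div_iff₀ (by exact_mod_cast hN), mul_comm]
  simpa using hC N

/-- The convolution bounding the coefficients of a product. -/
def conv (A f : Circle → ℂ) (N : ℕ) (k : ℤ) : ℝ := ∑' j, ‖coef A j‖ * tail f N (k - j)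

lemma summable_conv_aux (hA : Sm A) (hf : Sm f) (N : ℕ) :
    Summable (fun x : ℤ × ℤ => ‖coef A x.1‖ * tail f N (x.2 - x.1)) := by
  have h := hA.summable.mul_of_nonneg (summable_tail hf N) (fun _ => norm_nonneg _)
    (tail_nonneg f N)
  let e : ℤ × ℤ ≃ ℤ × ℤ := Equiv.prodShear (Equiv.refl ℤ) (fun j => Equiv.subRight j)
  exact (e.summable_iff (f := fun x : ℤ × ℤ => ‖coef A x.1‖ * tail f N x.2)).2 h

lemma conv_sum (hA : Sm A) (hf : Sm f) (N : ℕ) :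
    Summable (conv A f N) ∧ ∑' k, conv A f N k = (∑' j, ‖coef A j‖) * tailSum f N := by
  have h := summable_conv_aux hA hf N
  refine ⟨h.prod_symm.prod, ?_⟩
  unfold conv
  rw [Summable.tsum_comm (f := fun j k => ‖coef A j‖ * tail f N (k - j)) h,
    ← tsum_mul_right]
  refine tsum_congr fun j => ?_
  rw [tsum_mul_left, tailSum, ← (Equiv.subRight j).tsum_eq (tail f N)]
  rfl

/-- The hypothesis on the support of `A` leaves only coefficients of `f` of index at least `N` in
absolute value in the convolution. -/
lemma norm_coef_mul_le (hA : Sm A) (hf : Sm f) {N : ℕ} {k : ℤ}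
    (h : ∀ j, coef A j ≠ 0 → (N : ℤ) ≤ |k - j|) :
    ‖coef (fun z => A z * f z) k‖ ≤ conv A f N k := by
  have h1 := hasSum_coef_mul hA.summable hA.hasSum hf k
  have h2 : ∀ j, ‖coef A j * coef f (k - j)‖ = ‖coef A j‖ * tail f N (k - j) := by
    intro j
    by_cases hj : coef A j = 0
    · simp [hj]
    · rw [norm_mul, tail, if_pos (h j hj)]
  have h3 : Summable fun j => ‖coef A j * coef f (k - j)‖ := by
    simp only [h2]
    exact (summable_conv_aux hA hf N).prod_symm.prod_factor k
  rw [← h1.tsum_eq, conv]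
  simp only [← h2]
  exact norm_tsum_le_tsum_norm h3

/-- A priori bound for solutions of the linear system satisfied by a column of a stripped loop. -/
lemma column_bound (hA : Sm A) (hB : Sm B) (hf : Sm f) (hw : Sm w) {κ : ℂ} {N : ℕ}
    (hBA : ∀ k, ‖coef B k‖ ≤ conv A f N k)
    (hAB : ∀ k, ‖coef (fun z => A z - κ) k‖ ≤ conv B w N k)
    (hs : tailSum f N * tailSum w N ≤ 1 / 4) :
    ∑' k, ‖coef B k‖ ≤ 2 * ‖κ‖ * tailSum f N ∧
      ∑' k, ‖coef (fun z => A z - κ) k‖ ≤ 2 * ‖κ‖ * (tailSum f N * tailSum w N) := by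
  have hAκ : Sm (fun z => A z - κ) := hA.sub (.const κ)
  obtain ⟨s1, e1⟩ := conv_sum hA hf N
  obtain ⟨s2, e2⟩ := conv_sum hB hw N
  have b1 := Summable.tsum_le_tsum hBA hB.summable s1
  have b2 := Summable.tsum_le_tsum hAB hAκ.summable s2
  rw [e1] at b1
  rw [e2] at b2
  have hf0 := tailSum_nonneg f N
  have hw0 := tailSum_nonneg w N
  have b3 : ∑' k, ‖coef A k‖ ≤ ‖κ‖ + ∑' k, ‖coef (fun z => A z - κ) k‖ := by
    have hsd : HasSum (fun k : ℤ => if k = 0 then ‖κ‖ else 0) ‖κ‖ := hasSum_ite_eq 0 _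
    rw [← hsd.tsum_eq, ← hsd.summable.tsum_add hAκ.summable]
    refine Summable.tsum_le_tsum (fun k => ?_) hA.summable (hsd.summable.add hAκ.summable)
    rw [coef_sub hA (.const κ), coef_const]
    split_ifs with h
    · have := norm_add_le κ (coef A k - κ)
      rwa [add_sub_cancel] at this
    · simp
  set a := ∑' k, ‖coef A k‖
  set b := ∑' k, ‖coef B k‖
  set r := ∑' k, ‖coef (fun z => A z - κ) k‖
  have ha0 : 0 ≤ a := tsum_nonneg fun _ => norm_nonneg _
  have b4 : r ≤ a * (tailSum f N * tailSum w N) := by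
    calc r ≤ b * tailSum w N := b2
      _ ≤ a * tailSum f N * tailSum w N := by gcongr
      _ = _ := by ring
  have b5 : r ≤ a * (1 / 4) := b4.trans (by gcongr)
  -- From `a ≤ ‖κ‖ + r` and `r ≤ a / 4` the unknown `a` is absorbed on the left.
  have b6 : a ≤ 2 * ‖κ‖ := by linarith [norm_nonneg κ]
  exact ⟨b1.trans (by gcongr), b4.trans (by gcongr)⟩

lemma norm_le_tsum_coef (hA : Sm A) (z : Circle) : ‖A z‖ ≤ ∑' k, ‖coef A k‖ := by
  rw [← (hA.hasSum z).tsum_eq]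
  refine (norm_tsum_le_tsum_norm ?_).trans (le_of_eq ?_)
  · simpa only [norm_mul_zpow] using hA.summable
  · simp only [norm_mul_zpow]

lemma norm_coef_le_tsum (hA : Sm A) (k : ℤ) : ‖coef A k‖ ≤ ∑' k, ‖coef A k‖ :=
  hA.summable.le_tsum k fun _ _ => norm_nonneg _

/-- Support conditions complementary to `Tri`. -/
structure CoTri (S : Circle → Matrix (Fin 2) (Fin 2) ℂ) (N : ℕ) (κ : ℂ) : Prop where
  c00 : ∀ k > 0, mcoef S 0 0 k = 0
  c01 : ∀ k ≥ (N : ℤ), mcoef S 0 1 k = 0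
  c10 : ∀ k ≤ -(N : ℤ), mcoef S 1 0 k = 0
  c11 : ∀ k < 0, mcoef S 1 1 k = 0
  d00 : mcoef S 0 0 0 = κ
  d11 : mcoef S 1 1 0 = κ

variable {η : ℕ → ℂ × ℂ} {M : Circle → Matrix (Fin 2) (Fin 2) ℂ} {κ : ℂ}

/-- Unlike `Tri`, this holds for every `η`: the subtracted terms vanish at the frequencies
concerned, so `κ` does not change either. -/
lemma CoTri.strip (hM : MSm M) (h : CoTri M 0 κ) (N : ℕ) : CoTri (strip η M N) N κ := by
  induction N with
  | zero => exact h
  | succ N ih =>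
    refine ⟨fun k hk => ?_, fun k hk => ?_, fun k hk => ?_, fun k hk => ?_, ?_, ?_⟩
    · rw [mcoef_strip_zero hM, ih.c00 k hk, ih.c01 _ (by omega)]; simp
    · rw [mcoef_strip_one hM, ih.c01 k (by push_cast at hk; omega),
        ih.c00 _ (by push_cast at hk; omega)]; simp
    · rw [mcoef_strip_zero hM, ih.c10 k (by push_cast at hk; omega),
        ih.c11 _ (by push_cast at hk; omega)]; simp
    · rw [mcoef_strip_one hM, ih.c11 k hk, ih.c10 _ (by omega)]; simp
    · rw [mcoef_strip_zero hM, ih.d00, ih.c01 _ (by omega)]; simp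
    · rw [mcoef_strip_one hM, ih.d11, ih.c10 _ (by omega)]; simp

/-- Left multiplication by `[[1, w], [-f, 1]]`. -/
def mulUni (w f : Circle → ℂ) (M : Circle → Matrix (Fin 2) (Fin 2) ℂ) :
    Circle → Matrix (Fin 2) (Fin 2) ℂ := fun z => !![1, w z; -f z, 1] * M z

lemma mulUni_zero (z : Circle) (j : Fin 2) : mulUni w f M z 0 j = M z 0 j + w z * M z 1 j := by
  simp [mulUni, Matrix.mul_apply, Fin.sum_univ_two]

lemma mulUni_one (z : Circle) (j : Fin 2) : mulUni w f M z 1 j = M z 1 j - f z * M z 0 j := by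
  simp [mulUni, Matrix.mul_apply, Fin.sum_univ_two]
  ring

lemma msm_mulUni (hM : MSm M) (hw : Sm w) (hf : Sm f) : MSm (mulUni w f M) := by
  intro i j
  fin_cases i
  · simp only [Fin.zero_eta, mulUni_zero]
    exact (hM 0 j).add (hw.mul (hM 1 j))
  · simp only [Fin.mk_one, mulUni_one]
    exact (hM 1 j).sub (hf.mul (hM 0 j))

lemma mcoef_mulUni_zero (hM : MSm M) (hw : Sm w) (j : Fin 2) (k : ℤ) :
    mcoef (mulUni w f M) 0 j k = mcoef M 0 j k + coef (fun z => M z 1 j * w z) k := by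
  unfold mcoef
  simp only [mulUni_zero, mul_comm (w _)]
  exact coef_add (hM 0 j) ((hM 1 j).mul hw) k

lemma mcoef_mulUni_one (hM : MSm M) (hf : Sm f) (j : Fin 2) (k : ℤ) :
    mcoef (mulUni w f M) 1 j k = mcoef M 1 j k - coef (fun z => M z 0 j * f z) k := by
  unfold mcoef
  simp only [mulUni_one, mul_comm (f _)]
  exact coef_sub (hM 1 j) ((hM 0 j).mul hf) k

lemma conv_nonneg (A f : Circle → ℂ) (N : ℕ) (k : ℤ) : 0 ≤ conv A f N k :=
  tsum_nonneg fun _ => mul_nonneg (norm_nonneg _) (tail_nonneg _ _ _)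

/-- The bounds for both columns of a stripped loop. -/
lemma tri_bounds {N : ℕ} (hM : MSm M) (hf : Sm f) (hw : Sm w) (ht : Tri M N)
    (hc : CoTri (mulUni w f M) N κ) (hs : tailSum f N * tailSum w N ≤ 1 / 4) :
    ∑' k, ‖mcoef M 1 0 k‖ ≤ 2 * ‖κ‖ * tailSum f N ∧
    ∑' k, ‖coef (fun z => M z 0 0 - κ) k‖ ≤ 2 * ‖κ‖ * (tailSum f N * tailSum w N) ∧
    ∑' k, ‖mcoef M 0 1 k‖ ≤ 2 * ‖κ‖ * tailSum w N ∧
    ∑' k, ‖coef (fun z => M z 1 1 - κ) k‖ ≤ 2 * ‖κ‖ * (tailSum w N * tailSum f N) := by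
  have n00 : ∀ j, coef (fun z => M z 0 0) j ≠ 0 → 0 ≤ j := fun j hj => by
    by_contra h; exact hj (ht.c00 j (by omega))
  have n01 : ∀ j, coef (fun z => M z 0 1) j ≠ 0 → (N : ℤ) ≤ j := fun j hj => by
    by_contra h; exact hj (ht.c01 j (by omega))
  have n10 : ∀ j, coef (fun z => M z 1 0) j ≠ 0 → j ≤ -(N : ℤ) := fun j hj => by
    by_contra h; exact hj (ht.c10 j (by omega))
  have n11 : ∀ j, coef (fun z => M z 1 1) j ≠ 0 → j ≤ 0 := fun j hj => by
    by_contra h; exact hj (ht.c11 j (by omega))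
  -- `Tri` and `CoTri` prescribe complementary halves of the coefficients, so each entry, minus `κ`
  -- on the diagonal, is up to sign a projection of `f` or `w` times the other entry of its column.
  -- The second column is treated with `f` and `w` exchanged.
  have h1 := column_bound (κ := κ) (N := N) (hM 0 0) (hM 1 0) hf hw (fun k => ?_) (fun k => ?_) hs
  · have h2 := column_bound (κ := κ) (N := N) (hM 1 1) (hM 0 1) hw hf (fun k => ?_) (fun k => ?_)
      (by rwa [mul_comm])
    · exact ⟨h1.1, h1.2, h2.1, h2.2⟩
    · by_cases hk : k < N
      · rw [show coef (fun z => M z 0 1) k = 0 from ht.c01 k hk, norm_zero]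
        exact conv_nonneg _ _ _ _
      · have e := mcoef_mulUni_zero (f := f) hM hw 1 k
        rw [hc.c01 k (by omega)] at e
        have e2 : coef (fun z => M z 0 1) k = -coef (fun z => M z 1 1 * w z) k := by
          rw [mcoef] at e; linear_combination -e
        rw [e2, norm_neg]
        exact norm_coef_mul_le (hM 1 1) hw fun j hj => by
          have := n11 j hj
          rw [abs_of_nonneg (by omega)]; omega
    · rw [coef_sub (hM 1 1) (.const κ), coef_const]
      by_cases hk : 0 < k
      · rw [show coef (fun z => M z 1 1) k = 0 from ht.c11 k hk, if_neg (by omega), sub_zero,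
          norm_zero]
        exact conv_nonneg _ _ _ _
      · have e := mcoef_mulUni_one (w := w) hM hf 1 k
        have e2 : mcoef (mulUni w f M) 1 1 k = if k = 0 then κ else 0 := by
          split_ifs with h0
          · rw [h0, hc.d11]
          · exact hc.c11 k (by omega)
        have e3 : coef (fun z => M z 1 1) k - (if k = 0 then κ else 0) =
            coef (fun z => M z 0 1 * f z) k := by
          rw [← e2, e, mcoef]; ring
        rw [e3]
        exact norm_coef_mul_le (hM 0 1) hf fun j hj => by
          have := n01 j hj
          rw [abs_of_nonpos (by omega)]; omega
  · by_cases hk : k > -(N : ℤ)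
    · rw [show coef (fun z => M z 1 0) k = 0 from ht.c10 k hk, norm_zero]
      exact conv_nonneg _ _ _ _
    · have e := mcoef_mulUni_one (w := w) hM hf 0 k
      rw [hc.c10 k (by omega)] at e
      have e2 : coef (fun z => M z 1 0) k = coef (fun z => M z 0 0 * f z) k := by
        rw [mcoef] at e; linear_combination -e
      rw [e2]
      exact norm_coef_mul_le (hM 0 0) hf fun j hj => by
        have := n00 j hj
        rw [abs_of_nonpos (by omega)]; omega
  · rw [coef_sub (hM 0 0) (.const κ), coef_const]
    by_cases hk : k < 0
    · rw [show coef (fun z => M z 0 0) k = 0 from ht.c00 k hk, if_neg (by omega), sub_zero,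
        norm_zero]
      exact conv_nonneg _ _ _ _
    · have e := mcoef_mulUni_zero (f := f) hM hw 0 k
      have e2 : mcoef (mulUni w f M) 0 0 k = if k = 0 then κ else 0 := by
        split_ifs with h0
        · rw [h0, hc.d00]
        · exact hc.c00 k (by omega)
      have e3 : coef (fun z => M z 0 0) k - (if k = 0 then κ else 0) =
          -coef (fun z => M z 1 0 * w z) k := by
        rw [← e2, e, mcoef]; ring
      rw [e3, norm_neg]
      exact norm_coef_mul_le (hM 1 0) hw fun j hj => by
        have := n10 j hj
        rw [abs_of_nonneg (by omega)]; omega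

/-- The triangular factorizations provide the unipotent multiplier. -/
lemma CondI3.exists_coTri {g : Loop} (h : CondI3 g) : ∃ (w f : Circle → ℂ) (κ : ℂ),
    Sm w ∧ Sm f ∧ κ ≠ 0 ∧ CoTri (mulUni w f g.mat) 0 κ := by
  obtain ⟨τ, hτ, ⟨y, α, β, γ, δ, hy, hu, hg⟩, ⟨x, α', β', γ', δ', hx, hu', hg'⟩⟩ := h
  have hτ' : conj τ ≠ 0 := (map_ne_zero _).2 hτ
  have e10 : ∀ z : Circle, g.mat z 1 0 - conj (y z) * g.mat z 0 0 = τ⁻¹ * γ z := fun z => by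
    have h1 := hg z
    rw [lower_mul_diag_mul] at h1
    simp [Loop.mat, h1]
  have e11 : ∀ z : Circle, g.mat z 1 1 - conj (y z) * g.mat z 0 1 = τ⁻¹ * δ z := fun z => by
    have h1 := hg z
    rw [lower_mul_diag_mul] at h1
    simp [Loop.mat, h1]
  have hinv : ∀ z : Circle, conj (g.mat z 1 1) = conj τ * α' z ∧
      -conj (g.mat z 1 0) = conj τ * β' z ∧
      -conj (g.mat z 0 1) = conj (x z) * (conj τ * α' z) + (conj τ)⁻¹ * γ' z ∧
      conj (g.mat z 0 0) = conj (x z) * (conj τ * β' z) + (conj τ)⁻¹ * δ' z := fun z => by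
    have h1 := hg' z
    rw [lower_mul_diag_mul, invStar_eq] at h1
    exact ⟨by simpa using congrFun (congrFun h1 0) 0, by simpa using congrFun (congrFun h1 0) 1,
      by simpa using congrFun (congrFun h1 1) 0, by simpa using congrFun (congrFun h1 1) 1⟩
  -- The second row of the factorization of `g^{-*}`, conjugated, shows that the holomorphic
  -- multiplier `w = x` makes the first row antiholomorphic, as `f = y^*` makes the second row
  -- holomorphic.
  have e00 : ∀ z : Circle, g.mat z 0 0 + x z * g.mat z 1 0 = τ⁻¹ * conj (δ' z) := fun z => by
    obtain ⟨-, h2, -, h4⟩ := hinv z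
    have h5 : conj (g.mat z 0 0) + conj (x z) * conj (g.mat z 1 0) = (conj τ)⁻¹ * δ' z := by
      linear_combination h4 - conj (x z) * h2
    simpa using congrArg conj h5
  have e01 : ∀ z : Circle, g.mat z 0 1 + x z * g.mat z 1 1 = -τ⁻¹ * conj (γ' z) := fun z => by
    obtain ⟨h1, -, h3, -⟩ := hinv z
    have h5 : conj (g.mat z 0 1) + conj (x z) * conj (g.mat z 1 1) = -(conj τ)⁻¹ * γ' z := by
      linear_combination -h3 + conj (x z) * h1
    simpa using congrArg conj h5
  refine ⟨fun z => x z, fun z => conj (y z), τ⁻¹, hx.sm, hy.sm.star, inv_ne_zero hτ,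
    fun k hk => ?_, fun k hk => ?_, fun k hk => ?_, fun k hk => ?_, ?_, ?_⟩ <;>
    simp only [mcoef, mulUni_zero, mulUni_one, e00, e01, e10, e11, ge_iff_le, Nat.cast_zero,
      neg_zero] at *
  · rw [coef_const_mul _ (fun z : Circle => conj (δ' z)), hu'.hol_δ.coef_conj_of_pos hk, mul_zero]
  · rw [coef_const_mul _ (fun z : Circle => conj (γ' z))]
    rcases hk.eq_or_lt with rfl | hk
    · rw [hu'.hol_γ.coef_conj_zero, hu'.γ_zero, map_zero, mul_zero]
    · rw [hu'.hol_γ.coef_conj_of_pos hk, mul_zero]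
  · rw [coef_const_mul _ (fun z : Circle => γ z)]
    rcases hk.eq_or_lt with rfl | hk
    · rw [hu.hol_γ.coef_zero, hu.γ_zero, mul_zero]
    · rw [hu.hol_γ.coef_of_neg hk, mul_zero]
  · rw [coef_const_mul _ (fun z : Circle => δ z), hu.hol_δ.coef_of_neg hk, mul_zero]
  · rw [coef_const_mul _ (fun z : Circle => conj (δ' z)), hu'.hol_δ.coef_conj_zero, hu'.δ_zero]
    simp
  · rw [coef_const_mul _ (fun z : Circle => δ z), hu.hol_δ.coef_zero, hu.δ_zero, mul_one]

/-- The parameters decay rapidly, and the stripped loops tend to a scalar matrix. -/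
theorem strip_decay (hM : MSm M) (hf : Sm f) (hw : Sm w) (hκ : κ ≠ 0)
    (hc : CoTri (mulUni w f M) 0 κ) (ht : ∀ N, Tri (strip η M N) N)
    (hl : ∀ N, Lead (strip η M N) N (η N)) :
    RapidlyDecreasing η ∧ ∀ z i j,
      Filter.Tendsto (fun N => strip η M N z i j) Filter.atTop (𝓝 (if i = j then κ else 0)) := by
  have htf := tendsto_tailSum hf
  have htw := tendsto_tailSum hw
  have htfw : Filter.Tendsto (fun N => tailSum f N * tailSum w N) Filter.atTop (𝓝 0) := by
    simpa using htf.mul htw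
  have hev : ∀ᶠ N in Filter.atTop, tailSum f N * tailSum w N ≤ 1 / 4 :=
    htfw.eventually (ge_mem_nhds (by norm_num))
  have hs := fun N => msm_strip (η := η) hM N
  have hb : ∀ {N}, tailSum f N * tailSum w N ≤ 1 / 4 → _ := fun {N} h =>
    tri_bounds (N := N) (hs N) hf hw (ht N) (by
      have h1 := (hc.strip (η := η) (msm_mulUni hM hw hf)) N
      have h2 : strip η (mulUni w f M) N = mulUni w f (strip η M N) :=
        funext fun z => strip_mul_left _ N z
      rwa [h2] at h1) h
  have hκ0 : 0 < ‖κ‖ := norm_pos_iff.2 hκ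
  refine ⟨?_, fun z i j => ?_⟩
  · have hη : ∀ᶠ N in Filter.atTop, ‖η N‖ ≤ 4 * (tailSum f N + tailSum w N) := by
      filter_upwards [hev] with N hN
      obtain ⟨h1, h2, h3, h4⟩ := hb hN
      -- Since the product of the tails is at most `1 / 4`, the central coefficients stay within
      -- `‖κ‖ / 2` of `κ`; division in `Lead` then transfers the bound of the off-diagonal entries
      -- to `η N`.
      have lb : ∀ {A : Circle → ℂ}, Sm A →
          ∑' k, ‖coef (fun z => A z - κ) k‖ ≤ 2 * ‖κ‖ * (tailSum f N * tailSum w N) →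
          ‖κ‖ / 2 ≤ ‖coef A 0‖ := by
        intro A hA h
        have h5 := (norm_coef_le_tsum (hA.sub (.const κ)) 0).trans h
        rw [coef_sub hA (.const κ), coef_const, if_pos rfl] at h5
        have h6 := norm_sub_norm_le κ (κ - coef A 0)
        rw [sub_sub_cancel, norm_sub_rev] at h6
        have h7 : 2 * ‖κ‖ * (tailSum f N * tailSum w N) ≤ 2 * ‖κ‖ * (1 / 4) := by gcongr
        linarith
      have l0 := lb (hs N 0 0) h2
      have l1 := lb (hs N 1 1) (by rwa [mul_comm (tailSum f N)])
      have ub : ∀ {x c d : ℂ} {t : ℝ}, c = x * d → ‖κ‖ / 2 ≤ ‖d‖ → ‖c‖ ≤ 2 * ‖κ‖ * t →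
          ‖x‖ ≤ 4 * t := by
        intro x c d t h h5 h6
        rw [h, norm_mul] at h6
        have h7 : ‖x‖ * (‖κ‖ / 2) ≤ 2 * ‖κ‖ * t := le_trans (by gcongr) h6
        refine le_of_mul_le_mul_right (a := ‖κ‖ / 2) ?_ (by positivity)
        linarith
      have u1 := ub (hl N).c10 l1 ((norm_coef_le_tsum (hs N 1 0) _).trans h1)
      have u2 := ub (hl N).c01 l0 ((norm_coef_le_tsum (hs N 0 1) _).trans h3)
      have f0 := tailSum_nonneg f N
      have w0 := tailSum_nonneg w N
      exact max_le (by linarith) (by linarith)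
    intro k
    obtain ⟨C1, hC1⟩ := exists_tailSum_le hf k
    obtain ⟨C2, hC2⟩ := exists_tailSum_le hw k
    obtain ⟨N₀, hN₀⟩ := Filter.eventually_atTop.1 hη
    have hn : 0 ≤ ∑ n ∈ Finset.range N₀, (n : ℝ) ^ k * ‖η n‖ :=
      Finset.sum_nonneg fun _ _ => by positivity
    have hC : 0 ≤ 4 * (C1 + C2) := by
      have := (mul_nonneg (by positivity) (tailSum_nonneg f 0)).trans (hC1 0)
      have := (mul_nonneg (by positivity) (tailSum_nonneg w 0)).trans (hC2 0)
      linarith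
    refine ⟨4 * (C1 + C2) + ∑ n ∈ Finset.range N₀, (n : ℝ) ^ k * ‖η n‖, fun N => ?_⟩
    rcases lt_or_ge N N₀ with h | h
    · have := Finset.single_le_sum (f := fun n : ℕ => (n : ℝ) ^ k * ‖η n‖)
        (fun _ _ => by positivity) (Finset.mem_range.2 h)
      linarith
    · have h1 : (N : ℝ) ^ k * ‖η N‖ ≤ (N : ℝ) ^ k * (4 * (tailSum f N + tailSum w N)) := by
        gcongr
        exact hN₀ N h
      linarith [hC1 N, hC2 N]
  · have hlim : ∀ {A : ℕ → Circle → ℂ} {c : ℂ} {t : ℕ → ℝ}, (∀ N, Sm (A N)) →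
        (∀ᶠ N in Filter.atTop, ∑' k, ‖coef (fun z => A N z - c) k‖ ≤ 2 * ‖κ‖ * t N) →
        Filter.Tendsto t Filter.atTop (𝓝 0) →
        Filter.Tendsto (fun N => A N z) Filter.atTop (𝓝 c) := by
      intro A c t hA h1 h2
      rw [tendsto_iff_norm_sub_tendsto_zero]
      refine squeeze_zero' (Filter.Eventually.of_forall fun _ => norm_nonneg _) ?_
        (by simpa using h2.const_mul (2 * ‖κ‖))
      filter_upwards [h1] with N hN
      exact (norm_le_tsum_coef ((hA N).sub (.const c)) z).trans hN
    fin_cases i <;> fin_cases j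
    · exact hlim (fun N => hs N 0 0) (hev.mono fun N h => (hb h).2.1) htfw
    · refine hlim (c := 0) (fun N => hs N 0 1) (hev.mono fun N h => ?_) htw
      simp only [sub_zero]; exact (hb h).2.2.1
    · refine hlim (c := 0) (fun N => hs N 1 0) (hev.mono fun N h => ?_) htf
      simp only [sub_zero]; exact (hb h).1
    · refine hlim (fun N => hs N 1 1) (hev.mono fun N h => (hb h).2.2.2) ?_
      simpa only [mul_comm] using htfw

end

section

/-! ### Existence of root factorizations -/

/-- The principal square root serves: it is continuous at `1`, the limit of the radicands. -/
lemma exists_roots {η : ℕ → ℂ × ℂ} (hr : RapidlyDecreasing η)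
    (hnd : ∀ n, 1 - (η n).1 * (η n).2 ≠ 0) : ∃ s, IsParam₁ s η := by
  refine ⟨fun n => ((1 - (η n).1 * (η n).2)⁻¹) ^ ((2 : ℕ) : ℂ)⁻¹, hr, hnd,
    fun n => Complex.cpow_nat_inv_pow _ two_ne_zero, ?_⟩
  have h0 : Filter.Tendsto η Filter.atTop (𝓝 (0, 0)) :=
    tendsto_zero_iff_norm_tendsto_zero.2 hr.tendsto_zero
  have h1 : Filter.Tendsto (fun n => (1 - (η n).1 * (η n).2)⁻¹) Filter.atTop (𝓝 1) := by
    have h2 : Filter.Tendsto (fun n => (1 - (η n).1 * (η n).2)) Filter.atTop (𝓝 1) := by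
      have := ((h0.fst_nhds).mul (h0.snd_nhds)).const_sub 1
      simpa using this
    simpa using h2.inv₀ one_ne_zero
  have h2 := h1.cpow (tendsto_const_nhds (x := ((2 : ℕ) : ℂ)⁻¹)) (by simp)
  simpa using h2

/-- The sequence of roots with the initial root multiplied by `ε`. -/
def rescale (ε : ℂ) (s : ℕ → ℂ) (n : ℕ) : ℂ := if n = 0 then ε * s 0 else s n

lemma rootProd₁_rescale (ε : ℂ) (s : ℕ → ℂ) (η : ℕ → ℂ × ℂ) (N : ℕ) (z : Circle) :
    rootProd₁ (rescale ε s) η N z = ε • rootProd₁ s η N z := by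
  induction N with
  | zero => simp only [rootProd₁, rootFactor₁, rescale, if_true, smul_smul]
  | succ N ih =>
    rw [rootProd₁, ih, Matrix.mul_smul, rootProd₁, rescale, if_neg N.succ_ne_zero]

lemma IsParam₁.rescale {ε : ℂ} (hε : ε ^ 2 = 1) {s : ℕ → ℂ} {η : ℕ → ℂ × ℂ} (h : IsParam₁ s η) :
    IsParam₁ (rescale ε s) η := by
  refine ⟨h.rapid, h.nondeg, fun n => ?_, ?_⟩
  · unfold SLLoop.rescale
    split_ifs with hn
    · subst hn
      rw [mul_pow, hε, one_mul, h.root]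
    · exact h.root n
  · refine h.root_tendsto.congr' ?_
    filter_upwards [Filter.eventually_ne_atTop 0] with n hn
    rw [SLLoop.rescale, if_neg hn]

lemma SmoothTendsto.smul {G : ℕ → Circle → Matrix (Fin 2) (Fin 2) ℂ}
    {M : Circle → Matrix (Fin 2) (Fin 2) ℂ} (h : SmoothTendsto G M) (ε : ℂ) :
    SmoothTendsto (fun N z => ε • G N z) (fun z => ε • M z) := by
  intro m i j
  have := (uniformContinuous_const_smul ε).comp_tendstoUniformly (h m i j)
  simpa only [Matrix.smul_apply, smul_eq_mul, iteratedDeriv_const_mul_field, Function.comp_def]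
    using this

/-- A loop for which no denominator vanishes has a root factorization. -/
theorem IsForm₁.exists_factorization {g : Loop} {a b c d : ℂ → ℂ} (h : IsForm₁ g a b c d)
    (hg : IsSmoothLoop g) {v : ℕ ⊕ ℕ → ℂ}
    (hv : v = laurentData (fun z => b z / a z) (fun z => c z / d z))
    (hq : ∀ N, (Rows.iter v N).q ≠ 0) :
    ∃ s, IsRootFactorization₁ g s
      (fun N => ((Rows.iter v N).m / (Rows.iter v N).q, (Rows.iter v N).p / (Rows.iter v N).q)) := by
  set η : ℕ → ℂ × ℂ :=
    fun N => ((Rows.iter v N).m / (Rows.iter v N).q, (Rows.iter v N).p / (Rows.iter v N).q) with hη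
  have hs := h.strip_of_q_ne_zero hg hv hq (fun N => rfl : ∀ N, η N = _)
  obtain ⟨w, f, κ, hw, hf, hκ, hc⟩ := h.condI3.exists_coTri
  obtain ⟨hr, hlim⟩ := strip_decay hg.msm hf hw hκ hc (fun N => (hs N).1) (fun N => (hs N).2.1)
  have hnd : ∀ n, 1 - (η n).1 * (η n).2 ≠ 0 := by
    intro n h0
    apply hq (n + 1)
    have hqn := hq n
    have : (Rows.iter v n).q ^ 2 * (1 - (η n).1 * (η n).2) = (Rows.iter v (n + 1)).q := by
      rw [Rows.q_succ]
      simp only [hη]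
      field_simp
    rw [← this, h0, mul_zero]
  obtain ⟨s, hp⟩ := exists_roots hr hnd
  obtain ⟨g', hg', hf'⟩ := hp.exists_loop
  have hκ' := hf'.center_ne_zero hg'
  set κ' := mcoef g'.mat 0 0 0
  -- The central coefficient of a partial product is the product of its roots.
  have hprod : Filter.Tendsto (fun N => ∏ n ∈ Finset.range (N + 1), (s n)⁻¹) Filter.atTop
      (𝓝 κ'⁻¹) := by
    have h1 := hf'.2.tendsto_mcoef (fun N i j => sm_rootProd₁ N i j) hg'.msm 0 0 0
    refine (h1.inv₀ hκ').congr fun N => ?_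
    have h2 := (band_strip_rootProd₁ hp 0 N).2.2.1
    simp only [Finset.range_zero, Finset.prod_empty, one_mul, zero_add] at h2
    rw [Finset.prod_inv_distrib, ← h2]
    rfl
  -- The stripped loop times the partial product is a scalar times `g`; in the limit `κ • g' = κ'⁻¹
  -- • g`.
  have hgg : ∀ z, (g z).1 = (κ * κ') • (g' z).1 := by
    intro z
    have hT : Filter.Tendsto (fun N => strip η g.mat (N + 1) z) Filter.atTop
        (𝓝 (κ • (1 : Matrix (Fin 2) (Fin 2) ℂ))) := by
      refine tendsto_pi_nhds.2 fun i => tendsto_pi_nhds.2 fun j => ?_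
      have := (hlim z i j).comp (Filter.tendsto_add_atTop_nat 1)
      simpa [Matrix.one_apply, Function.comp_def] using this
    have hP : Filter.Tendsto (fun N => rootProd₁ s η N z) Filter.atTop (𝓝 (g' z).1) := by
      refine tendsto_pi_nhds.2 fun i => tendsto_pi_nhds.2 fun j => ?_
      rw [Metric.tendsto_nhds]
      intro ε hε
      filter_upwards [hf'.2.eventually_dist_lt hε] with N hN
      rw [dist_eq_norm]
      exact hN z i j
    have h1 := hT.mul hP
    simp only [strip_mul_rootProd₁ hp] at h1
    have h2 := tendsto_nhds_unique h1 (hprod.smul_const (g z).1)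
    rw [Matrix.smul_mul, Matrix.one_mul] at h2
    rw [mul_comm, mul_smul, h2, smul_smul, mul_inv_cancel₀ hκ', one_smul]
  have hε : (κ * κ') ^ 2 = 1 := by
    have h1 := (g 1).2
    have h2 := (g' 1).2
    rw [hgg, Matrix.det_smul, h2] at h1
    simpa using h1
  -- The factor `κ * κ'` is `±1` by determinants, and admissibility does not restrict the sign of a
  -- single root.
  refine ⟨rescale (κ * κ') s, hp.rescale hε, ?_⟩
  have := hf'.2.smul (κ * κ')
  simp only [← hgg, ← rootProd₁_rescale] at this
  exact this

end

section

/-! ### Loops of the second kind -/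

/-- Conjugation by the antidiagonal permutation matrix. -/
def flip (M : Matrix (Fin 2) (Fin 2) ℂ) : Matrix (Fin 2) (Fin 2) ℂ :=
  M.submatrix Fin.revPerm Fin.revPerm

lemma flip_mul (M N : Matrix (Fin 2) (Fin 2) ℂ) : flip (M * N) = flip M * flip N :=
  (Matrix.submatrix_mul_equiv M N _ _ _).symm

lemma flip_flip (M : Matrix (Fin 2) (Fin 2) ℂ) : flip (flip M) = M := by
  ext i j
  simp [flip]

lemma flip_fin (a b c d : ℂ) : flip !![a, b; c, d] = !![d, c; b, a] := by
  ext i j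
  fin_cases i <;> fin_cases j <;> rfl

/-- Conjugation of a loop by the antidiagonal permutation matrix. -/
def Loop.flip (g : Loop) : Loop := fun z =>
  ⟨SLLoop.flip (g z).1, by rw [SLLoop.flip, Matrix.det_submatrix_equiv_self]; exact (g z).2⟩

variable {g : Loop} {s : ℕ → ℂ} {ζ : ℕ → ℂ × ℂ}

lemma Loop.flip_flip (g : Loop) : g.flip.flip = g :=
  funext fun z => Subtype.ext (SLLoop.flip_flip (g z).1)

lemma IsSmoothLoop.flip (hg : IsSmoothLoop g) : IsSmoothLoop g.flip := fun _ _ => hg _ _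

lemma SmoothTendsto.flip {G : ℕ → Circle → Matrix (Fin 2) (Fin 2) ℂ}
    {M : Circle → Matrix (Fin 2) (Fin 2) ℂ} (h : SmoothTendsto G M) :
    SmoothTendsto (fun N z => SLLoop.flip (G N z)) (fun z => SLLoop.flip (M z)) :=
  fun m _ _ => h m _ _

lemma flip_rootFactor₁ (c : ℂ) (e : ℂ × ℂ) (n : ℕ) (z : ℂ) :
    flip (rootFactor₁ c e n z) = rootFactor₂ c e n z := by
  ext i j
  fin_cases i <;> fin_cases j <;> rfl

/-- The values at index `0` are reset so that the additional factor there is the identity. -/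
lemma flip_rootProd₁ (s : ℕ → ℂ) (ζ : ℕ → ℂ × ℂ) (N : ℕ) (z : Circle) :
    flip (rootProd₁ (Function.update s 0 1) (Function.update ζ 0 0) N z) = rootProd₂ s ζ N z := by
  induction N with
  | zero =>
    simp only [rootProd₁, flip_rootFactor₁, rootProd₂, rootFactor₂, Function.update_self]
    ext i j
    fin_cases i <;> fin_cases j <;> simp
  | succ N ih =>
    rw [rootProd₁, flip_mul, ih, flip_rootFactor₁, rootProd₂,
      Function.update_of_ne N.succ_ne_zero, Function.update_of_ne N.succ_ne_zero]

lemma IsParam₂.isParam₁ (h : IsParam₂ s ζ) :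
    IsParam₁ (Function.update s 0 1) (Function.update ζ 0 0) := by
  refine ⟨fun k => ?_, fun n => ?_, fun n => ?_, ?_⟩
  · obtain ⟨C, hC⟩ := h.rapid k
    refine ⟨C, fun n => le_trans ?_ (hC n)⟩
    gcongr
    rcases eq_or_ne n 0 with rfl | hn
    · simp
    · rw [Function.update_of_ne hn]
  · rcases eq_or_ne n 0 with rfl | hn
    · simp
    · rw [Function.update_of_ne hn]
      exact h.nondeg n (Nat.one_le_iff_ne_zero.2 hn)
  · rcases eq_or_ne n 0 with rfl | hn
    · simp
    · rw [Function.update_of_ne hn, Function.update_of_ne hn]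
      exact h.root n (Nat.one_le_iff_ne_zero.2 hn)
  · refine h.root_tendsto.congr' ?_
    filter_upwards [Filter.eventually_ne_atTop 0] with n hn
    rw [Function.update_of_ne hn]

/-- The root products of the second kind converge in `C^∞`. -/
theorem IsParam₂.exists_loop (h : IsParam₂ s ζ) :
    ∃ g : Loop, IsSmoothLoop g ∧ IsRootFactorization₂ g s ζ := by
  obtain ⟨g, hg, hf⟩ := h.isParam₁.exists_loop
  refine ⟨g.flip, hg.flip, h, ?_⟩
  have := hf.2.flip
  simp only [flip_rootProd₁] at this
  exact this

lemma IsRootFactorization₂.flip (h : IsRootFactorization₂ g s ζ) :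
    IsRootFactorization₁ g.flip (Function.update s 0 1) (Function.update ζ 0 0) := by
  refine ⟨h.1.isParam₁, ?_⟩
  have := h.2.flip
  simp only [← flip_rootProd₁, flip_flip] at this
  exact this

lemma IsForm₂.flip {a b c d : ℂ → ℂ} (h : IsForm₂ g a b c d) : IsForm₁ g.flip d c b a where
  hol_a := h.hol_d
  hol_b := h.hol_c
  hol_c := h.hol_b
  hol_d := h.hol_a
  eq_on_circle z := by
    rw [← flip_fin, ← h.eq_on_circle]
    rfl
  center := h.center.symm
  center_ne := h.center_ne
  no_common_zero_ab z hz h0 := h.no_common_zero_cd z hz h0.symm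
  no_common_zero_cd z hz h0 := h.no_common_zero_ab z hz h0.symm

lemma IsForm₁.flip {a b c d : ℂ → ℂ} (h : IsForm₁ g a b c d) (hb : b 0 = 0) (hc : c 0 = 0) :
    IsForm₂ g.flip d c b a where
  hol_a := h.hol_d
  hol_b := h.hol_c
  hol_c := h.hol_b
  hol_d := h.hol_a
  eq_on_circle z := by
    rw [← flip_fin, ← h.eq_on_circle]
    rfl
  b_zero := hc
  c_zero := hb
  center := h.center.symm
  center_ne := h.center_ne
  no_common_zero_ab z hz h0 := h.no_common_zero_cd z hz h0.symm
  no_common_zero_cd z hz h0 := h.no_common_zero_ab z hz h0.symm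

/-- After flipping, the parameter at index `0` is zero, and `Lead` at `N = 0` forces both
off-diagonal entries to vanish at the center. -/
theorem IsRootFactorization₂.exists_form (h : IsRootFactorization₂ g s ζ) (hg : IsSmoothLoop g) :
    CondII1 g := by
  obtain ⟨a, b, c, d, hF⟩ := h.flip.exists_form hg.flip
  have hl := h.flip.lead hg.flip 0
  have hb : b 0 = 0 := by
    have := hl.c01
    simp only [strip, mcoef, hF.apply01] at this
    rw [← hF.hol_b.coef_zero]
    simpa [strip] using this
  have hc : c 0 = 0 := by
    have := hl.c10
    simp only [strip, mcoef, hF.apply10] at this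
    rw [← map_eq_zero (starRingEnd ℂ), ← hF.hol_c.coef_conj_zero]
    simpa [strip] using this
  exact ⟨d, c, b, a, g.flip_flip ▸ hF.flip hb hc⟩

/-- The sequence of roots with the initial root moved to the next index. -/
def absorb (s : ℕ → ℂ) : ℕ → ℂ := Function.update s 1 (s 0 * s 1)

/-- A product of the second kind has no factor of index `0`, so a scalar `s 0` must be carried by
the factor of index `1`. Hence the products agree only from index `1` on. -/
lemma rootProd₂_absorb (s : ℕ → ℂ) {η : ℕ → ℂ × ℂ} (h0 : η 0 = 0) (N : ℕ) (z : Circle) :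
    rootProd₂ (absorb s) η (N + 1) z = flip (rootProd₁ s η (N + 1) z) := by
  induction N with
  | zero =>
    rw [rootProd₂, rootProd₂, rootProd₁, rootProd₁, flip_mul, flip_rootFactor₁, h0]
    simp only [rootFactor₁, rootFactor₂, absorb]
    ext i j
    fin_cases i <;> fin_cases j <;>
      simp [flip, Matrix.mul_apply, Fin.sum_univ_two] <;> ring
  | succ N ih =>
    have h1 : rootProd₁ s η (N + 1 + 1) z =
        rootFactor₁ (s (N + 1 + 1)) (η (N + 1 + 1)) (N + 1 + 1) z * rootProd₁ s η (N + 1) z := rfl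
    rw [rootProd₂, ih, h1, flip_mul, flip_rootFactor₁, absorb, Function.update_of_ne (by omega)]

theorem IsForm₂.condII2 {a b c d : ℂ → ℂ} (h : IsForm₂ g a b c d)
    (hg : IsSmoothLoop g) {v : ℕ ⊕ ℕ → ℂ}
    (hv : v = laurentData (fun z => c z / d z) (fun z => b z / a z))
    (hq : ∀ N, 1 ≤ N → (Rows.iter v N).q ≠ 0) : CondII2 g := by
  have hq0 : (Rows.iter v 0).q = 1 := by simp [Rows.iter, Rows.q]
  have hq' : ∀ N, (Rows.iter v N).q ≠ 0 := fun N => by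
    rcases Nat.eq_zero_or_pos N with rfl | hN
    · rw [hq0]
      exact one_ne_zero
    · exact hq N hN
  obtain ⟨s, hf⟩ := h.flip.exists_factorization hg.flip hv hq'
  set η : ℕ → ℂ × ℂ :=
    fun N => ((Rows.iter v N).m / (Rows.iter v N).q, (Rows.iter v N).p / (Rows.iter v N).q) with hη
  have h0 : η 0 = 0 := by
    simp [hη, Rows.iter, Rows.q, Rows.m, Rows.p, hv, laurentData, taylorCoeff, h.b_zero, h.c_zero]
  -- Vanishing of `b` and `c` at `0` gives `η 0 = 0`, so `s 0` is a sign and moving it preserves the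
  -- root equation at index `1`.
  have hs0 : s 0 ^ 2 = 1 := by
    rw [hf.1.root, h0]
    simp
  refine ⟨absorb s, η, ⟨hf.1.rapid, fun n _ => hf.1.nondeg n, fun n _ => ?_, ?_⟩, ?_⟩
  · rcases eq_or_ne n 1 with rfl | hn
    · rw [absorb, Function.update_self, mul_pow, hs0, one_mul, hf.1.root]
    · rw [absorb, Function.update_of_ne hn, hf.1.root]
  · refine hf.1.root_tendsto.congr' ?_
    filter_upwards [Filter.eventually_ne_atTop 1] with n hn
    rw [absorb, Function.update_of_ne hn]
  · have h1 := hf.2.flip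
    intro m i j u hu
    filter_upwards [h1 m i j u hu, Filter.eventually_ge_atTop 1] with N hN hN1
    obtain ⟨N, rfl⟩ := Nat.exists_eq_add_of_le' hN1
    simp only [rootProd₂_absorb s h0]
    simpa only [Loop.flip, flip_flip] using hN

end

end

end SLLoop

/-! ### Assembly of the two kinds of loops -/

theorem theorem0p2 :
    -- Loops of the first kind: the infinite products converge in `C^∞(S¹, SL(2,ℂ))`;
    (∀ (s : ℕ → ℂ) (η : ℕ → ℂ × ℂ), SLLoop.IsParam₁ s η →
      ∃ g : SLLoop.Loop, SLLoop.IsSmoothLoop g ∧ SLLoop.IsRootFactorization₁ g s η) ∧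
    -- (I.1) and (I.3) are equivalent, and (I.2) implies both;
    (∀ g : SLLoop.Loop, SLLoop.IsSmoothLoop g →
      (SLLoop.CondI1 g ↔ SLLoop.CondI3 g) ∧
      (SLLoop.CondI2 g → SLLoop.CondI1 g ∧ SLLoop.CondI3 g)) ∧
    -- generic converse: there are universal rational functions `m k / q k` and `p k / q k` of the
    -- coefficients of `b/a` and `c^*/d^*` giving the coordinates of every factorization, and a
    -- factorization exists as soon as none of the denominators vanishes.
    (∃ m p q : ℕ → MvPolynomial (ℕ ⊕ ℕ) ℂ, (∀ k, q k ≠ 0) ∧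
      ∀ g : SLLoop.Loop, SLLoop.IsSmoothLoop g →
      ∀ a b c d : ℂ → ℂ, SLLoop.IsForm₁ g a b c d →
      ∀ v : ℕ ⊕ ℕ → ℂ, v = SLLoop.laurentData (fun z => b z / a z) (fun z => c z / d z) →
        (∀ (s : ℕ → ℂ) (η : ℕ → ℂ × ℂ), SLLoop.IsRootFactorization₁ g s η →
          ∀ k : ℕ, MvPolynomial.eval v (q k) ≠ 0 ∧
            (η k).1 = MvPolynomial.eval v (m k) / MvPolynomial.eval v (q k) ∧
            (η k).2 = MvPolynomial.eval v (p k) / MvPolynomial.eval v (q k)) ∧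
        ((∀ k : ℕ, MvPolynomial.eval v (q k) ≠ 0) → SLLoop.CondI2 g)) ∧
    -- Loops of the second kind: the same statements, with coordinates indexed by `k ≥ 1` and
    -- the coefficients of `c/d` and `b^*/a^*`.
    (∀ (s : ℕ → ℂ) (ζ : ℕ → ℂ × ℂ), SLLoop.IsParam₂ s ζ →
      ∃ g : SLLoop.Loop, SLLoop.IsSmoothLoop g ∧ SLLoop.IsRootFactorization₂ g s ζ) ∧
    (∀ g : SLLoop.Loop, SLLoop.IsSmoothLoop g →
      (SLLoop.CondII1 g ↔ SLLoop.CondII3 g) ∧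
      (SLLoop.CondII2 g → SLLoop.CondII1 g ∧ SLLoop.CondII3 g)) ∧
    (∃ m p q : ℕ → MvPolynomial (ℕ ⊕ ℕ) ℂ, (∀ k, 1 ≤ k → q k ≠ 0) ∧
      ∀ g : SLLoop.Loop, SLLoop.IsSmoothLoop g →
      ∀ a b c d : ℂ → ℂ, SLLoop.IsForm₂ g a b c d →
      ∀ v : ℕ ⊕ ℕ → ℂ, v = SLLoop.laurentData (fun z => c z / d z) (fun z => b z / a z) →
        (∀ (s : ℕ → ℂ) (ζ : ℕ → ℂ × ℂ), SLLoop.IsRootFactorization₂ g s ζ →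
          ∀ k : ℕ, 1 ≤ k → MvPolynomial.eval v (q k) ≠ 0 ∧
            (ζ k).1 = MvPolynomial.eval v (m k) / MvPolynomial.eval v (q k) ∧
            (ζ k).2 = MvPolynomial.eval v (p k) / MvPolynomial.eval v (q k)) ∧
        ((∀ k : ℕ, 1 ≤ k → MvPolynomial.eval v (q k) ≠ 0) → SLLoop.CondII2 g)) := by
  refine ⟨fun s η h => h.exists_loop, fun g hg => ⟨⟨fun ⟨_, _, _, _, h⟩ => h.condI3, fun h => h.condI1⟩,
    fun ⟨s, η, h⟩ => ?_⟩, ?_, fun s ζ h => h.exists_loop,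
    fun g hg => ⟨⟨fun ⟨_, _, _, _, h⟩ => h.condII3, fun h => h.condII1⟩, fun ⟨s, ζ, h⟩ => ?_⟩, ?_⟩
  · obtain ⟨a, b, c, d, hF⟩ := h.exists_form hg
    exact ⟨⟨a, b, c, d, hF⟩, hF.condI3⟩
  · refine ⟨fun k => (SLLoop.Rows.univ k).m, fun k => (SLLoop.Rows.univ k).p,
      fun k => (SLLoop.Rows.univ k).q, SLLoop.Rows.univ_q_ne_zero, ?_⟩
    intro g hg a b c d h v hv
    simp only [SLLoop.Rows.eval_q, SLLoop.Rows.eval_p, SLLoop.Rows.eval_m]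
    refine ⟨fun s η hf k => ?_, fun hq => ?_⟩
    · obtain ⟨h1, h2, h3⟩ := h.rational hg hf k
      rw [← hv] at h1 h2 h3
      exact ⟨h1, by rw [h2, mul_div_cancel_right₀ _ h1], by rw [h3, mul_div_cancel_right₀ _ h1]⟩
    · obtain ⟨s, hs⟩ := h.exists_factorization hg hv hq
      exact ⟨s, _, hs⟩
  · obtain ⟨a, b, c, d, hF⟩ := h.exists_form hg
    exact ⟨⟨a, b, c, d, hF⟩, hF.condII3⟩
  · refine ⟨fun k => (SLLoop.Rows.univ k).m, fun k => (SLLoop.Rows.univ k).p,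
      fun k => (SLLoop.Rows.univ k).q, fun k _ => SLLoop.Rows.univ_q_ne_zero k, ?_⟩
    intro g hg a b c d h v hv
    simp only [SLLoop.Rows.eval_q, SLLoop.Rows.eval_p, SLLoop.Rows.eval_m]
    refine ⟨fun s ζ hf k hk => ?_, fun hq => h.condII2 hg hv hq⟩
    obtain ⟨h1, h2, h3⟩ := h.flip.rational hg.flip hf.flip k
    rw [← hv] at h1 h2 h3
    rw [Function.update_of_ne (Nat.one_le_iff_ne_zero.1 hk)] at h2 h3
    exact ⟨h1, by rw [h2, mul_div_cancel_right₀ _ h1], by rw [h3, mul_div_cancel_right₀ _ h1]⟩
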